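/- Let $\mathbb{K}$ be a field and let $q\in\mathbb{K}^*$ be not a root of unity. The quantum spatial ageing algebra $\mathcal{A}$ is the $\mathbb{K}$-algebra generated by $E,K,K^{-1},X,Y$ subject to $KK^{-1}=K^{-1}K=1$ and $$EK=q^{-2}KE,\quad XK=q^{-1}KX,\quad YK=qKY,\quad EX=qXE,\quad EY=X+q^{-1}YE,\quad qYX=XY.$$ Put $D=\mathbb{K}[K^{\pm1}]$, $\varphi=EY-qYE$, $Z=\varphi YK^{-1}$, $C=XYK$; $(S)$ denotes the two-sided ideal generated by $S$, and $\mathrm{Max}(\mathcal{A})$ the set of maximal two-sided ideals. For an algebra $R$ and a commutative domain $B\subseteq R$, an $R$-module $M$ is called $B$-torsion if every element of $M$ is annihilated by a non-zero element of $B$; $\hat R(B\text{-torsion})$ is the set of isomorphism classes of simple $B$-torsion $R$-modules, and $\mathrm{Supp}_B(M)$ is the set of $\mathfrak{m}\in\mathrm{Max}(B)$ such that $\mathfrak{m}v=0$ for some $0\neq v\in M$. Let $\hat{\mathcal{A}}(D\text{-torsion},S)$ be the set of isomorphism classes of simple $D$-torsion $\mathcal{A}$-modules whose annihilator lies in the set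 of ideals $S$, and $\hat{\mathcal{A}}(D\text{-torsion},\mathfrak{p})=\hat{\mathcal{A}}(D\text{-torsion},\{\mathfrak{p}\})$. 1. The set of annihilators of the simple $D$-torsion $\mathcal{A}$-modules is the disjoint union $\mathrm{Max}(\mathcal{A})\sqcup\{0\}$. In particular, $\hat{\mathcal{A}}(D\text{-torsion},(Y))=\emptyset$ and $\hat{\mathcal{A}}(D\text{-torsion},(E))=\emptyset$. 2. $\mathrm{Max}(\mathcal{A})=\mathcal{P}\sqcup\mathcal{Q}\sqcup\mathcal{R}$, where $\mathcal{P}=\{(Y,E,\mathfrak{p})\mid\mathfrak{p}\in\mathrm{Max}(\mathbb{K}[K^{\pm1}])\}$, $\mathcal{Q}=\{(X,\mathfrak{q})\mid\mathfrak{q}\in\mathrm{Max}(\mathbb{K}[Z])\setminus\{(Z)\}\}$ and $\mathcal{R}=\{(\varphi,\mathfrak{r})\mid\mathfrak{r}\in\mathrm{Max}(\mathbb{K}[C])\setminus\{(C)\}\}$. Moreover: (a) $\hat{\mathcal{A}}(D\text{-torsion},\mathcal{P})$ is the set of isomorphism classes of simple finite-dimensional $\mathcal{A}$-modules. (b) $\hat{\mathcal{A}}(D\text{-torsion},\mathcal{Q})=\bigsqcup_{\mathfrak{p}\in\mathcal{Q}}\hat{\mathcal{A}}(D\text{-torsion},\mathfrak{p})$.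 Let $\mathfrak{p}=(X,\mathfrak{q})\in\mathcal{Q}$ with $\mathfrak{q}\in\mathrm{Max}(\mathbb{K}[Z])\setminus\{(Z)\}$, $L=\mathbb{K}[Z]/\mathfrak{q}$ and $D_{\mathfrak{q}}=L[K^{\pm1}]$, and let $\rho$ be the $L$-automorphism of $D_{\mathfrak{q}}$ with $\rho(K)=qK$. There is an isomorphism $D_{\mathfrak{q}}[Y^{\pm1};\rho]\simeq\mathcal{A}/\mathfrak{p}$, where $D_{\mathfrak{q}}[Y^{\pm1};\rho]$ is the skew Laurent polynomial ring with $Yd=\rho(d)Y$ for $d\in D_{\mathfrak{q}}$, which is the identity on $\mathbb{K}$ and sends the class of $Z$ in $L$ and $K$, $Y$ to the classes of $Z$, $K$, $Y$ in $\mathcal{A}/\mathfrak{p}$. With $D_{\mathfrak{q}}$ regarded as a subring of $\mathcal{A}/\mathfrak{p}$ in this way, inflation along $\mathcal{A}\to\mathcal{A}/\mathfrak{p}$ identifies $\widehat{\mathcal{A}/\mathfrak{p}}(D_{\mathfrak{q}}\text{-torsion})$ with $\hat{\mathcal{A}}(D\text{-torsion},\mathfrak{p})$, and the map from the set of $\langle\rho\rangle$-orbits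 $$\mathrm{Max}(D_{\mathfrak{q}})/\langle\rho\rangle\to\widehat{\mathcal{A}/\mathfrak{p}}(D_{\mathfrak{q}}\text{-torsion}),\quad \mathcal{O}(\mathfrak{m})=\{\rho^i(\mathfrak{m})\mid i\in\mathbb{Z}\}\mapsto(\mathcal{A}/\mathfrak{p})/(\mathcal{A}/\mathfrak{p})\mathfrak{m},$$ is a well-defined bijection with inverse $M\mapsto\mathrm{Supp}_{D_{\mathfrak{q}}}(M)$. (c) The same statement as (b) holds with $\mathcal{Q}$, $X$, $Z$, $\mathfrak{q}$ replaced by $\mathcal{R}$, $\varphi$, $C$, $\mathfrak{r}$. (d) $\hat{\mathcal{A}}(D\text{-torsion},0)\neq\emptyset$. -/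

import Mathlib

universe u

open scoped Polynomial LaurentPolynomial

namespace Ageing

noncomputable section

/-! ### The quantum spatial ageing algebra -/

/-- The canonical generators. -/
inductive Gen : Type
  | E | K | Kinv | X | Y

section Algebra

variable {𝕜 : Type u} [Field 𝕜]

/-- A generator, seen in the free algebra. -/
def gen (g : Gen) : FreeAlgebra 𝕜 Gen := FreeAlgebra.ι 𝕜 g

/-- The defining relations. -/
inductive Rel (q : 𝕜ˣ) : FreeAlgebra 𝕜 Gen → FreeAlgebra 𝕜 Gen → Prop
  | K_Kinv : Rel q (gen .K * gen .Kinv) 1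
  | Kinv_K : Rel q (gen .Kinv * gen .K) 1
  | E_K : Rel q (gen .E * gen .K) (((q ^ (-2 : ℤ) : 𝕜ˣ) : 𝕜) • (gen .K * gen .E))
  | X_K : Rel q (gen .X * gen .K) (((q⁻¹ : 𝕜ˣ) : 𝕜) • (gen .K * gen .X))
  | Y_K : Rel q (gen .Y * gen .K) ((q : 𝕜) • (gen .K * gen .Y))
  | E_X : Rel q (gen .E * gen .X) ((q : 𝕜) • (gen .X * gen .E))
  | E_Y : Rel q (gen .E * gen .Y) (gen .X + ((q⁻¹ : 𝕜ˣ) : 𝕜) • (gen .Y * gen .E))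
  | Y_X : Rel q ((q : 𝕜) • (gen .Y * gen .X)) (gen .X * gen .Y)

/-- The quantum spatial ageing algebra `𝒜 = 𝕜_q[X, Y] ⋊ U_q^{≥0}(sl₂)`, by generators and
relations. -/
def Alg (q : 𝕜ˣ) : Type u := RingQuot (Rel q)

instance (q : 𝕜ˣ) : Ring (Alg q) := inferInstanceAs (Ring (RingQuot (Rel q)))

instance (q : 𝕜ˣ) : Algebra 𝕜 (Alg q) := inferInstanceAs (Algebra 𝕜 (RingQuot (Rel q)))

/-- The class of a generator in `𝒜`. -/
def elt (q : 𝕜ˣ) (g : Gen) : Alg q := RingQuot.mkAlgHom 𝕜 (Rel q) (gen g)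

/-- `K` as a unit of `𝒜`. -/
def unitK (q : 𝕜ˣ) : (Alg q)ˣ where
  val := elt q .K
  inv := elt q .Kinv
  val_inv := by
    have h := RingQuot.mkAlgHom_rel 𝕜 (Rel.K_Kinv (q := q))
    rwa [map_mul, map_one] at h
  inv_val := by
    have h := RingQuot.mkAlgHom_rel 𝕜 (Rel.Kinv_K (q := q))
    rwa [map_mul, map_one] at h

/-- The normal element `φ = EY - qYE`. -/
def elemPhi (q : 𝕜ˣ) : Alg q := elt q .E * elt q .Y - (q : 𝕜) • (elt q .Y * elt q .E)

/-- `Z = φ Y K⁻¹`. -/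
def elemZ (q : 𝕜ˣ) : Alg q := elemPhi q * elt q .Y * elt q .Kinv

/-- `C = X Y K`. -/
def elemC (q : 𝕜ˣ) : Alg q := elt q .X * elt q .Y * elt q .K

end Algebra

/-! ### Laurent polynomials -/

section Laurent

variable {k : Type*} [CommRing k]

/-- The `k`-algebra homomorphism `k[T;T⁻¹] → B` that sends `T` to a given unit of `B`. -/
def laurentHom {B : Type*} [Ring B] [Algebra k B] (u : Bˣ) : k[T;T⁻¹] →ₐ[k] B :=
  AddMonoidAlgebra.lift k B ℤ ((Units.coeHom B).comp (zpowersHom Bˣ u))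

theorem laurentHom_T {B : Type*} [Ring B] [Algebra k B] (u : Bˣ) (n : ℤ) :
    laurentHom (k := k) u (LaurentPolynomial.T n) = ((u ^ n : Bˣ) : B) := by
  unfold laurentHom LaurentPolynomial.T
  rw [AddMonoidAlgebra.lift_single]
  simp

/-- The unit `cT` of `k[T;T⁻¹]`. -/
def scaledT (c : kˣ) : (k[T;T⁻¹])ˣ where
  val := LaurentPolynomial.C (c : k) * LaurentPolynomial.T 1
  inv := LaurentPolynomial.C ((c⁻¹ : kˣ) : k) * LaurentPolynomial.T (-1)
  val_inv := by
    rw [mul_mul_mul_comm, ← map_mul, ← LaurentPolynomial.T_add]; simp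
  inv_val := by
    rw [mul_mul_mul_comm, ← map_mul, ← LaurentPolynomial.T_add]; simp

theorem laurentHom_comp_scaledT (c d : kˣ) (h : d * c = 1) :
    (laurentHom (k := k) (scaledT c)).comp (laurentHom (scaledT d)) =
      AlgHom.id k k[T;T⁻¹] := by
  have key : (laurentHom (k := k) (scaledT c))
      ((laurentHom (k := k) (scaledT d)) (LaurentPolynomial.T 1)) = LaurentPolynomial.T 1 := by
    rw [laurentHom_T, zpow_one]
    change (laurentHom (k := k) (scaledT c))
      (LaurentPolynomial.C (d : k) * LaurentPolynomial.T 1) = _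
    rw [map_mul, laurentHom_T, zpow_one, LaurentPolynomial.C_eq_algebraMap, AlgHom.commutes]
    change _ * (LaurentPolynomial.C (c : k) * LaurentPolynomial.T 1) = _
    rw [← LaurentPolynomial.C_eq_algebraMap, ← mul_assoc, ← map_mul, ← Units.val_mul, h]
    simp
  apply (AddMonoidAlgebra.lift k k[T;T⁻¹] ℤ).symm.injective
  refine MonoidHom.ext_mint ?_
  exact key

/-- The `k`-algebra automorphism of `k[T;T⁻¹]` with `T ↦ cT`. -/
def scale (c : kˣ) : k[T;T⁻¹] ≃ₐ[k] k[T;T⁻¹] :=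
  AlgEquiv.ofAlgHom (laurentHom (scaledT c)) (laurentHom (scaledT c⁻¹))
    (laurentHom_comp_scaledT _ _ (by simp)) (laurentHom_comp_scaledT _ _ (by simp))

theorem scale_T (c : kˣ) : scale c (LaurentPolynomial.T 1) =
    LaurentPolynomial.C (c : k) * LaurentPolynomial.T 1 := by
  change laurentHom (k := k) (scaledT c) (LaurentPolynomial.T 1) = _
  rw [laurentHom_T, zpow_one]; rfl

end Laurent

/-! ### Skew Laurent polynomial rings -/

section Skew

variable {D : Type*} [CommRing D]

/-- The action of the infinite cyclic group on `D` through the powers of `ρ`. -/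
abbrev zpowAction (ρ : RingAut D) : MulSemiringAction (Multiplicative ℤ) D :=
  MulSemiringAction.compHom D (zpowersHom (RingAut D) ρ)

/-- The skew Laurent polynomial ring `D[Y^{±1}; ρ]`, in which `Y d = ρ(d) Y`. -/
def SkewLaurent (_ρ : RingAut D) := SkewMonoidAlgebra D (Multiplicative ℤ)

instance (ρ : RingAut D) : Ring (SkewLaurent ρ) :=
  letI := zpowAction ρ
  inferInstanceAs (Ring (SkewMonoidAlgebra D (Multiplicative ℤ)))

/-- The coefficient ring `D` inside `D[Y^{±1}; ρ]`. -/
def SkewLaurent.const (ρ : RingAut D) : D →+* SkewLaurent ρ :=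
  letI := zpowAction ρ
  (SkewMonoidAlgebra.singleOneRingHom : D →+* SkewMonoidAlgebra D (Multiplicative ℤ))

/-- The variable `Y` of `D[Y^{±1}; ρ]`. -/
def SkewLaurent.var (ρ : RingAut D) : SkewLaurent ρ :=
  SkewMonoidAlgebra.single (Multiplicative.ofAdd (1 : ℤ)) (1 : D)

/-- The orbit `{ρ^i(𝔪) | i ∈ ℤ}` of an ideal. -/
def orbit (ρ : RingAut D) (𝔪 : Ideal D) : Set (Ideal D) :=
  {I | ∃ i : ℤ, I = 𝔪.map (ρ ^ i : RingAut D)}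

/-- The set `Max(D)/⟨ρ⟩` of the orbits of maximal ideals. -/
def maxOrbits (ρ : RingAut D) : Set (Set (Ideal D)) :=
  {O | ∃ 𝔪 : Ideal D, 𝔪.IsMaximal ∧ O = orbit ρ 𝔪}

end Skew

/-! ### Isomorphism classes of modules -/

section Modules

/-- The isomorphism classes of left `R`-modules. (Every simple `R`-module is isomorphic to a
quotient of `R`, so that those in the universe of `R` are enough.) -/
def IsoClasses (R : Type u) [Ring R] : Type (u + 1) :=
  Quotient (CategoryTheory.isIsomorphicSetoid (ModuleCat.{u} R))

variable {R : Type u} [Ring R]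

/-- The isomorphism class `[M]`. -/
def isoClass (M : ModuleCat.{u} R) : IsoClasses R :=
  Quotient.mk (CategoryTheory.isIsomorphicSetoid (ModuleCat.{u} R)) M

/-- For a ring homomorphism `f : D → R` from a commutative domain `D` (below always the inclusion
of a subring): the `R`-module `M` is `D`-torsion, that is, its localization at `D ∖ {0}` is zero. -/
def IsTorsionOver {D : Type*} [CommRing D] (f : D →+* R) (M : ModuleCat.{u} R) : Prop :=
  ∀ v : M, ∃ d : D, d ≠ 0 ∧ f d • v = 0

/-- The set of isomorphism classes of simple `D`-torsion `R`-modules. -/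
def simpleTorsion {D : Type*} [CommRing D] (f : D →+* R) : Set (IsoClasses R) :=
  {c | ∃ M : ModuleCat.{u} R, IsSimpleModule R M ∧ IsTorsionOver f M ∧ c = isoClass M}

/-- The `D`-support: the set of maximal ideals `𝔪` of `D` with
`M_𝔪 = {v ∈ M | 𝔪 v = 0} ≠ 0`. -/
def supp {D : Type*} [CommRing D] (f : D →+* R) (M : ModuleCat.{u} R) : Set (Ideal D) :=
  {𝔪 | 𝔪.IsMaximal ∧ ∃ v : M, v ≠ 0 ∧ ∀ d ∈ 𝔪, f d • v = 0}

/-- The `R`-module `R/R𝔪` for an ideal `𝔪` of `D`. -/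
def cyclic {D : Type*} [CommRing D] (f : D →+* R) (𝔪 : Ideal D) : ModuleCat.{u} R :=
  ModuleCat.of R (R ⧸ Submodule.span R (f '' (𝔪 : Set D)))

/-- For a ring homomorphism `f : D → R` and an automorphism `ρ` of `D`: the map
`Max(D)/⟨ρ⟩ → R̂(D-torsion)`, `𝒪(𝔪) ↦ [R/R𝔪]`, is a (well defined) bijection, and its inverse is
`[M] ↦ Supp_D(M)`. -/
def OrbitClassification {D : Type*} [CommRing D] (ρ : RingAut D) (f : D →+* R) : Prop :=
  ∃ e : maxOrbits ρ ≃ simpleTorsion f,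
    (∀ (𝔪 : Ideal D) (h𝔪 : 𝔪.IsMaximal),
      (e ⟨orbit ρ 𝔪, 𝔪, h𝔪, rfl⟩).1 = isoClass (cyclic f 𝔪)) ∧
    ∀ (M : ModuleCat.{u} R) (hM : isoClass M ∈ simpleTorsion f),
      (e.symm ⟨isoClass M, hM⟩).1 = supp f M

/-- The annihilator of a module, as a two-sided ideal. -/
def ann (M : ModuleCat.{u} R) : TwoSidedIdeal R := (Module.annihilator R M).toTwoSided

/-- An `S`-module as an `R`-module, on isomorphism classes. -/
def inflate {S : Type u} [Ring S] (f : R →+* S) : IsoClasses S → IsoClasses R :=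
  Quotient.map' (ModuleCat.restrictScalars.{u} f).obj
    (fun _ _ ⟨i⟩ => ⟨(ModuleCat.restrictScalars.{u} f).mapIso i⟩)

/-- The factor ring by a two-sided ideal. -/
abbrev Factor (I : TwoSidedIdeal R) : Type u := I.ringCon.Quotient

/-- The projection onto the factor ring. -/
def proj (I : TwoSidedIdeal R) : R →+* Factor I := I.ringCon.mk'

variable (R) in
/-- `Max(R)`: the maximal two-sided ideals. -/
def maxSpec : Set (TwoSidedIdeal R) := {I | IsCoatom I}

end Modules

/-! ### Ideals and simple modules of `𝒜` -/

section Sets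

variable {𝕜 : Type u} [Field 𝕜] (q : 𝕜ˣ)

/-- The inclusion of `D = 𝕜[K^{±1}]` into `𝒜`, `T ↦ K`. -/
def inclD : 𝕜[T;T⁻¹] →ₐ[𝕜] Alg q := laurentHom (unitK q)

/-- The ideal `(Y, E, 𝔭)`. -/
def idealP (𝔭 : Ideal 𝕜[T;T⁻¹]) : TwoSidedIdeal (Alg q) :=
  TwoSidedIdeal.span ({elt q .Y, elt q .E} ∪ inclD q '' (𝔭 : Set 𝕜[T;T⁻¹]))

/-- The ideal `(X, 𝔮)`, where `𝔮` is an ideal of the polynomial ring in `Z`. -/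
def idealQ (𝔮 : Ideal 𝕜[X]) : TwoSidedIdeal (Alg q) :=
  TwoSidedIdeal.span ({elt q .X} ∪ Polynomial.aeval (elemZ q) '' (𝔮 : Set 𝕜[X]))

/-- The ideal `(φ, 𝔯)`, where `𝔯` is an ideal of the polynomial ring in `C`. -/
def idealR (𝔯 : Ideal 𝕜[X]) : TwoSidedIdeal (Alg q) :=
  TwoSidedIdeal.span ({elemPhi q} ∪ Polynomial.aeval (elemC q) '' (𝔯 : Set 𝕜[X]))

/-- The family `𝒫`. -/
def famP : Set (TwoSidedIdeal (Alg q)) :=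
  {I | ∃ 𝔭 : Ideal 𝕜[T;T⁻¹], 𝔭.IsMaximal ∧ I = idealP q 𝔭}

/-- The family `𝒬`. -/
def famQ : Set (TwoSidedIdeal (Alg q)) :=
  {I | ∃ 𝔮 : Ideal 𝕜[X], 𝔮.IsMaximal ∧ 𝔮 ≠ Ideal.span {Polynomial.X} ∧ I = idealQ q 𝔮}

/-- The family `ℛ`. -/
def famR : Set (TwoSidedIdeal (Alg q)) :=
  {I | ∃ 𝔯 : Ideal 𝕜[X], 𝔯.IsMaximal ∧ 𝔯 ≠ Ideal.span {Polynomial.X} ∧ I = idealR q 𝔯}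

/-- The isomorphism classes of simple `D`-torsion `𝒜`-modules with annihilator in `S`. -/
def torsionIn (S : Set (TwoSidedIdeal (Alg q))) : Set (IsoClasses (Alg q)) :=
  {c | ∃ M : ModuleCat.{u} (Alg q), IsSimpleModule (Alg q) M ∧
    IsTorsionOver (inclD q).toRingHom M ∧ ann M ∈ S ∧ c = isoClass M}

/-- The isomorphism classes of simple `D`-torsion `𝒜`-modules with annihilator `I`. -/
def torsionAt (I : TwoSidedIdeal (Alg q)) : Set (IsoClasses (Alg q)) := torsionIn q {I}

/-- `Prim(𝒜, D-torsion)`: the annihilators of the simple `D`-torsion `𝒜`-modules. -/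
def primTorsion : Set (TwoSidedIdeal (Alg q)) :=
  {I | ∃ M : ModuleCat.{u} (Alg q), IsSimpleModule (Alg q) M ∧
    IsTorsionOver (inclD q).toRingHom M ∧ I = ann M}

/-- The isomorphism classes of simple `𝒜`-modules that are finite dimensional over `𝕜`. -/
def finDim : Set (IsoClasses (Alg q)) :=
  {c | ∃ M : ModuleCat.{u} (Alg q), IsSimpleModule (Alg q) M ∧
    Module.Finite 𝕜 ((ModuleCat.restrictScalars.{u} (algebraMap 𝕜 (Alg q))).obj M) ∧
    c = isoClass M}

/-- For an ideal `𝔞` of `𝕜[X]` and `L = 𝕜[X]/𝔞`: the `L`-algebra automorphism `ρ` of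
`L[T;T⁻¹]` with `ρ(T) = qT`. -/
def rho (𝔞 : Ideal 𝕜[X]) : RingAut ((𝕜[X] ⧸ 𝔞)[T;T⁻¹]) :=
  (scale (Units.map (algebraMap 𝕜 (𝕜[X] ⧸ 𝔞)).toMonoidHom q)).toRingEquiv

/-- The `D_𝔞`-structure, `D_𝔞 = L[K^{±1}]`, on a ring that is identified with the skew Laurent
polynomial ring `D_𝔞[Y^{±1}; ρ]`. -/
def inclOf {D B : Type*} [CommRing D] [Ring B] {ρ : RingAut D} (Φ : SkewLaurent ρ ≃+* B) :
    D →+* B :=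
  Φ.toRingHom.comp (SkewLaurent.const ρ)

end Sets

end

end Ageing

/-! Both `X` and `φ = X + (q⁻¹ - q) Y E` are normal: they commute with every generator up to a power
of `q`. Modulo a maximal ideal, and equally on a simple module, a normal element is zero or
invertible (`eq_zero_or_isUnit_of_isCoatom`, `eq_zero_or_isUnit_of_isSimpleModule`). The maximal
ideals and the annihilators of the simple torsion modules are therefore found by the same three
cases.

If `X = 0`, then `E` and `Y` `q`-commute and become normal too. It cannot happen that one of them
vanishes and the other is invertible, because everything would then have `K`-weights on one side
only (`not_isUnit_of_weight`, `not_isUnit_of_weight_module`). If both vanish, only `𝕜[K^{±1}]` is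
left, which gives `𝒫`. If both are invertible, `Z` is central and invertible and `E` is a scalar
multiple of `Z K Y⁻²`, so that only a quantum torus in `K^{±1}`, `Y^{±1}` over `𝕜[Z]` is left. If
`X` is invertible and `φ = 0`, the same happens with `C` and `E` a multiple of `C K⁻¹ Y⁻²`. In both
torus cases the central element is algebraic over `𝕜`: in a factor ring by comparing coefficients of
an inverse, on a torsion module by Nakayama's lemma applied to part of a weight space. Hence the
ideal contains some `(X, 𝔮)` or `(φ, 𝔯)`. These are proper by explicit representations on a line,
and maximal because `D_𝔮[Y^{±1}; ρ]` stays injective in every nonzero algebra to which the factor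
ring maps (`skewLaurent_injective`, `TorusIdeal.isCoatom`).

If `X` and `φ` are both invertible, the representation is faithful (`Rep.lift_injective`): the
monomials `Kᵃ Xⁱ φʲ Eᵈ` and `Kᵃ Xⁱ φʲ Y⁻ᵈ` span `𝒜` and are separated by their commutation with `K`,
`X`, `φ` and one of `E`, `Y`. So the ideal is zero. Zero is not maximal, but it is the annihilator
of a simple torsion module with basis `ℤ × ℤ`.

The torsion modules of a torus are classified by orbits. If `𝔪` kills `v`, then `ρⁿ(𝔪)` kills `Yⁿ
v`, and these maximal ideals are distinct because scaling by a scalar that is not a root of unity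
fixes no maximal ideal (a determinant argument, `comap_scale_ne`). Hence `R/R𝔪` is simple, the
support of a simple module is one orbit, and a point of the support determines the module
(`orbitClassification`). Torsion over `𝕜[K^{±1}]` and over `L[K^{±1}]` agree because the second ring
is integral over the first. Finally, determinants show that on a finite-dimensional simple module no
operator of nonzero weight is invertible, so `X`, `E`, `Y` vanish there. -/

namespace Ageing

noncomputable section

/-! ### `q`-commuting elements -/

section QComm

variable {𝕜 : Type*} [Field 𝕜] {B : Type*} [Ring B] [Algebra 𝕜 B] {q : 𝕜ˣ}

/-- The relation `a b = qⁿ b a`. -/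
def QComm (q : 𝕜ˣ) (n : ℤ) (a b : B) : Prop := a * b = ((q ^ n : 𝕜ˣ) : 𝕜) • (b * a)

namespace QComm

variable {n m : ℤ} {a b c : B}

theorem eq (h : QComm q n a b) : a * b = ((q ^ n : 𝕜ˣ) : 𝕜) • (b * a) := h

theorem congr (h : QComm q n a b) (e : n = m) : QComm q m a b := e ▸ h

theorem symm (h : QComm q n a b) : QComm q (-n) b a := by
  unfold QComm at *
  rw [h, smul_smul, ← Units.val_mul, ← zpow_add]; simp

theorem mul_right (h : QComm q n a b) (h' : QComm q m a c) : QComm q (n + m) a (b * c) := by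
  unfold QComm at *
  rw [← mul_assoc, h, smul_mul_assoc, mul_assoc, h', mul_smul_comm, smul_smul, ← Units.val_mul,
    ← zpow_add, mul_assoc]

theorem mul_left (h : QComm q n a c) (h' : QComm q m b c) : QComm q (n + m) (a * b) c :=
  ((h.symm.mul_right h'.symm).symm).congr (by ring)

theorem of_commute (h : Commute a b) : QComm q 0 a b := by
  unfold QComm; simpa using h.eq

theorem commute (h : QComm q 0 a b) : Commute a b :=
  h.trans (by simp)

theorem one_right (a : B) : QComm q 0 a 1 := of_commute (Commute.one_right a)

theorem zero_left (n : ℤ) (a : B) : QComm q n 0 a := by simp [QComm]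

theorem add_right (h : QComm q n a b) (h' : QComm q n a c) : QComm q n a (b + c) := by
  unfold QComm at *; rw [mul_add, h, h', add_mul, smul_add]

theorem smul_right (h : QComm q n a b) (s : 𝕜) : QComm q n a (s • b) := by
  unfold QComm at *; rw [mul_smul_comm, h, smul_mul_assoc, smul_comm]

theorem sub_right (h : QComm q n a b) (h' : QComm q n a c) : QComm q n a (b - c) := by
  unfold QComm at *; rw [mul_sub, h, h', sub_mul, smul_sub]

theorem add_left (h : QComm q n a c) (h' : QComm q n b c) : QComm q n (a + b) c :=
  (h.symm.add_right h'.symm).symm.congr (by ring)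

theorem smul_left (h : QComm q n a b) (s : 𝕜) : QComm q n (s • a) b :=
  (h.symm.smul_right s).symm.congr (by ring)

theorem pow_right (h : QComm q n a b) (k : ℕ) : QComm q (k * n) a (b ^ k) := by
  induction k with
  | zero => simpa using one_right a
  | succ k ih => rw [pow_succ]; exact (ih.mul_right h).congr (by push_cast; ring)

theorem pow_left (h : QComm q n a b) (k : ℕ) : QComm q (k * n) (a ^ k) b :=
  (h.symm.pow_right k).symm.congr (by ring)

theorem inv_right {u : Bˣ} (h : QComm q n a (u : B)) : QComm q (-n) a (↑u⁻¹ : B) := by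
  have h1 := h.symm
  unfold QComm at *
  have : (u : B) * (a * (↑u⁻¹ : B)) = u * (((q ^ (-n) : 𝕜ˣ) : 𝕜) • ((↑u⁻¹ : B) * a)) := by
    rw [← mul_assoc, h1, smul_mul_assoc, mul_assoc, Units.mul_inv, mul_one, mul_smul_comm,
      Units.mul_inv_cancel_left]
  exact u.mul_right_inj.1 this

theorem inv_left {u : Bˣ} (h : QComm q n (u : B) a) : QComm q (-n) (↑u⁻¹ : B) a :=
  h.symm.inv_right.symm.congr (by ring)

theorem zpow_right {u : Bˣ} (h : QComm q n a (u : B)) (k : ℤ) :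
    QComm q (k * n) a (↑(u ^ k) : B) := by
  cases k with
  | ofNat k => simpa using h.pow_right k
  | negSucc k =>
    have h2 : QComm q (((k + 1 : ℕ) : ℤ) * n) a ((u ^ (k + 1) : Bˣ) : B) := by
      simpa using h.pow_right (k + 1)
    rw [zpow_negSucc]
    exact h2.inv_right.congr (by rw [Int.negSucc_eq]; push_cast; ring)

theorem zpow_left {u : Bˣ} (h : QComm q n (u : B) a) (k : ℤ) :
    QComm q (k * n) (↑(u ^ k) : B) a :=
  (h.symm.zpow_right k).symm.congr (by ring)

theorem map {C : Type*} [Ring C] [Algebra 𝕜 C] (f : B →ₐ[𝕜] C) (h : QComm q n a b) :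
    QComm q n (f a) (f b) := by
  unfold QComm at *; rw [← map_mul, h, map_smul, map_mul]

end QComm

end QComm

theorem zpow_injective {𝕜 : Type*} [Field 𝕜] {q : 𝕜ˣ} (hq : ∀ n : ℕ, 0 < n → q ^ n ≠ 1) :
    Function.Injective fun n : ℤ => q ^ n :=
  injective_zpow_iff_not_isOfFinOrder.2 fun h => by
    obtain ⟨n, hn, h⟩ := isOfFinOrder_iff_pow_eq_one.1 h
    exact hq n hn h

theorem zpow_val_injective {𝕜 : Type*} [Field 𝕜] {q : 𝕜ˣ} (hq : ∀ n : ℕ, 0 < n → q ^ n ≠ 1) :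
    Function.Injective fun n : ℤ => ((q ^ n : 𝕜ˣ) : 𝕜) :=
  Units.val_injective.comp (zpow_injective hq)

/-! ### Representations -/

section Rep

variable {𝕜 : Type u} [Field 𝕜]

/-- Elements of an algebra that satisfy the defining relations of the ageing algebra. -/
@[ext]
structure Rep (q : 𝕜ˣ) (B : Type*) [Ring B] [Algebra 𝕜 B] where
  E : B
  X : B
  Y : B
  K : Bˣ
  EK : QComm q (-2) E (K : B)
  XK : QComm q (-1) X (K : B)
  YK : QComm q 1 Y (K : B)
  EX : QComm q 1 E X
  XY : QComm q 1 X Y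
  EY : E * Y = X + ((q⁻¹ : 𝕜ˣ) : 𝕜) • (Y * E)

/-- The constant `q⁻¹ - q`. -/
def cst (q : 𝕜ˣ) : 𝕜 := ((q⁻¹ : 𝕜ˣ) : 𝕜) - (q : 𝕜)

theorem cst_ne_zero {q : 𝕜ˣ} (hq : ∀ n : ℕ, 0 < n → q ^ n ≠ 1) : cst q ≠ 0 := by
  intro h
  have := zpow_val_injective hq (a₁ := -1) (a₂ := 1)
    (by simpa [cst, sub_eq_zero] using h)
  omega

namespace Rep

variable {q : 𝕜ˣ} {B : Type*} [Ring B] [Algebra 𝕜 B] (r : Rep q B)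

/-- The element `φ`. -/
def phi : B := r.E * r.Y - (q : 𝕜) • (r.Y * r.E)

/-- The element `Z`. -/
def Z : B := r.phi * r.Y * (↑r.K⁻¹ : B)

/-- The element `C`. -/
def C : B := r.X * r.Y * (r.K : B)

theorem phi_eq : r.phi = r.X + cst q • (r.Y * r.E) := by
  rw [phi, r.EY, cst, sub_smul]; abel

theorem cst_smul_YE : cst q • (r.Y * r.E) = r.phi - r.X := by rw [phi_eq]; abel

theorem cst_smul_EY :
    cst q • (r.E * r.Y) = ((q⁻¹ : 𝕜ˣ) : 𝕜) • r.phi - (q : 𝕜) • r.X := by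
  rw [r.EY, phi_eq, smul_add, smul_add, smul_comm (cst q) ((q⁻¹ : 𝕜ˣ) : 𝕜)]
  nth_rewrite 1 [cst]
  rw [sub_smul]; abel

theorem YX : QComm q (-1) r.Y r.X := r.XY.symm

theorem YE_K : QComm q (-1) (r.Y * r.E) (r.K : B) := r.YK.mul_left r.EK

theorem phi_K : QComm q (-1) r.phi (r.K : B) := by
  rw [phi_eq]; exact r.XK.add_left (r.YE_K.smul_left _)

theorem phi_X : QComm q 0 r.phi r.X := by
  rw [phi_eq]
  exact (QComm.of_commute (Commute.refl r.X)).add_left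
    (((r.YX.mul_left r.EX).congr (by norm_num)).smul_left _)

theorem XE : QComm q (-1) r.X r.E := r.EX.symm

/-- In `Eφ` the coefficient of `XE` is `q + (q⁻¹ - q) = q⁻¹`; the constant `q⁻¹ - q` is exactly what
makes the two terms of `φ` scale alike. -/
theorem phi_E : QComm q 1 r.phi r.E := by
  have h1 : r.phi * r.E = r.X * r.E + cst q • (r.Y * r.E * r.E) := by
    rw [phi_eq, add_mul, smul_mul_assoc]
  have h2 : r.E * r.phi = r.E * r.X + cst q • (r.E * r.Y * r.E) := by
    rw [phi_eq, mul_add, mul_smul_comm, mul_assoc]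
  unfold QComm
  rw [h1, h2, r.EX.eq, r.EY, add_mul, smul_mul_assoc]
  simp only [smul_add, smul_smul]
  rw [← add_assoc, ← add_smul]
  have hq := q.ne_zero
  congr 1
  · conv_lhs => rw [← one_smul 𝕜 (r.X * r.E)]
    congr 1
    simp only [cst, zpow_one, Units.val_inv_eq_inv_val]; field_simp; ring
  · congr 1
    simp only [cst, zpow_one, Units.val_inv_eq_inv_val]; field_simp

theorem phi_Y : QComm q (-1) r.phi r.Y := by
  have h1 : r.phi * r.Y = r.X * r.Y + cst q • (r.Y * (r.E * r.Y)) := by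
    rw [phi_eq, add_mul, smul_mul_assoc, mul_assoc]
  have h2 : r.Y * r.phi = r.Y * r.X + cst q • (r.Y * (r.Y * r.E)) := by
    rw [phi_eq, mul_add, mul_smul_comm]
  unfold QComm
  rw [h1, h2, r.XY.eq, r.EY, mul_add, mul_smul_comm]
  simp only [smul_add, smul_smul]
  rw [← add_assoc, ← add_smul]
  have hq := q.ne_zero
  congr 1
  · congr 1
    simp only [cst, zpow_one, Units.val_inv_eq_inv_val, zpow_neg]; field_simp; ring
  · congr 1
    simp only [cst, zpow_one, Units.val_inv_eq_inv_val, zpow_neg]; field_simp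

/-- The image of a representation. -/
@[simps]
def map {C : Type*} [Ring C] [Algebra 𝕜 C] (f : B →ₐ[𝕜] C) : Rep q C where
  E := f r.E
  X := f r.X
  Y := f r.Y
  K := Units.map (f : B →* C) r.K
  EK := r.EK.map f
  XK := r.XK.map f
  YK := r.YK.map f
  EX := r.EX.map f
  XY := r.XY.map f
  EY := by rw [← map_mul, r.EY]; simp

theorem map_phi {C : Type*} [Ring C] [Algebra 𝕜 C] (f : B →ₐ[𝕜] C) :
    (r.map f).phi = f r.phi := by simp [phi]

variable (q) in
/-- The projection of the free algebra to the ageing algebra. -/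
def freeProj : FreeAlgebra 𝕜 Gen →ₐ[𝕜] Alg q := RingQuot.mkAlgHom 𝕜 (Rel q)

theorem freeProj_rel {a b : FreeAlgebra 𝕜 Gen} (h : Rel q a b) : freeProj q a = freeProj q b :=
  RingQuot.mkAlgHom_rel 𝕜 h

variable (q) in
/-- The generators of the ageing algebra. -/
def can : Rep q (Alg q) where
  E := elt q .E
  X := elt q .X
  Y := elt q .Y
  K := unitK q
  EK := by
    have h := freeProj_rel (Rel.E_K (q := q))
    rwa [map_smul, map_mul, map_mul] at h
  XK := by
    have h := freeProj_rel (Rel.X_K (q := q))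
    rwa [map_smul, map_mul, map_mul, ← zpow_neg_one] at h
  YK := by
    have h := freeProj_rel (Rel.Y_K (q := q))
    rw [map_smul, map_mul, map_mul] at h
    unfold QComm; rwa [zpow_one]
  EX := by
    have h := freeProj_rel (Rel.E_X (q := q))
    rw [map_smul, map_mul, map_mul] at h
    unfold QComm; rwa [zpow_one]
  XY := by
    have h := freeProj_rel (Rel.Y_X (q := q))
    rw [map_smul, map_mul, map_mul] at h
    unfold QComm; rw [zpow_one]; exact h.symm
  EY := by
    have h := freeProj_rel (Rel.E_Y (q := q))
    rwa [map_add, map_smul, map_mul, map_mul] at h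

/-- The images of the generators. -/
def val : Gen → B
  | .E => r.E
  | .K => r.K
  | .Kinv => (↑r.K⁻¹ : B)
  | .X => r.X
  | .Y => r.Y

/-- The algebra homomorphism of a representation. -/
def lift : Alg q →ₐ[𝕜] B :=
  RingQuot.liftAlgHom 𝕜 ⟨FreeAlgebra.lift 𝕜 r.val, by
    intro a b h
    cases h <;> simp only [gen, map_mul, map_smul, map_add, map_one, FreeAlgebra.lift_ι_apply, val]
    · simp
    · simp
    · exact r.EK
    · exact r.XK.eq.trans (by simp)
    · exact r.YK.eq.trans (by simp)
    · exact r.EX.eq.trans (by simp)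
    · exact r.EY
    · exact (r.XY.eq.trans (by simp)).symm⟩

theorem lift_elt (g : Gen) : r.lift (elt q g) = r.val g :=
  (RingQuot.liftAlgHom_mkAlgHom_apply 𝕜 _ _ _).trans (FreeAlgebra.lift_ι_apply _ _)

@[simp] theorem lift_E : r.lift (elt q .E) = r.E := r.lift_elt .E
@[simp] theorem lift_X : r.lift (elt q .X) = r.X := r.lift_elt .X
@[simp] theorem lift_Y : r.lift (elt q .Y) = r.Y := r.lift_elt .Y
@[simp] theorem lift_K : r.lift (elt q .K) = r.K := r.lift_elt .K
@[simp] theorem lift_Kinv : r.lift (elt q .Kinv) = (↑r.K⁻¹ : B) := r.lift_elt .Kinv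

theorem can_map_lift : (can q).map r.lift = r := by
  ext
  · exact r.lift_E
  · exact r.lift_X
  · exact r.lift_Y
  · exact r.lift_K

theorem lift_phi : r.lift (elemPhi q) = r.phi := by simp [elemPhi, phi]

theorem lift_Z : r.lift (elemZ q) = r.Z := by simp [elemZ, Z, lift_phi]

theorem lift_C : r.lift (elemC q) = r.C := by simp [elemC, Rep.C]

end Rep

theorem adjoin_elt (q : 𝕜ˣ) : Algebra.adjoin 𝕜 (Set.range (elt q)) = ⊤ := by
  have h1 := FreeAlgebra.adjoin_range_ι (R := 𝕜) (X := Gen)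
  have h2 := congrArg (Subalgebra.map (Rep.freeProj q)) h1
  rw [AlgHom.map_adjoin, Algebra.map_top, (AlgHom.range_eq_top (Rep.freeProj q)).2
    (RingQuot.mkAlgHom_surjective 𝕜 (Rel q)), ← Set.range_comp] at h2
  exact h2

/-- `X = EY - q⁻¹YE`: the generator `X` is redundant. -/
theorem eq_top_of_elt_mem {q : 𝕜ˣ} (S : Subalgebra 𝕜 (Alg q)) (hE : elt q .E ∈ S)
    (hY : elt q .Y ∈ S) (hK : elt q .K ∈ S) (hK' : elt q .Kinv ∈ S) (a : Alg q) : a ∈ S := by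
  have hX : elt q .X ∈ S := by
    rw [show elt q .X = elt q .E * elt q .Y - ((q⁻¹ : 𝕜ˣ) : 𝕜) • (elt q .Y * elt q .E) from
      eq_sub_of_add_eq (Rep.can q).EY.symm]
    exact S.sub_mem (S.mul_mem hE hY) (S.smul_mem (S.mul_mem hY hE) _)
  have : (⊤ : Subalgebra 𝕜 (Alg q)) ≤ S := by
    rw [← adjoin_elt, Algebra.adjoin_le_iff]
    rintro _ ⟨g, rfl⟩
    cases g <;> assumption
  exact this trivial

/-- A subspace that is stable under the generators is stable. -/
theorem apply_mem_of_stable {q : 𝕜ˣ} {M : Type*} [AddCommGroup M] [Module 𝕜 M]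
    (f : Alg q →ₐ[𝕜] Module.End 𝕜 M) (V : Submodule 𝕜 M)
    (hE : ∀ v ∈ V, f (elt q .E) v ∈ V) (hY : ∀ v ∈ V, f (elt q .Y) v ∈ V)
    (hK : ∀ v ∈ V, f (elt q .K) v ∈ V) (hK' : ∀ v ∈ V, f (elt q .Kinv) v ∈ V)
    (a : Alg q) {v : M} (hv : v ∈ V) : f a v ∈ V := by
  let S : Subalgebra 𝕜 (Alg q) :=
    { carrier := {a | ∀ v ∈ V, f a v ∈ V}
      mul_mem' := fun {a b} ha hb v hv => by
        simpa only [map_mul, Module.End.mul_apply] using ha _ (hb v hv)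
      add_mem' := fun {a b} ha hb v hv => by
        simpa only [map_add, LinearMap.add_apply] using V.add_mem (ha _ hv) (hb v hv)
      algebraMap_mem' := fun s v hv => by
        simpa only [AlgHom.commutes, Module.algebraMap_end_apply] using V.smul_mem s hv }
  exact eq_top_of_elt_mem S hE hY hK hK' a v hv

/-- A subspace that contains `1` and is stable under left multiplication by the generators
contains the image. -/
theorem lift_mem_of_stable {q : 𝕜ˣ} {B : Type*} [Ring B] [Algebra 𝕜 B] (r : Rep q B)
    (V : Submodule 𝕜 B) (h1 : (1 : B) ∈ V)
    (hE : ∀ v ∈ V, r.E * v ∈ V) (hY : ∀ v ∈ V, r.Y * v ∈ V)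
    (hK : ∀ v ∈ V, (r.K : B) * v ∈ V) (hK' : ∀ v ∈ V, (↑r.K⁻¹ : B) * v ∈ V)
    (a : Alg q) : r.lift a ∈ V := by
  have := apply_mem_of_stable ((Algebra.lmul 𝕜 B).comp r.lift) V
    (by simpa using hE) (by simpa using hY) (by simpa using hK) (by simpa using hK') a h1
  simpa using this

theorem algHom_eq_lift {q : 𝕜ˣ} {B : Type*} [Ring B] [Algebra 𝕜 B] (f : Alg q →ₐ[𝕜] B) :
    ((Rep.can q).map f).lift = f := by
  apply AlgHom.ext
  intro a
  refine eq_top_of_elt_mem (AlgHom.equalizer _ _) ?_ ?_ ?_ ?_ a <;>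
    simp only [AlgHom.mem_equalizer] <;> rw [Rep.lift_elt] <;> rfl

end Rep


/-! ### Weight components -/

section Weight

variable {𝕜 : Type*} [Field 𝕜] {q : 𝕜ˣ}

theorem aeval_apply_of_eq_smul {V : Type*} [AddCommGroup V] [Module 𝕜 V] (T : Module.End 𝕜 V)
    {v : V} {c : 𝕜} (h : T v = c • v) (p : 𝕜[X]) : Polynomial.aeval T p v = p.eval c • v := by
  induction p using Polynomial.induction_on' with
  | add p₁ p₂ h₁ h₂ => simp [h₁, h₂, add_smul]
  | monomial n a =>
    have : (T ^ n) v = c ^ n • v := by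
      induction n with
      | zero => simp
      | succ n ih => rw [pow_succ, Module.End.mul_apply, h, map_smul, ih, smul_smul, pow_succ']
    simp [Polynomial.aeval_monomial, this, smul_smul, mul_comm]

theorem aeval_apply_mem {V : Type*} [AddCommGroup V] [Module 𝕜 V] (T : Module.End 𝕜 V)
    (p : Submodule 𝕜 V) (hp : ∀ v ∈ p, T v ∈ p) (g : 𝕜[X]) {v : V} (hv : v ∈ p) :
    Polynomial.aeval T g v ∈ p := by
  induction g using Polynomial.induction_on' with
  | add p₁ p₂ h₁ h₂ => simpa using p.add_mem h₁ h₂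
  | monomial n a =>
    have : (T ^ n) v ∈ p := by
      induction n with
      | zero => simpa
      | succ n ih => rw [pow_succ', Module.End.mul_apply]; exact hp _ ih
    simpa [Polynomial.aeval_monomial] using p.smul_mem a this

/-- A stable subspace contains the weight components of its elements. -/
theorem sum_filter_mem (hq : ∀ n : ℕ, 0 < n → q ^ n ≠ 1) {V : Type*} [AddCommGroup V] [Module 𝕜 V]
    (T : Module.End 𝕜 V) (p : Submodule 𝕜 V) (hp : ∀ v ∈ p, T v ∈ p) {ι : Type*} (s : Finset ι)
    (b : ι → V) (w : ι → ℤ) (h : ∀ i ∈ s, T (b i) = ((q ^ w i : 𝕜ˣ) : 𝕜) • b i)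
    (hs : ∑ i ∈ s, b i ∈ p) (n : ℤ) : ∑ i ∈ s with w i = n, b i ∈ p := by
  classical
  -- `g` vanishes at all eigenvalues `q^m` with `m ≠ n` that occur, so `g(T)` maps the sum to
  -- `g(qⁿ)` times its component of weight `n`.
  let g : 𝕜[X] := ∏ m ∈ (s.image w).erase n, (Polynomial.X - Polynomial.C ((q ^ m : 𝕜ˣ) : 𝕜))
  have hg : ∀ i ∈ s, w i ≠ n → g.eval ((q ^ w i : 𝕜ˣ) : 𝕜) = 0 := by
    intro i hi hn
    rw [Polynomial.eval_prod]
    exact Finset.prod_eq_zero (i := w i)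
      (Finset.mem_erase.2 ⟨hn, Finset.mem_image_of_mem w hi⟩) (by simp)
  have hg0 : g.eval ((q ^ n : 𝕜ˣ) : 𝕜) ≠ 0 := by
    rw [Polynomial.eval_prod]
    refine Finset.prod_ne_zero_iff.2 fun m hm => ?_
    rw [Polynomial.eval_sub, Polynomial.eval_X, Polynomial.eval_C, sub_ne_zero]
    exact fun h => (Finset.mem_erase.1 hm).1 (zpow_val_injective hq h).symm
  have h1 := aeval_apply_mem T p hp g hs
  rw [map_sum, Finset.sum_congr rfl fun i hi => aeval_apply_of_eq_smul T (h i hi) g,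
    ← Finset.sum_filter_add_sum_filter_not s (fun i => w i = n)] at h1
  rw [Finset.sum_eq_zero (s := s.filter fun i => ¬ w i = n) (fun i hi => by
    rw [hg i (Finset.mem_filter.1 hi).1 (Finset.mem_filter.1 hi).2, zero_smul]), add_zero,
    Finset.sum_congr rfl (fun i hi => by rw [(Finset.mem_filter.1 hi).2]),
    ← Finset.smul_sum] at h1
  exact (p.smul_mem_iff hg0).1 h1

variable {B : Type*} [Ring B] [Algebra 𝕜 B]

/-- Conjugation by `u` has each `bᵢ` as an eigenvector with eigenvalue `q^(w i)`, and the zero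
subspace is stable under it. -/
theorem QComm.sum_filter_eq_zero (hq : ∀ n : ℕ, 0 < n → q ^ n ≠ 1) (u : Bˣ) {ι : Type*}
    (s : Finset ι) (b : ι → B) (w : ι → ℤ) (h : ∀ i ∈ s, QComm q (w i) (u : B) (b i))
    (hs : ∑ i ∈ s, b i = 0) (n : ℤ) : ∑ i ∈ s with w i = n, b i = 0 := by
  let T : Module.End 𝕜 B := LinearMap.mulLeft 𝕜 (u : B) ∘ₗ LinearMap.mulRight 𝕜 (↑u⁻¹ : B)
  have hT : ∀ i ∈ s, T (b i) = ((q ^ w i : 𝕜ˣ) : 𝕜) • b i := by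
    intro i hi
    have := (h i hi).eq
    simp only [T, LinearMap.comp_apply, LinearMap.mulLeft_apply, LinearMap.mulRight_apply]
    rw [← mul_assoc, this, smul_mul_assoc, mul_assoc, Units.mul_inv, mul_one]
  have := sum_filter_mem hq T ⊥ (fun v hv => by simp [(Submodule.mem_bot 𝕜).1 hv]) s b w hT
    (by simpa using hs) n
  simpa using this

/-- Left multiplication by `G` against right multiplication by `G` separates the `bᵢ`. -/
theorem QComm.coeff_eq_zero (hq : ∀ n : ℕ, 0 < n → q ^ n ≠ 1) (G : B) (hG : ∀ k, G ^ k ≠ 0)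
    {ι : Type*} (s : Finset ι) (b : ι → Bˣ) (w : ι → ℤ) (hw : Set.InjOn w s)
    (h : ∀ i ∈ s, QComm q (w i) G (b i : B)) (c : ι → 𝕜) (k : ℕ)
    (hs : ∑ i ∈ s, c i • ((b i : B) * G ^ k) = 0) : ∀ i ∈ s, c i = 0 := by
  classical
  induction s using Finset.induction_on generalizing c k with
  | empty => simp
  | insert a s ha ih =>
    rw [Finset.sum_insert ha] at hs
    have hwa : ∀ i ∈ s, w i ≠ w a := fun i hi e =>
      ha (hw (by simp [hi]) (by simp) e ▸ hi)
    -- Multiply the relation by `G` on the left and subtract `q^(w a)` times its product with `G` on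
    -- the right. The term of `a` cancels and the exponent of `G` grows by one; this is why `G` need
    -- only be non-nilpotent, not invertible.
    have key : ∑ i ∈ s, ((((q ^ w i : 𝕜ˣ) : 𝕜) - ((q ^ w a : 𝕜ˣ) : 𝕜)) * c i) •
        ((b i : B) * G ^ (k + 1)) = 0 := by
      have h1 : ∀ i ∈ insert a s, G * (c i • ((b i : B) * G ^ k)) =
          (((q ^ w i : 𝕜ˣ) : 𝕜) * c i) • ((b i : B) * G ^ (k + 1)) := fun i hi => by
        rw [mul_smul_comm, ← mul_assoc, (h i hi).eq, smul_mul_assoc, mul_assoc, ← pow_succ',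
          smul_smul, mul_comm]
      have h2 := congrArg (G * ·) hs
      have h3 := congrArg (fun x => ((q ^ w a : 𝕜ˣ) : 𝕜) • (x * G)) hs
      simp only [mul_add, Finset.mul_sum, mul_zero] at h2
      simp only [add_mul, Finset.sum_mul, zero_mul, smul_zero, smul_add, Finset.smul_sum,
        smul_mul_assoc, smul_smul, mul_assoc, ← pow_succ] at h3
      rw [h1 a (by simp), Finset.sum_congr rfl fun i hi => h1 i (by simp [hi])] at h2
      have h4 := h2.trans h3.symm
      rw [add_right_inj, ← sub_eq_zero, ← Finset.sum_sub_distrib] at h4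
      rw [← h4]
      exact Finset.sum_congr rfl fun i _ => by rw [← sub_smul, sub_mul]
    have hc := ih (hw.mono (by simp)) (fun i hi => h i (by simp [hi])) _ _ key
    have hc' : ∀ i ∈ s, c i = 0 := fun i hi =>
      (mul_eq_zero.1 (hc i hi)).resolve_left
        (sub_ne_zero.2 fun e => hwa i hi (zpow_val_injective hq e))
    rw [Finset.sum_eq_zero fun i hi => by rw [hc' i hi, zero_smul], add_zero] at hs
    intro i hi
    rcases Finset.mem_insert.1 hi with rfl | hi
    · refine (smul_eq_zero.1 hs).resolve_right fun e => hG k ?_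
      exact (b i).mul_right_eq_zero.1 e
    · exact hc' i hi

end Weight

/-! ### Representations in which `X` and `φ` are invertible are faithful -/

section Faithful

variable {𝕜 : Type u} [Field 𝕜] {q : 𝕜ˣ} {B : Type*} [Ring B] [Algebra 𝕜 B] (r : Rep q B)

namespace Rep

/-- If `e = Eᵏ` and `Eᵏ⁺¹ = 0`, then `YEe = 0` gives `φe = Xe`, and `eEY = 0` gives `q⁻¹eφ = qeX`.
Moving `e` to the right yields `(q^(-1-k) - q^(1+k)) X e = 0`, so `e = 0`, as `q` is not a root of
unity. -/
theorem E_pow_ne_zero (hq : ∀ n : ℕ, 0 < n → q ^ n ≠ 1) [Nontrivial B] (hX : IsUnit r.X) (k : ℕ) :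
    r.E ^ k ≠ 0 := by
  induction k with
  | zero => simp
  | succ k ih =>
    intro h0
    set e := r.E ^ k
    have h1 : r.phi * e = r.X * e := by
      have : (cst q • (r.Y * r.E)) * e = 0 := by
        rw [smul_mul_assoc, mul_assoc, ← pow_succ', h0, mul_zero, smul_zero]
      rwa [cst_smul_YE, sub_mul, sub_eq_zero] at this
    have h2 : ((q⁻¹ : 𝕜ˣ) : 𝕜) • (e * r.phi) = (q : 𝕜) • (e * r.X) := by
      have : e * (cst q • (r.E * r.Y)) = 0 := by
        rw [mul_smul_comm, ← mul_assoc, ← pow_succ, h0, zero_mul, smul_zero]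
      rwa [cst_smul_EY, mul_sub, mul_smul_comm, mul_smul_comm, sub_eq_zero] at this
    rw [(r.phi_E.symm.pow_left k).eq, (r.EX.pow_left k).eq, h1, smul_smul, smul_smul,
      ← Units.val_mul, ← Units.val_mul, ← zpow_neg_one, ← zpow_add, ← zpow_one_add, ← sub_eq_zero,
      ← sub_smul, smul_eq_zero, hX.mul_right_eq_zero, sub_eq_zero] at h2
    rcases h2 with h2 | h2
    · have := zpow_val_injective hq h2
      omega
    · exact ih h2

theorem Y_pow_ne_zero (hq : ∀ n : ℕ, 0 < n → q ^ n ≠ 1) [Nontrivial B] (hX : IsUnit r.X) (k : ℕ) :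
    r.Y ^ k ≠ 0 := by
  induction k with
  | zero => simp
  | succ k ih =>
    intro h0
    set e := r.Y ^ k
    have h1 : e * r.phi = e * r.X := by
      have : e * (cst q • (r.Y * r.E)) = 0 := by
        rw [mul_smul_comm, ← mul_assoc, ← pow_succ, h0, zero_mul, smul_zero]
      rwa [cst_smul_YE, mul_sub, sub_eq_zero] at this
    have h2 : ((q⁻¹ : 𝕜ˣ) : 𝕜) • (r.phi * e) = (q : 𝕜) • (r.X * e) := by
      have : (cst q • (r.E * r.Y)) * e = 0 := by
        rw [smul_mul_assoc, mul_assoc, ← pow_succ', h0, mul_zero, smul_zero]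
      rwa [cst_smul_EY, sub_mul, smul_mul_assoc, smul_mul_assoc, sub_eq_zero] at this
    rw [(r.phi_Y.pow_right k).eq, (r.XY.pow_right k).eq, h1, smul_smul, smul_smul,
      ← Units.val_mul, ← Units.val_mul, ← zpow_neg_one, ← zpow_add, ← zpow_one_add, ← sub_eq_zero,
      ← sub_smul, (r.YX.pow_left k).eq, smul_smul, smul_eq_zero, hX.mul_right_eq_zero] at h2
    rcases h2 with h2 | h2
    · rcases mul_eq_zero.1 h2 with h2 | h2
      · have := zpow_val_injective hq (sub_eq_zero.1 h2)
        omega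
      · exact (Units.ne_zero _ h2).elim
    · exact ih h2

/-- The monomials `Kᵃ Xⁱ φʲ Eᵈ` and `Kᵃ Xⁱ φʲ Y⁻ᵈ`, according to the sign of `d`. -/
def mon (t : ℤ × ℕ × ℕ × ℤ) : B :=
  (↑(r.K ^ t.1) : B) * r.X ^ t.2.1 * r.phi ^ t.2.2.1 *
    (r.E ^ t.2.2.2.toNat * r.Y ^ (-t.2.2.2).toNat)

theorem mon_map {C : Type*} [Ring C] [Algebra 𝕜 C] (f : B →ₐ[𝕜] C) (t : ℤ × ℕ × ℕ × ℤ) :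
    (r.map f).mon t = f (r.mon t) := by
  simp only [mon, map_mul, map_pow, map_phi, map_X, map_E, map_Y, map_K]
  rw [← map_zpow]; rfl

theorem E_prefix (a : ℤ) (i j : ℕ) : QComm q (a * -2 + i * 1 + j * -1) r.E
    ((↑(r.K ^ a) : B) * r.X ^ i * r.phi ^ j) :=
  ((r.EK.zpow_right a).mul_right (r.EX.pow_right i)).mul_right (r.phi_E.symm.pow_right j)

theorem Y_prefix (a : ℤ) (i j : ℕ) : QComm q (a * 1 + i * -1 + j * 1) r.Y
    ((↑(r.K ^ a) : B) * r.X ^ i * r.phi ^ j) :=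
  ((r.YK.zpow_right a).mul_right (r.YX.pow_right i)).mul_right
    ((r.phi_Y.symm.pow_right j).congr (by ring))

theorem E_mul_prefix (a : ℤ) (i j : ℕ) (b : B) : ∃ s : 𝕜,
    r.E * ((↑(r.K ^ a) : B) * r.X ^ i * r.phi ^ j * b) =
      s • ((↑(r.K ^ a) : B) * r.X ^ i * r.phi ^ j * (r.E * b)) :=
  ⟨_, by rw [← mul_assoc, (r.E_prefix a i j).eq, smul_mul_assoc, mul_assoc]⟩

theorem Y_mul_prefix (a : ℤ) (i j : ℕ) (b : B) : ∃ s : 𝕜,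
    r.Y * ((↑(r.K ^ a) : B) * r.X ^ i * r.phi ^ j * b) =
      s • ((↑(r.K ^ a) : B) * r.X ^ i * r.phi ^ j * (r.Y * b)) :=
  ⟨_, by rw [← mul_assoc, (r.Y_prefix a i j).eq, smul_mul_assoc, mul_assoc]⟩

/-- `EY` and `YE` are linear combinations of `φ` and `X`. Since `φ` and `X` commute, such a factor
raises an exponent of the prefix. -/
theorem prefix_linear_mem {V : Submodule 𝕜 B} (a : ℤ) (i j : ℕ) (b : B) (s t : 𝕜)
    (h : ∀ i j, (↑(r.K ^ a) : B) * r.X ^ i * r.phi ^ j * b ∈ V) :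
    (↑(r.K ^ a) : B) * r.X ^ i * r.phi ^ j * ((s • r.phi + t • r.X) * b) ∈ V := by
  have h1 : (↑(r.K ^ a) : B) * r.X ^ i * r.phi ^ j * ((s • r.phi + t • r.X) * b) =
      s • ((↑(r.K ^ a) : B) * r.X ^ i * r.phi ^ (j + 1) * b) +
      t • ((↑(r.K ^ a) : B) * r.X ^ (i + 1) * r.phi ^ j * b) := by
    have hc : r.phi ^ j * r.X = r.X * r.phi ^ j := (r.phi_X.commute.pow_left j).eq
    rw [add_mul, mul_add, smul_mul_assoc, smul_mul_assoc, mul_smul_comm, mul_smul_comm,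
      pow_succ, pow_succ]
    simp only [mul_assoc]
    rw [← mul_assoc (r.phi ^ j) r.X b, hc]
    simp only [mul_assoc]
  rw [h1]
  exact V.add_mem (V.smul_mem _ (h _ _)) (V.smul_mem _ (h _ _))

/-- Whenever `E` and `Y` meet, their product is a combination of `φ` and `X`. This is why a monomial
needs a power of only one of the two. -/
theorem lift_mem_span_mon (hq : ∀ n : ℕ, 0 < n → q ^ n ≠ 1) (a : Alg q) :
    r.lift a ∈ Submodule.span 𝕜 (Set.range r.mon) := by
  set V := Submodule.span 𝕜 (Set.range r.mon)
  have hV : ∀ t, r.mon t ∈ V := fun t => Submodule.subset_span ⟨t, rfl⟩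
  have hc := cst_ne_zero hq
  have red : ∀ x : B, (∀ t, x * r.mon t ∈ V) → ∀ v ∈ V, x * v ∈ V := by
    intro x hx v hv
    have : V ≤ V.comap (LinearMap.mulLeft 𝕜 x) :=
      Submodule.span_le.2 (by rintro _ ⟨t, rfl⟩; exact hx t)
    exact this hv
  have hEY : r.E * r.Y = ((cst q)⁻¹ * ((q⁻¹ : 𝕜ˣ) : 𝕜)) • r.phi + ((cst q)⁻¹ * -(q : 𝕜)) • r.X := by
    rw [mul_smul, mul_smul, ← smul_add, neg_smul, ← sub_eq_add_neg, ← cst_smul_EY,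
      inv_smul_smul₀ hc]
  have hYE : r.Y * r.E = (cst q)⁻¹ • r.phi + (-(cst q)⁻¹) • r.X := by
    rw [neg_smul, ← smul_neg, ← smul_add, ← sub_eq_add_neg, ← cst_smul_YE, inv_smul_smul₀ hc]
  refine lift_mem_of_stable r V ?_ ?_ ?_ ?_ ?_ a
  · simpa [mon] using hV (0, 0, 0, 0)
  · refine red _ ?_
    rintro ⟨a, i, j, d⟩
    obtain ⟨s, hs⟩ := r.E_mul_prefix a i j (r.E ^ d.toNat * r.Y ^ (-d).toNat)
    rw [mon, hs]
    refine V.smul_mem _ ?_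
    rcases le_or_gt 0 d with hd | hd
    · have := hV (a, i, j, d + 1)
      have e1 : (d + 1).toNat = d.toNat + 1 := by omega
      have e2 : (-(d + 1)).toNat = (-d).toNat := by omega
      simp only [mon, e1, e2, pow_succ', mul_assoc] at this ⊢
      exact this
    -- For `d < 0` the new `E` meets a power of `Y` and uses up one factor `Y`.
    · have e1 : d.toNat = 0 := by omega
      have e2 : (-d).toNat = (-(d + 1)).toNat + 1 := by omega
      rw [e1, e2, pow_zero, one_mul, pow_succ', ← mul_assoc r.E, hEY]
      refine r.prefix_linear_mem _ _ _ _ _ _ fun i j => ?_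
      have := hV (a, i, j, d + 1)
      have e3 : (d + 1).toNat = 0 := by omega
      simpa only [mon, e3, pow_zero, one_mul] using this
  · refine red _ ?_
    rintro ⟨a, i, j, d⟩
    obtain ⟨s, hs⟩ := r.Y_mul_prefix a i j (r.E ^ d.toNat * r.Y ^ (-d).toNat)
    rw [mon, hs]
    refine V.smul_mem _ ?_
    rcases le_or_gt d 0 with hd | hd
    · have := hV (a, i, j, d - 1)
      have e1 : (d - 1).toNat = 0 := by omega
      have e2 : (-(d - 1)).toNat = (-d).toNat + 1 := by omega
      have e3 : d.toNat = 0 := by omega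
      simpa only [mon, e1, e2, e3, pow_succ', pow_zero, one_mul] using this
    · have e1 : d.toNat = (d - 1).toNat + 1 := by omega
      have e2 : (-d).toNat = 0 := by omega
      rw [e1, e2, pow_zero, mul_one, pow_succ', ← mul_assoc r.Y, hYE]
      refine r.prefix_linear_mem _ _ _ _ _ _ fun i j => ?_
      have := hV (a, i, j, d - 1)
      have e3 : (-(d - 1)).toNat = 0 := by omega
      simpa only [mon, e3, pow_zero, mul_one] using this
  · refine red _ ?_
    rintro ⟨a, i, j, d⟩
    have := hV (1 + a, i, j, d)
    simpa only [mon, zpow_add, zpow_one, Units.val_mul, mul_assoc] using this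
  · refine red _ ?_
    rintro ⟨a, i, j, d⟩
    have := hV (-1 + a, i, j, d)
    simpa only [mon, zpow_add, zpow_neg_one, Units.val_mul, mul_assoc] using this

/-- Conjugation by the units `K`, `X`, `φ` determines `d`, `a` and `i + j`. What remains is `i - j`,
and it is read off from commutation with `E` or `Y`, whichever forms the common tail. -/
theorem mon_linearIndependent (hq : ∀ n : ℕ, 0 < n → q ^ n ≠ 1) [Nontrivial B]
    (hX : IsUnit r.X) (hphi : IsUnit r.phi) : LinearIndependent 𝕜 r.mon := by
  classical
  rw [linearIndependent_iff']
  rintro s c hs ⟨a₀, i₀, j₀, d₀⟩ ht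
  obtain ⟨x, hx⟩ := hX
  obtain ⟨p, hp⟩ := hphi
  have hK : ∀ t : ℤ × ℕ × ℕ × ℤ, QComm q
      (t.2.1 + t.2.2.1 + (2 * t.2.2.2.toNat - (-t.2.2.2).toNat)) (r.K : B) (c t • r.mon t) :=
    fun t => (((((((QComm.of_commute (Commute.refl (r.K : B))).zpow_right t.1).mul_right
      (r.XK.symm.pow_right t.2.1)).mul_right (r.phi_K.symm.pow_right t.2.2.1)).mul_right
      ((r.EK.symm.pow_right _).mul_right (r.YK.symm.pow_right _))).smul_right _)).congr (by ring)
  have hX' : ∀ t : ℤ × ℕ × ℕ × ℤ, QComm q (-t.1 - t.2.2.2) (x : B) (c t • r.mon t) := by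
    intro t
    rw [hx]
    exact (((((((r.XK.zpow_right t.1).mul_right
      ((QComm.of_commute (Commute.refl r.X)).pow_right t.2.1)).mul_right
      (r.phi_X.symm.pow_right t.2.2.1)).mul_right
      ((r.XE.pow_right _).mul_right (r.XY.pow_right _))).smul_right _)).congr
      (by have := Int.toNat_sub_toNat_neg t.2.2.2; lia))
  have hp' : ∀ t : ℤ × ℕ × ℕ × ℤ, QComm q (-t.1 + t.2.2.2) (p : B) (c t • r.mon t) := by
    intro t
    rw [hp]
    exact (((((((r.phi_K.zpow_right t.1).mul_right (r.phi_X.pow_right t.2.1)).mul_right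
      ((QComm.of_commute (Commute.refl r.phi)).pow_right t.2.2.1)).mul_right
      ((r.phi_E.pow_right _).mul_right (r.phi_Y.pow_right _))).smul_right _)).congr
      (by have := Int.toNat_sub_toNat_neg t.2.2.2; lia))
  -- The weights under `X` and `φ` are `-a - d` and `-a + d`, which fix `a` and `d`; the weight
  -- under `K` then fixes `i + j`.
  have h1 := QComm.sum_filter_eq_zero hq r.K s _ _ (fun t _ => hK t) hs
    (i₀ + j₀ + (2 * d₀.toNat - (-d₀).toNat))
  have h2 := QComm.sum_filter_eq_zero hq x _ _ _ (fun t _ => hX' t) h1 (-a₀ - d₀)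
  have h3 := QComm.sum_filter_eq_zero hq p _ _ _ (fun t _ => hp' t) h2 (-a₀ + d₀)
  obtain ⟨s', h3, hmem, ht'⟩ : ∃ s' : Finset (ℤ × ℕ × ℕ × ℤ), ∑ t ∈ s', c t • r.mon t = 0 ∧
      (∀ t ∈ s', t.1 = a₀ ∧ t.2.2.2 = d₀ ∧ t.2.1 + t.2.2.1 = i₀ + j₀) ∧ (a₀, i₀, j₀, d₀) ∈ s' := by
    refine ⟨_, h3, ?_, ?_⟩
    · rintro ⟨a, i, j, d⟩ ht
      simp only [Finset.mem_filter] at ht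
      obtain ⟨⟨⟨-, h1⟩, h2⟩, h3⟩ := ht
      dsimp only
      have hd : d = d₀ := by omega
      subst hd
      exact ⟨by omega, rfl, by omega⟩
    · simp only [Finset.mem_filter, ht, and_self]
  let b : ℤ × ℕ × ℕ × ℤ → Bˣ := fun t => r.K ^ t.1 * x ^ t.2.1 * p ^ t.2.2.1
  have hb : ∀ t, (b t : B) = (↑(r.K ^ t.1) : B) * r.X ^ t.2.1 * r.phi ^ t.2.2.1 := by
    intro t; simp [b, hx, hp]
  rcases le_or_gt 0 d₀ with hd | hd
  -- All remaining monomials end in the same power of `E`, which is nonzero but need not be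
  -- invertible. With `a` and `i + j` fixed, the weight `-2a + i - j` is injective.
  · refine QComm.coeff_eq_zero hq r.E (r.E_pow_ne_zero hq ⟨x, hx⟩) s' b
      (fun t => t.1 * -2 + t.2.1 * 1 + t.2.2.1 * -1) ?_
      (fun t _ => by rw [hb]; exact r.E_prefix _ _ _) c d₀.toNat ?_ _ ht'
    · rintro ⟨a, i, j, d⟩ h ⟨a', i', j', d'⟩ h' e
      have h1 := hmem _ h
      have h2 := hmem _ h'
      dsimp only at h1 h2 e
      simp only [Prod.mk.injEq]
      omega
    · rw [← h3]
      refine Finset.sum_congr rfl fun t ht => ?_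
      have e1 : (-t.2.2.2).toNat = 0 := by have := (hmem t ht).2.1; omega
      rw [hb, mon, e1, (hmem t ht).2.1, pow_zero, mul_one]
  · refine QComm.coeff_eq_zero hq r.Y (r.Y_pow_ne_zero hq ⟨x, hx⟩) s' b
      (fun t => t.1 * 1 + t.2.1 * -1 + t.2.2.1 * 1) ?_
      (fun t _ => by rw [hb]; exact r.Y_prefix _ _ _) c (-d₀).toNat ?_ _ ht'
    · rintro ⟨a, i, j, d⟩ h ⟨a', i', j', d'⟩ h' e
      have h1 := hmem _ h
      have h2 := hmem _ h'
      dsimp only at h1 h2 e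
      simp only [Prod.mk.injEq]
      omega
    · rw [← h3]
      refine Finset.sum_congr rfl fun t ht => ?_
      have e1 : t.2.2.2.toNat = 0 := by have := (hmem t ht).2.1; omega
      rw [hb, mon, e1, (hmem t ht).2.1, pow_zero, one_mul]

/-- The monomials span `𝒜` and their images are independent, so a relation in the image comes only
from zero coefficients. -/
theorem lift_injective (hq : ∀ n : ℕ, 0 < n → q ^ n ≠ 1) [Nontrivial B]
    (hX : IsUnit r.X) (hphi : IsUnit r.phi) : Function.Injective r.lift := by
  rw [injective_iff_map_eq_zero]
  intro a ha
  have h1 := (can q).lift_mem_span_mon hq a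
  have h2 : (can q).lift = AlgHom.id 𝕜 _ := by
    rw [← algHom_eq_lift (AlgHom.id 𝕜 (Alg q))]; rfl
  rw [h2, Finsupp.mem_span_range_iff_exists_finsupp] at h1
  obtain ⟨c, hc⟩ := h1
  have h3 : Finsupp.linearCombination 𝕜 r.mon c = 0 := by
    rw [← ha, ← AlgHom.id_apply (R := 𝕜) a, ← hc, map_finsuppSum]
    refine Finset.sum_congr rfl fun t _ => ?_
    have : r.mon t = r.lift ((can q).mon t) := by
      rw [← mon_map, can_map_lift]
    simp [this]
  have h4 := linearIndependent_iff.1 (r.mon_linearIndependent hq hX hphi) c h3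
  rw [← AlgHom.id_apply (R := 𝕜) a, ← hc, h4]
  simp

end Rep

end Faithful


/-! ### Normal elements -/

section Normal

variable {𝕜 : Type u} [Field 𝕜] {q : 𝕜ˣ}

namespace Rep

variable {B : Type*} [Ring B] [Algebra 𝕜 B] (r : Rep q B)

/-- An element that commutes with the generators up to powers of `q`. -/
def Normal (x : B) : Prop :=
  (∃ n, QComm q n x r.E) ∧ (∃ n, QComm q n x r.Y) ∧ ∃ n, QComm q n x (r.K : B)

variable {r}

/-- The elements that can be moved past `x` in both directions form a subalgebra, and
`q`-commutation puts the generators in it. -/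
theorem Normal.exists_lift {x : B} (h : r.Normal x) (a : Alg q) :
    (∃ a', x * r.lift a = r.lift a' * x) ∧ ∃ a', r.lift a * x = x * r.lift a' := by
  obtain ⟨⟨n, hE⟩, ⟨m, hY⟩, k, hK⟩ := h
  let S : Subalgebra 𝕜 (Alg q) :=
    { carrier := {a | (∃ a', x * r.lift a = r.lift a' * x) ∧ ∃ a', r.lift a * x = x * r.lift a'}
      mul_mem' := by
        rintro a b ⟨⟨a₁, ha₁⟩, a₂, ha₂⟩ ⟨⟨b₁, hb₁⟩, b₂, hb₂⟩
        refine ⟨⟨a₁ * b₁, ?_⟩, a₂ * b₂, ?_⟩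
        · rw [map_mul, ← mul_assoc, ha₁, mul_assoc, hb₁, map_mul, mul_assoc]
        · rw [map_mul, mul_assoc, hb₂, ← mul_assoc, ha₂, map_mul, mul_assoc]
      add_mem' := by
        rintro a b ⟨⟨a₁, ha₁⟩, a₂, ha₂⟩ ⟨⟨b₁, hb₁⟩, b₂, hb₂⟩
        refine ⟨⟨a₁ + b₁, ?_⟩, a₂ + b₂, ?_⟩
        · rw [map_add, mul_add, ha₁, hb₁, map_add, add_mul]
        · rw [map_add, add_mul, ha₂, hb₂, map_add, mul_add]
      algebraMap_mem' := fun s =>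
        ⟨⟨algebraMap _ _ s, by rw [AlgHom.commutes]; exact (Algebra.commutes s x).symm⟩,
          algebraMap _ _ s, by rw [AlgHom.commutes]; exact Algebra.commutes s x⟩ }
  have key : ∀ (g : Alg q) (n : ℤ), QComm q n x (r.lift g) → g ∈ S := fun g n h =>
    ⟨⟨((q ^ n : 𝕜ˣ) : 𝕜) • g, by rw [h.eq, map_smul, smul_mul_assoc]⟩,
      ((q ^ (-n) : 𝕜ˣ) : 𝕜) • g, by rw [h.symm.eq, map_smul, mul_smul_comm]⟩
  exact eq_top_of_elt_mem S (key _ n (by simpa using hE)) (key _ m (by simpa using hY))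
    (key _ k (by simpa using hK)) (key _ (-k) (by simpa using hK.inv_right)) a

/-- An element that commutes with the generators. -/
theorem commute_lift {x : B} (hE : Commute x r.E) (hY : Commute x r.Y) (hK : Commute x r.K)
    (a : Alg q) : Commute x (r.lift a) := by
  let S : Subalgebra 𝕜 (Alg q) := (Subalgebra.centralizer 𝕜 {x}).comap r.lift
  have key : ∀ g : Alg q, Commute x (r.lift g) ↔ g ∈ S := fun g => by
    rw [Subalgebra.mem_comap, Subalgebra.mem_centralizer_iff]
    exact ⟨fun h => by rintro _ rfl; exact h, fun h => h x rfl⟩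
  rw [key]
  exact eq_top_of_elt_mem S ((key _).1 (by simpa using hE)) ((key _).1 (by simpa using hY))
    ((key _).1 (by simpa using hK))
    ((key _).1 (by simpa using hK)) a

theorem normal_of_commute {x : B} (h : ∀ a, Commute x (r.lift a)) : r.Normal x :=
  ⟨⟨0, QComm.of_commute (by simpa using h (elt q .E))⟩,
    ⟨0, QComm.of_commute (by simpa using h (elt q .Y))⟩,
    0, QComm.of_commute (by simpa using h (elt q .K))⟩

theorem normal_phi : r.Normal r.phi := ⟨⟨1, r.phi_E⟩, ⟨-1, r.phi_Y⟩, -1, r.phi_K⟩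

theorem normal_X : r.Normal r.X := ⟨⟨-1, r.XE⟩, ⟨1, r.XY⟩, -1, r.XK⟩

theorem EY_of_X_eq_zero (h : r.X = 0) : QComm q (-1) r.E r.Y := by
  unfold QComm; rw [r.EY, h, zero_add, zpow_neg_one]

theorem EY_of_phi_eq_zero (h : r.phi = 0) : QComm q 1 r.E r.Y := by
  unfold QComm; rw [zpow_one]; exact sub_eq_zero.1 h

theorem normal_E_of_X (h : r.X = 0) : r.Normal r.E :=
  ⟨⟨0, QComm.of_commute (Commute.refl _)⟩, ⟨-1, EY_of_X_eq_zero h⟩, -2, r.EK⟩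

theorem normal_Y_of_X (h : r.X = 0) : r.Normal r.Y :=
  ⟨⟨_, (EY_of_X_eq_zero h).symm⟩, ⟨0, QComm.of_commute (Commute.refl _)⟩, 1, r.YK⟩

theorem normal_Y_of_phi (h : r.phi = 0) : r.Normal r.Y :=
  ⟨⟨_, (EY_of_phi_eq_zero h).symm⟩, ⟨0, QComm.of_commute (Commute.refl _)⟩, 1, r.YK⟩

end Rep

/-! ### Factor rings by maximal ideals -/

/-- The generators in a factor ring. -/
def quotRep (I : TwoSidedIdeal (Alg q)) : Rep q (Factor I) :=
  (Rep.can q).map (RingCon.mkₐ 𝕜 I.ringCon)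

theorem quotRep_lift (I : TwoSidedIdeal (Alg q)) (a : Alg q) :
    (quotRep I).lift a = proj I a := by
  unfold quotRep; rw [algHom_eq_lift]; rfl

theorem proj_surjective {R : Type*} [Ring R] (I : TwoSidedIdeal R) :
    Function.Surjective (proj I) := RingCon.mk'_surjective _

theorem proj_eq_zero_iff {R : Type*} [Ring R] (I : TwoSidedIdeal R) {a : R} :
    proj I a = 0 ↔ a ∈ I := by
  conv_rhs => rw [← TwoSidedIdeal.ker_ringCon_mk' I]
  exact (TwoSidedIdeal.mem_ker _).symm

theorem quotRep_lift_eq_zero_iff (I : TwoSidedIdeal (Alg q)) {a : Alg q} :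
    (quotRep I).lift a = 0 ↔ a ∈ I := by
  rw [quotRep_lift, proj_eq_zero_iff]

theorem quotRep_lift_surjective (I : TwoSidedIdeal (Alg q)) :
    Function.Surjective (quotRep I).lift := fun b => by
  obtain ⟨a, ha⟩ := proj_surjective I b
  exact ⟨a, by rw [quotRep_lift, ha]⟩

theorem nontrivial_factor {I : TwoSidedIdeal (Alg q)} (h : I ≠ ⊤) : Nontrivial (Factor I) := by
  refine ⟨1, 0, fun e => h ?_⟩
  rw [← TwoSidedIdeal.one_mem_iff, ← proj_eq_zero_iff, map_one, e]

/-- By normality the right ideal generated by `x` is two-sided. If `x ≠ 0`, its preimage strictly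
contains `I`, hence contains `1`. -/
theorem eq_zero_or_isUnit_of_isCoatom {I : TwoSidedIdeal (Alg q)} (hI : IsCoatom I)
    {x : Factor I} (hx : (quotRep I).Normal x) : x = 0 ∨ IsUnit x := by
  by_cases h0 : x = 0
  · exact Or.inl h0
  refine Or.inr ?_
  set r := quotRep I
  let J : TwoSidedIdeal (Alg q) := TwoSidedIdeal.mk' {a | ∃ b, r.lift a = x * r.lift b}
    ⟨0, by simp⟩
    (by
      rintro a b ⟨a', ha⟩ ⟨b', hb⟩
      exact ⟨a' + b', by rw [map_add, map_add, ha, hb, mul_add]⟩)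
    (by
      rintro a ⟨a', ha⟩
      exact ⟨-a', by rw [map_neg, map_neg, ha, mul_neg]⟩)
    (by
      rintro a b ⟨b', hb⟩
      obtain ⟨a', ha'⟩ := (hx.exists_lift a).2
      exact ⟨a' * b', by rw [map_mul, hb, ← mul_assoc, ha', map_mul, mul_assoc]⟩)
    (by
      rintro a b ⟨a', ha⟩
      exact ⟨a' * b, by rw [map_mul, ha, map_mul, mul_assoc]⟩)
  have hJ : ∀ a, a ∈ J ↔ ∃ b, r.lift a = x * r.lift b := fun a => TwoSidedIdeal.mem_mk' ..
  have hIJ : I < J := by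
    refine lt_of_le_of_ne (fun a ha => (hJ a).2 ⟨0, ?_⟩) fun e => ?_
    · rw [(quotRep_lift_eq_zero_iff I).2 ha]; simp
    · obtain ⟨a, ha⟩ := quotRep_lift_surjective I x
      have : a ∈ I := e ▸ (hJ a).2 ⟨1, by rw [map_one, mul_one]; exact ha⟩
      exact h0 (ha ▸ (quotRep_lift_eq_zero_iff I).2 this)
  have h1 : (1 : Alg q) ∈ J := by rw [hI.2 J hIJ]; trivial
  obtain ⟨b, hb⟩ := (hJ 1).1 h1
  -- Moving `x` past its right inverse `b` gives `1 = x b = c x`, a left inverse; the two agree.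
  obtain ⟨c, hc⟩ := (hx.exists_lift b).1
  rw [map_one] at hb
  exact isUnit_iff_exists.2 ⟨r.lift b, hb.symm, by
    rw [← hb] at hc
    have : r.lift b = r.lift c := by
      rw [← one_mul (r.lift b), hc, mul_assoc, ← hb, mul_one]
    rw [this, ← hc]⟩

/-! ### Simple modules -/

section Module

variable (q) (M : Type*) [AddCommGroup M] [Module 𝕜 M] [Module (Alg q) M]
  [IsScalarTower 𝕜 (Alg q) M]

/-- The action of the generators on a module. -/
def modRep : Rep q (Module.End 𝕜 M) := (Rep.can q).map (Algebra.lsmul 𝕜 𝕜 M)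

variable {M}

@[simp] theorem modRep_lift (a : Alg q) (v : M) : (modRep q M).lift a v = a • v := by
  unfold modRep; rw [algHom_eq_lift]; rfl

variable {q}

theorem modRep_lift_eq_zero_iff (a : Alg q) :
    (modRep q M).lift a = 0 ↔ a ∈ Module.annihilator (Alg q) M := by
  rw [Module.mem_annihilator, LinearMap.ext_iff]; simp

/-- Schur's lemma for an operator that commutes with `𝒜` only up to a change of the acting element:
this is enough for its kernel and its image to be submodules. -/
theorem eq_zero_or_isUnit_of_isSimpleModule [IsSimpleModule (Alg q) M]
    {x : Module.End 𝕜 M} (hx : (modRep q M).Normal x) : x = 0 ∨ IsUnit x := by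
  have hl : ∀ (a : Alg q) (v : M), ∃ a' : Alg q, x (a • v) = a' • x v := fun a v => by
    obtain ⟨a', h⟩ := (hx.exists_lift a).1
    exact ⟨a', by simpa using LinearMap.congr_fun h v⟩
  have hr : ∀ (a : Alg q) (v : M), ∃ a' : Alg q, a • x v = x (a' • v) := fun a v => by
    obtain ⟨a', h⟩ := (hx.exists_lift a).2
    exact ⟨a', by simpa using LinearMap.congr_fun h v⟩
  let N : Submodule (Alg q) M :=
    { carrier := {v | x v = 0}
      zero_mem' := by simp
      add_mem' := fun {a b} ha hb => by simp_all
      smul_mem' := fun a v hv => by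
        obtain ⟨a', h⟩ := hl a v
        change x (a • v) = 0
        rw [h, show x v = 0 from hv, smul_zero] }
  let P : Submodule (Alg q) M :=
    { carrier := {v | ∃ w, x w = v}
      zero_mem' := ⟨0, by simp⟩
      add_mem' := by rintro _ _ ⟨a, rfl⟩ ⟨b, rfl⟩; exact ⟨a + b, map_add _ _ _⟩
      smul_mem' := by
        rintro a _ ⟨v, rfl⟩
        obtain ⟨a', h⟩ := hr a v
        exact ⟨_, h.symm⟩ }
  rcases eq_bot_or_eq_top N with hN | hN
  · rcases eq_bot_or_eq_top P with hP | hP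
    · left
      ext v
      have : x v ∈ P := ⟨v, rfl⟩
      rw [hP] at this
      simpa using this
    · right
      rw [Module.End.isUnit_iff]
      refine ⟨(injective_iff_map_eq_zero x).2 fun v hv => ?_, fun v => ?_⟩
      · have : v ∈ N := hv
        rw [hN] at this
        simpa using this
      · have : v ∈ P := by rw [hP]; trivial
        exact this
  · left
    ext v
    have : v ∈ N := by rw [hN]; trivial
    exact this

end Module

end Normal

/-! ### Construction of representations -/

section Construction

variable {𝕜 : Type u} [Field 𝕜] {q : 𝕜ˣ}

/-- The representation with given `X` and `φ` and with invertible `Y`. -/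
def Rep.ofXPhi {B : Type*} [Ring B] [Algebra 𝕜 B] (hq : cst q ≠ 0) (x p : B) (y k : Bˣ)
    (xk : QComm q (-1) x (k : B)) (pk : QComm q (-1) p (k : B)) (yk : QComm q 1 (y : B) (k : B))
    (xy : QComm q 1 x (y : B)) (py : QComm q (-1) p (y : B)) (px : QComm q 0 p x) : Rep q B where
  -- Forced by `(q⁻¹ - q) Y E = φ - X`.
  E := (↑y⁻¹ : B) * ((cst q)⁻¹ • (p - x))
  X := x
  Y := y
  K := k
  EK := yk.inv_left.mul_left (((pk.symm.sub_right xk.symm).symm).smul_left _)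
  XK := xk
  YK := yk
  EX := (xy.symm.inv_left).mul_left
    (((px.symm.sub_right (QComm.of_commute (Commute.refl x)).symm).symm).smul_left _)
  XY := xy
  EY := by
    have h1 : p * (y : B) = ((q⁻¹ : 𝕜ˣ) : 𝕜) • ((y : B) * p) := by rw [← zpow_neg_one]; exact py
    have h2 : x * (y : B) = (q : 𝕜) • ((y : B) * x) := by rw [← zpow_one q]; exact xy
    have h3 : x = (cst q)⁻¹ • (cst q • x) := by rw [inv_smul_smul₀ hq]
    rw [Units.mul_inv_cancel_left, mul_assoc, smul_mul_assoc, sub_mul, h1, h2, mul_smul_comm,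
      mul_sub, mul_smul_comm, mul_smul_comm, Units.inv_mul_cancel_left, Units.inv_mul_cancel_left]
    nth_rewrite 2 [h3]
    have h4 : cst q • x = ((q⁻¹ : 𝕜ˣ) : 𝕜) • x - (q : 𝕜) • x := by rw [cst, sub_smul]
    rw [smul_comm ((q⁻¹ : 𝕜ˣ) : 𝕜), ← smul_add]
    congr 1
    rw [h4, smul_sub]
    abel

theorem Rep.ofXPhi_phi {B : Type*} [Ring B] [Algebra 𝕜 B] (hq : cst q ≠ 0) (x p : B) (y k : Bˣ)
    (xk pk yk xy py px) : (Rep.ofXPhi (q := q) hq x p y k xk pk yk xy py px).phi = p := by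
  rw [Rep.phi_eq]
  change x + cst q • ((y : B) * ((↑y⁻¹ : B) * ((cst q)⁻¹ • (p - x)))) = p
  rw [Units.mul_inv_cancel_left, smul_inv_smul₀ hq]
  abel

/-- The endomorphism `eᵢ ↦ cᵢ e_{σ i}` of a free module. -/
def monop {R ι : Type*} [CommRing R] (σ : ι → ι) (c : ι → R) : Module.End R (ι →₀ R) :=
  Finsupp.linearCombination R fun i => Finsupp.single (σ i) (c i)

section Monop

variable {R ι : Type*} [CommRing R]

@[simp] theorem monop_single (σ : ι → ι) (c : ι → R) (i : ι) (a : R) :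
    monop σ c (Finsupp.single i a) = Finsupp.single (σ i) (a * c i) := by
  simp [monop]

theorem monop_mul (σ τ : ι → ι) (c d : ι → R) :
    monop σ c * monop τ d = monop (σ ∘ τ) fun i => d i * c (τ i) := by
  ext i : 2
  simp

theorem monop_id : monop (id : ι → ι) (fun _ => (1 : R)) = 1 := by
  ext i : 2
  simp

/-- The automorphism `eᵢ ↦ cᵢ e_{σ i}` of a free module. -/
def monopUnit (σ : Equiv.Perm ι) (c : ι → Rˣ) : (Module.End R (ι →₀ R))ˣ where
  val := monop σ fun i => (c i : R)
  inv := monop σ.symm fun i => ((c (σ.symm i))⁻¹ : Rˣ)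
  val_inv := by rw [monop_mul, ← monop_id]; congr 1 <;> ext i <;> simp
  inv_val := by rw [monop_mul, ← monop_id]; congr 1 <;> ext i <;> simp

@[simp] theorem monopUnit_val (σ : Equiv.Perm ι) (c : ι → Rˣ) :
    (monopUnit σ c : Module.End R (ι →₀ R)) = monop σ fun i => (c i : R) := rfl

theorem monop_qComm [Algebra 𝕜 R] (n : ℤ) {σ τ : ι → ι} {c d : ι → R} (h : σ ∘ τ = τ ∘ σ)
    (h' : ∀ i, d i * c (τ i) = algebraMap 𝕜 R ((q ^ n : 𝕜ˣ) : 𝕜) * (c i * d (σ i))) :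
    QComm q n (monop σ c) (monop τ d) := by
  unfold QComm
  rw [monop_mul, monop_mul, h]
  ext i : 2
  simp only [LinearMap.comp_apply, Finsupp.lsingle_apply, monop_single, LinearMap.smul_apply,
    Finsupp.smul_single, one_mul, h']
  rw [Algebra.smul_def]

end Monop

end Construction


/-! ### A faithful simple module -/

section Lattice

variable {𝕜 : Type u} [Field 𝕜] (q : 𝕜ˣ)

/-- The operator `eᵢ ↦ q^{w(i)} e_{i+v}` on the lattice `ℤ × ℤ`. -/
def latticeOp (v : ℤ × ℤ) (w : ℤ × ℤ → ℤ) : (Module.End 𝕜 (ℤ × ℤ →₀ 𝕜))ˣ :=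
  monopUnit (Equiv.addRight v) fun i => q ^ w i

variable {q} in
theorem latticeOp_qComm (n : ℤ) {v v' : ℤ × ℤ} {w w' : ℤ × ℤ → ℤ}
    (h : ∀ i, w' i + w (i + v') = n + (w i + w' (i + v))) :
    QComm q n (latticeOp q v w : Module.End 𝕜 (ℤ × ℤ →₀ 𝕜)) (latticeOp q v' w') :=
  monop_qComm _ (by ext i <;> simp [add_right_comm]) fun i => by
    simp only [Algebra.algebraMap_self, RingHom.id_apply, ← Units.val_mul, ← zpow_add,
      Equiv.coe_addRight, h]

theorem latticeOp_single (v : ℤ × ℤ) (w : ℤ × ℤ → ℤ) (i : ℤ × ℤ) (a : 𝕜) :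
    (latticeOp q v w : Module.End 𝕜 (ℤ × ℤ →₀ 𝕜)) (Finsupp.single i a) =
      Finsupp.single (i + v) (a * ((q ^ w i : 𝕜ˣ) : 𝕜)) := by
  simp [latticeOp]

/-- The representation on the lattice `ℤ × ℤ`. -/
def latticeRep (hq : cst q ≠ 0) : Rep q (Module.End 𝕜 (ℤ × ℤ →₀ 𝕜)) :=
  -- `K` records the first coordinate. The summand `-2 * i.2` in `φ` makes `X Y φ Y` diagonal with
  -- eigenvalues `q^(-2 i.2)`, so the second coordinate is visible as well.
  Rep.ofXPhi hq (latticeOp q (1, 1) fun i => -i.1) (latticeOp q (1, -1) fun i => i.1 - 2 * i.2)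
    (latticeOp q (-1, 0) fun _ => 0) (latticeOp q 0 fun i => i.1)
    (latticeOp_qComm _ fun i => by simp) (latticeOp_qComm _ fun i => by simp; ring)
    (latticeOp_qComm _ fun i => by simp) (latticeOp_qComm _ fun i => by simp)
    (latticeOp_qComm _ fun i => by simp; ring) (latticeOp_qComm _ fun i => by simp; ring)

variable {q}

theorem latticeRep_phi (hq : cst q ≠ 0) :
    (latticeRep q hq).phi = latticeOp q (1, -1) fun i => i.1 - 2 * i.2 :=
  Rep.ofXPhi_phi ..

theorem latticeRep_phi_isUnit (hq : cst q ≠ 0) : IsUnit (latticeRep q hq).phi := by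
  rw [latticeRep_phi]; exact Units.isUnit _

theorem latticeRep_X_isUnit (hq : cst q ≠ 0) : IsUnit (latticeRep q hq).X :=
  (latticeOp q (1, 1) fun i => -i.1).isUnit

theorem latticeRep_Y_ne_zero (hq : cst q ≠ 0) : (latticeRep q hq).Y ≠ 0 :=
  (latticeOp q (-1, 0) fun _ => 0).ne_zero

theorem elt_Y_ne_zero (hq : ∀ n : ℕ, 0 < n → q ^ n ≠ 1) : elt q .Y ≠ 0 := fun h =>
  latticeRep_Y_ne_zero (cst_ne_zero hq) (by rw [← Rep.lift_Y, h, map_zero])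

theorem elt_E_ne_zero (hq : ∀ n : ℕ, 0 < n → q ^ n ≠ 1) : elt q .E ≠ 0 := fun h =>
  (latticeRep q (cst_ne_zero hq)).E_pow_ne_zero hq (latticeRep_X_isUnit _) 1
    (by rw [← Rep.lift_E, h, map_zero, zero_pow one_ne_zero])

end Lattice

/-! ### The ideals that contain `Y` and `E` -/

section Counit

theorem laurentHom_ext {k B : Type*} [CommRing k] [Ring B] [Algebra k B]
    {f g : k[T;T⁻¹] →ₐ[k] B} (h : f (LaurentPolynomial.T 1) = g (LaurentPolynomial.T 1)) :
    f = g := by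
  apply (AddMonoidAlgebra.lift k B ℤ).symm.injective
  exact MonoidHom.ext_mint h

variable {𝕜 : Type u} [Field 𝕜] (q : 𝕜ˣ)

/-- The representation in `𝕜[K^{±1}]` in which `E`, `X`, `Y` act as zero. -/
def counitRep : Rep q 𝕜[T;T⁻¹] where
  E := 0
  X := 0
  Y := 0
  K := scaledT 1
  EK := QComm.zero_left _ _
  XK := QComm.zero_left _ _
  YK := QComm.zero_left _ _
  EX := QComm.zero_left _ _
  XY := QComm.zero_left _ _
  EY := by simp

theorem inclD_T_one : inclD q (LaurentPolynomial.T 1) = elt q .K := by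
  unfold inclD; rw [laurentHom_T, zpow_one]; rfl

theorem inclD_T_neg_one : inclD q (LaurentPolynomial.T (-1)) = elt q .Kinv := by
  unfold inclD; rw [laurentHom_T, zpow_neg_one]; rfl

theorem counitRep_lift_inclD (d : 𝕜[T;T⁻¹]) : (counitRep q).lift (inclD q d) = d := by
  have : (counitRep q).lift.comp (inclD q) = AlgHom.id 𝕜 _ := by
    apply laurentHom_ext
    rw [AlgHom.comp_apply, inclD_T_one, Rep.lift_K]
    simp [counitRep, scaledT]
  exact DFunLike.congr_fun this d

/-- Modulo `Y` and `E`, hence modulo `X`, only polynomials in `K^{±1}` remain. The elements for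
which this holds form a subalgebra that contains the generators. -/
theorem sub_inclD_counit_mem {I : TwoSidedIdeal (Alg q)} (hY : elt q .Y ∈ I) (hE : elt q .E ∈ I)
    (a : Alg q) : a - inclD q ((counitRep q).lift a) ∈ I := by
  let S : Subalgebra 𝕜 (Alg q) :=
    { carrier := {a | a - inclD q ((counitRep q).lift a) ∈ I}
      mul_mem' := fun {a b} ha hb => by
        have : a * b - inclD q ((counitRep q).lift (a * b)) =
            (a - inclD q ((counitRep q).lift a)) * b +
            inclD q ((counitRep q).lift a) * (b - inclD q ((counitRep q).lift b)) := by
          rw [map_mul, map_mul, sub_mul, mul_sub]; abel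
        change _ ∈ I
        rw [this]
        exact I.add_mem (I.mul_mem_right _ _ ha) (I.mul_mem_left _ _ hb)
      add_mem' := fun {a b} ha hb => by
        have : a + b - inclD q ((counitRep q).lift (a + b)) =
            (a - inclD q ((counitRep q).lift a)) + (b - inclD q ((counitRep q).lift b)) := by
          rw [map_add, map_add]; abel
        change _ ∈ I
        rw [this]
        exact I.add_mem ha hb
      algebraMap_mem' := fun s => by
        change _ ∈ I
        rw [AlgHom.commutes, AlgHom.commutes, sub_self]
        exact I.zero_mem }
  refine eq_top_of_elt_mem S ?_ ?_ ?_ ?_ a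
  · change _ ∈ I
    simpa [counitRep] using hE
  · change _ ∈ I
    simpa [counitRep] using hY
  · change _ ∈ I
    have : (counitRep q).lift (elt q .K) = LaurentPolynomial.T 1 := by
      simp [counitRep, scaledT]
    rw [this, inclD_T_one, sub_self]
    exact I.zero_mem
  · change _ ∈ I
    have : (counitRep q).lift (elt q .Kinv) = LaurentPolynomial.T (-1) := by
      rw [Rep.lift_Kinv]
      change LaurentPolynomial.C (((1 : 𝕜ˣ)⁻¹ : 𝕜ˣ) : 𝕜) * LaurentPolynomial.T (-1) = _
      simp
    rw [this, inclD_T_neg_one, sub_self]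
    exact I.zero_mem

variable {q}

theorem mem_idealP {𝔭 : Ideal 𝕜[T;T⁻¹]} {a : Alg q} :
    a ∈ idealP q 𝔭 ↔ (counitRep q).lift a ∈ 𝔭 := by
  have hs : ∀ x ∈ ({elt q .Y, elt q .E} ∪ inclD q '' (𝔭 : Set 𝕜[T;T⁻¹]) : Set (Alg q)),
      x ∈ idealP q 𝔭 := fun x hx => TwoSidedIdeal.subset_span hx
  constructor
  · intro h
    have : idealP q 𝔭 ≤ TwoSidedIdeal.comap (counitRep q).lift 𝔭.toTwoSided := by
      refine TwoSidedIdeal.span_le.2 ?_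
      rintro x ((rfl | rfl) | ⟨d, hd, rfl⟩)
      all_goals
        rw [SetLike.mem_coe, TwoSidedIdeal.mem_comap, Ideal.mem_toTwoSided]
      · simp [counitRep]
      · simp [counitRep]
      · rwa [counitRep_lift_inclD]
    have := this h
    rwa [TwoSidedIdeal.mem_comap, Ideal.mem_toTwoSided] at this
  · intro h
    have h1 := sub_inclD_counit_mem q (hs (elt q .Y) (by simp)) (hs (elt q .E) (by simp)) a
    have h2 := hs _ (Or.inr ⟨_, h, rfl⟩)
    have := (idealP q 𝔭).add_mem h1 h2
    rwa [sub_add_cancel] at this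

theorem idealP_ne_top {𝔭 : Ideal 𝕜[T;T⁻¹]} (h : 𝔭 ≠ ⊤) : idealP q 𝔭 ≠ ⊤ := by
  rw [Ne, ← TwoSidedIdeal.one_mem_iff, mem_idealP, map_one]
  exact (Ideal.ne_top_iff_one _).1 h

theorem Y_mem_idealP (𝔭 : Ideal 𝕜[T;T⁻¹]) : elt q .Y ∈ idealP q 𝔭 := by
  rw [mem_idealP]; simp [counitRep]

theorem E_mem_idealP (𝔭 : Ideal 𝕜[T;T⁻¹]) : elt q .E ∈ idealP q 𝔭 := by
  rw [mem_idealP]; simp [counitRep]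

theorem inclD_mem_idealP {𝔭 : Ideal 𝕜[T;T⁻¹]} {d : 𝕜[T;T⁻¹]} (h : d ∈ 𝔭) :
    inclD q d ∈ idealP q 𝔭 := by
  rwa [mem_idealP, counitRep_lift_inclD]

theorem isCoatom_of_forall {R : Type*} [Ring R] {I : TwoSidedIdeal R} (h1 : I ≠ ⊤)
    (h : ∀ J : TwoSidedIdeal R, I ≤ J → J ≠ ⊤ → J ≤ I) : IsCoatom I :=
  ⟨h1, fun J hJ => by_contra fun e => hJ.not_ge (h J hJ.le e)⟩

/-- An ideal that contains `Y` and `E` and is proper lies in an ideal `(Y, E, 𝔭)`. -/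
theorem exists_le_idealP {I : TwoSidedIdeal (Alg q)} (hI : I ≠ ⊤) (hY : elt q .Y ∈ I)
    (hE : elt q .E ∈ I) {𝔞 : Ideal 𝕜[T;T⁻¹]} (h : ∀ d ∈ 𝔞, inclD q d ∈ I) :
    ∃ 𝔭 : Ideal 𝕜[T;T⁻¹], 𝔭.IsMaximal ∧ 𝔞 ≤ 𝔭 ∧ I ≤ idealP q 𝔭 := by
  have h1 : I.asIdeal.comap (inclD q).toRingHom ≠ ⊤ := by
    rw [Ideal.ne_top_iff_one, Ideal.mem_comap, map_one, TwoSidedIdeal.mem_asIdeal,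
      TwoSidedIdeal.one_mem_iff]
    exact hI
  obtain ⟨𝔭, h𝔭, hle⟩ := Ideal.exists_le_maximal _ h1
  refine ⟨𝔭, h𝔭, fun d hd => hle (TwoSidedIdeal.mem_asIdeal.2 (h d hd)), fun a ha => ?_⟩
  rw [mem_idealP]
  refine hle (TwoSidedIdeal.mem_asIdeal.2 ?_)
  have := I.sub_mem ha (sub_inclD_counit_mem q hY hE a)
  rwa [sub_sub_cancel] at this

theorem isCoatom_idealP {𝔭 : Ideal 𝕜[T;T⁻¹]} (h : 𝔭.IsMaximal) : IsCoatom (idealP q 𝔭) := by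
  refine isCoatom_of_forall (idealP_ne_top h.ne_top) fun J hJ hne => ?_
  obtain ⟨𝔮, h𝔮, hle, hJ'⟩ := exists_le_idealP hne (hJ (Y_mem_idealP 𝔭)) (hJ (E_mem_idealP 𝔭))
    fun d hd => hJ (inclD_mem_idealP hd)
  rwa [h.eq_of_le h𝔮.ne_top hle]

theorem mem_famP_of_isCoatom {I : TwoSidedIdeal (Alg q)} (hI : IsCoatom I) (hY : elt q .Y ∈ I)
    (hE : elt q .E ∈ I) : I ∈ famP q := by
  obtain ⟨𝔭, h𝔭, -, hle⟩ := exists_le_idealP hI.1 hY hE (𝔞 := ⊥) (by simp [I.zero_mem])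
  exact ⟨𝔭, h𝔭, ((hI.le_iff.1 hle).resolve_left (idealP_ne_top h𝔭.ne_top)).symm⟩

theorem exists_maximal_ne_bot (k : Type*) [Field k] :
    ∃ 𝔭 : Ideal k[T;T⁻¹], 𝔭.IsMaximal ∧ ∃ d ∈ 𝔭, d ≠ 0 := by
  let f : k[T;T⁻¹] →ₐ[k] k := laurentHom 1
  refine ⟨RingHom.ker f, RingHom.ker_isMaximal_of_surjective f fun a => ⟨algebraMap _ _ a, f.commutes a⟩,
    LaurentPolynomial.T 1 - 1, ?_, ?_⟩
  · rw [RingHom.mem_ker, map_sub, map_one, laurentHom_T]; simp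
  · rw [sub_ne_zero, ← LaurentPolynomial.T_zero]
    intro h
    have := congrArg (fun p => p.coeff 0) h
    simp at this

/-- The ideal `(Y, E)` is not maximal. -/
theorem not_isCoatom_of_le_ker {I : TwoSidedIdeal (Alg q)}
    (h : ∀ a ∈ I, (counitRep q).lift a = 0) : ¬ IsCoatom I := by
  intro hI
  obtain ⟨𝔭, h𝔭, d, hd, hd0⟩ := exists_maximal_ne_bot 𝕜
  have hle : I ≤ idealP q 𝔭 := fun a ha => mem_idealP.2 (by rw [h a ha]; exact 𝔭.zero_mem)
  have := (hI.le_iff.1 hle).resolve_left (idealP_ne_top h𝔭.ne_top)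
  have h1 := h _ (this ▸ inclD_mem_idealP hd)
  rw [counitRep_lift_inclD] at h1
  exact hd0 h1

theorem not_isCoatom_span_of_counit {a : Alg q} (h : (counitRep q).lift a = 0) :
    ¬ IsCoatom (TwoSidedIdeal.span {a}) := by
  refine not_isCoatom_of_le_ker fun b hb => ?_
  have : TwoSidedIdeal.span {a} ≤ TwoSidedIdeal.ker (counitRep q).lift :=
    TwoSidedIdeal.span_le.2 (by
      rintro _ rfl; exact (TwoSidedIdeal.mem_ker _).2 h)
  exact (TwoSidedIdeal.mem_ker _).1 (this hb)

theorem not_isCoatom_bot : ¬ IsCoatom (⊥ : TwoSidedIdeal (Alg q)) :=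
  not_isCoatom_of_le_ker fun a ha => by rw [(TwoSidedIdeal.mem_bot _).1 ha, map_zero]

end Counit


/-! ### The skew Laurent polynomial ring -/

namespace SkewLaurent

variable {D : Type*} [CommRing D] (ρ : RingAut D)

/-- The powers of the variable. -/
def varHom : Multiplicative ℤ →* SkewLaurent ρ :=
  letI := zpowAction ρ
  SkewMonoidAlgebra.of D (Multiplicative ℤ)

/-- The variable, as a unit. -/
def varUnit : (SkewLaurent ρ)ˣ := Units.map (varHom ρ) (toUnits (Multiplicative.ofAdd 1))

theorem varUnit_zpow (n : ℤ) :
    (↑(varUnit ρ ^ n) : SkewLaurent ρ) = varHom ρ (Multiplicative.ofAdd n) := by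
  unfold varUnit
  rw [← map_zpow, ← map_zpow, ← ofAdd_zsmul]
  simp

/-- The term `d Yⁿ`. -/
def term (n : ℤ) (d : D) : SkewLaurent ρ :=
  SkewMonoidAlgebra.single (Multiplicative.ofAdd n) d

theorem const_mul_zpow (n : ℤ) (d : D) : const ρ d * (↑(varUnit ρ ^ n) : SkewLaurent ρ) =
    term ρ n d := by
  let := zpowAction ρ
  rw [varUnit_zpow]
  refine (SkewMonoidAlgebra.single_mul_single (a₁ := (1 : Multiplicative ℤ))
    (a₂ := Multiplicative.ofAdd n) (b₁ := d) (b₂ := 1)).trans ?_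
  rw [one_mul, one_smul, mul_one]; rfl

theorem var_mul_const (d : D) : var ρ * const ρ d = const ρ (ρ d) * var ρ := by
  let := zpowAction ρ
  refine (SkewMonoidAlgebra.single_mul_single (a₁ := Multiplicative.ofAdd (1 : ℤ))
    (a₂ := 1) (b₁ := 1) (b₂ := d)).trans (Eq.symm ?_)
  refine (SkewMonoidAlgebra.single_mul_single (a₁ := (1 : Multiplicative ℤ))
    (a₂ := Multiplicative.ofAdd (1 : ℤ)) (b₁ := ρ d) (b₂ := 1)).trans ?_
  rw [one_mul, one_smul, mul_one, one_mul, mul_one]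
  rfl

/-- The coefficient of `Yⁿ`. -/
def coeffHom (n : ℤ) : SkewLaurent ρ →+ D where
  toFun s := SkewMonoidAlgebra.coeff (k := D) (G := Multiplicative ℤ) s (Multiplicative.ofAdd n)
  map_zero' := rfl
  map_add' a b := DFunLike.congr_fun
    (SkewMonoidAlgebra.coeff_add (k := D) (G := Multiplicative ℤ) a b) _

theorem coeffHom_const_mul_zpow (n m : ℤ) (d : D) :
    coeffHom ρ n (const ρ d * (↑(varUnit ρ ^ m) : SkewLaurent ρ)) = if m = n then d else 0 := by
  classical
  rw [const_mul_zpow]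
  refine (SkewMonoidAlgebra.coeff_single_apply ..).trans ?_
  by_cases h : m = n
  · subst h; simp
  · have h' : n ≠ m := Ne.symm h
    simp [h]

theorem exists_sum (s : SkewLaurent ρ) :
    ∃ c : ℤ →₀ D, s = c.sum fun n d => const ρ d * (↑(varUnit ρ ^ n) : SkewLaurent ρ) := by
  have : ∀ s : SkewMonoidAlgebra D (Multiplicative ℤ), s ∈
      (Finsupp.liftAddHom (M := D) (N := SkewLaurent ρ) (α := ℤ) fun n =>
        (AddMonoidHom.mulRight (↑(varUnit ρ ^ n) : SkewLaurent ρ)).comp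
          (const ρ : D →+ SkewLaurent ρ)).range := by
    intro s
    induction s using SkewMonoidAlgebra.induction_on with
    | zero => exact AddSubgroup.zero_mem _
    | single g d =>
      refine ⟨Finsupp.single g.toAdd d, ?_⟩
      rw [Finsupp.liftAddHom_apply_single]
      exact const_mul_zpow ρ _ d
    | add a b ha hb => exact AddSubgroup.add_mem _ ha hb
  obtain ⟨c, hc⟩ := this s
  exact ⟨c, hc.symm⟩

section Lift

variable {ρ} {R : Type*} [Ring R] {f : D →+* R} {y : Rˣ}

theorem zpow_mul_comm (h : ∀ d, (y : R) * f d = f (ρ d) * y) (n : ℤ) (d : D) :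
    (↑(y ^ n) : R) * f d = f ((ρ ^ n : RingAut D) d) * (↑(y ^ n) : R) := by
  have h' : ∀ d, (↑y⁻¹ : R) * f d = f ((ρ⁻¹ : RingAut D) d) * (↑y⁻¹ : R) := fun d => by
    have h1 := h ((ρ⁻¹ : RingAut D) d)
    have h2 : ρ ((ρ⁻¹ : RingAut D) d) = d := ρ.apply_symm_apply d
    rw [h2] at h1
    rw [Units.inv_mul_eq_iff_eq_mul, ← mul_assoc, h1, Units.mul_inv_cancel_right]
  induction n generalizing d with
  | zero => simp
  | succ n ih =>
    rw [zpow_add_one, zpow_add_one, Units.val_mul, mul_assoc, h, ← mul_assoc, ih, mul_assoc]; rfl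
  | pred n ih =>
    rw [zpow_sub_one, zpow_sub_one, Units.val_mul, mul_assoc, h', ← mul_assoc, ih, mul_assoc]; rfl

/-- The universal property of the skew Laurent polynomial ring. -/
def lift (h : ∀ d, (y : R) * f d = f (ρ d) * y) : SkewLaurent ρ →+* R :=
  letI := zpowAction ρ
  SkewMonoidAlgebra.liftNCRingHom f ((Units.coeHom R).comp (zpowersHom Rˣ y))
    (fun {d g} => (zpow_mul_comm h g.toAdd d).symm)

theorem lift_const (h : ∀ d, (y : R) * f d = f (ρ d) * y) (d : D) : lift h (const ρ d) = f d := by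
  refine (SkewMonoidAlgebra.liftNC_single _ _ _ _).trans ?_
  simp

theorem lift_var (h : ∀ d, (y : R) * f d = f (ρ d) * y) : lift h (var ρ) = y := by
  refine (SkewMonoidAlgebra.liftNC_single _ _ _ _).trans ?_
  simp

end Lift

section Restrict

variable {ρ} {R : Type*} [Ring R] (Φ : SkewLaurent ρ →+* R)

/-- The restriction of a homomorphism to the coefficients. -/
def restrict : D →+* R := Φ.comp (const ρ)

/-- The image of the variable. -/
def imageVar : Rˣ := Units.map (Φ : SkewLaurent ρ →* R) (varUnit ρ)

theorem restrict_apply (d : D) : restrict Φ d = Φ (const ρ d) := rfl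

theorem commute_restrict (d d' : D) : Commute (restrict Φ d) (restrict Φ d') :=
  (Commute.all d d').map (restrict Φ)

theorem imageVar_val : (imageVar Φ : R) = Φ (var ρ) := rfl

theorem imageVar_mul_restrict (d : D) :
    (imageVar Φ : R) * restrict Φ d = restrict Φ (ρ d) * imageVar Φ := by
  rw [imageVar_val, restrict_apply, restrict_apply, ← map_mul, var_mul_const, map_mul]

theorem map_term (n : ℤ) (d : D) : Φ (const ρ d * (↑(varUnit ρ ^ n) : SkewLaurent ρ)) =
    restrict Φ d * (↑(imageVar Φ ^ n) : R) := by
  rw [map_mul, imageVar, ← map_zpow]; rfl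

end Restrict

end SkewLaurent

/-! ### Torus representations -/

section Coeff

variable {𝕜 : Type*} [Field 𝕜] {q : 𝕜ˣ} {B : Type*} [Ring B] [Algebra 𝕜 B]

/-- The powers of a unit `v` are independent over the elements that commute with a unit `u` that
`q`-commutes with `v`. -/
theorem QComm.left_coeff_eq_zero (hq : ∀ n : ℕ, 0 < n → q ^ n ≠ 1) {u v : Bˣ} {m : ℤ}
    (hm : m ≠ 0) (huv : QComm q m (u : B) (v : B)) (s : Finset ℤ) (w : ℤ → B)
    (hw : ∀ i ∈ s, Commute (u : B) (w i)) (hs : ∑ i ∈ s, w i * (↑(v ^ i) : B) = 0) :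
    ∀ i ∈ s, w i = 0 := by
  classical
  intro i hi
  have h := QComm.sum_filter_eq_zero hq u s _ (fun i => 0 + i * m)
    (fun i hi => (QComm.of_commute (hw i hi)).mul_right (huv.zpow_right i)) hs (0 + i * m)
  have : (s.filter fun j => 0 + j * m = 0 + i * m) = {i} := by
    ext j
    simp only [Finset.mem_filter, Finset.mem_singleton, zero_add, mul_left_inj' hm]
    exact ⟨fun h => h.2, fun h => ⟨h ▸ hi, h⟩⟩
  rw [this, Finset.sum_singleton] at h
  exact (Units.mul_left_eq_zero (v ^ i)).1 h

end Coeff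

section Torus

variable {𝕜 : Type u} [Field 𝕜] {q : 𝕜ˣ}

theorem rho_T (𝔞 : Ideal 𝕜[X]) : rho q 𝔞 (LaurentPolynomial.T 1) =
    LaurentPolynomial.C (Ideal.Quotient.mk 𝔞 (Polynomial.C (q : 𝕜))) * LaurentPolynomial.T 1 :=
  scale_T _

theorem rho_C (𝔞 : Ideal 𝕜[X]) (l : 𝕜[X] ⧸ 𝔞) :
    rho q 𝔞 (LaurentPolynomial.C l) = LaurentPolynomial.C l :=
  (scale (Units.map (algebraMap 𝕜 (𝕜[X] ⧸ 𝔞)).toMonoidHom q)).commutes l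

/-- `T` as a unit. -/
def unitT (k : Type*) [CommRing k] : (k[T;T⁻¹])ˣ where
  val := LaurentPolynomial.T 1
  inv := LaurentPolynomial.T (-1)
  val_inv := by rw [← LaurentPolynomial.T_add]; simp
  inv_val := by rw [← LaurentPolynomial.T_add]; simp

theorem unitT_zpow {k : Type*} [CommRing k] (n : ℤ) :
    ((unitT k ^ n : (k[T;T⁻¹])ˣ) : k[T;T⁻¹]) = LaurentPolynomial.T n := by
  cases n with
  | ofNat n => simp [unitT, LaurentPolynomial.T_pow]
  | negSucc n =>
    rw [zpow_negSucc, ← inv_pow, Units.val_pow_eq_pow_val]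
    change LaurentPolynomial.T (-1) ^ (n + 1) = _
    rw [LaurentPolynomial.T_pow, Int.negSucc_eq]
    congr 1; push_cast; ring

theorem eq_sum_C_mul_T {k : Type*} [CommRing k] (d : k[T;T⁻¹]) :
    d = d.coeff.sum fun n a => LaurentPolynomial.C a * ((unitT k ^ n : (k[T;T⁻¹])ˣ) : k[T;T⁻¹]) := by
  simp only [unitT_zpow, ← LaurentPolynomial.single_eq_C_mul_T]
  exact (AddMonoidAlgebra.sum_coeff_single d).symm

variable {B : Type*} [Ring B] [Algebra 𝕜 B]

/-- A homomorphism from the skew Laurent polynomial ring is injective if it is injective on the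
field of constants. -/
theorem skewLaurent_injective (hq : ∀ n : ℕ, 0 < n → q ^ n ≠ 1) {𝔞 : Ideal 𝕜[X]}
    (Φ : SkewLaurent (D := (𝕜[X] ⧸ 𝔞)[T;T⁻¹]) (rho q 𝔞) →+* B)
    (h𝕜 : ∀ c : 𝕜, Φ (SkewLaurent.const _
      (LaurentPolynomial.C (Ideal.Quotient.mk 𝔞 (Polynomial.C c)))) = algebraMap 𝕜 B c)
    (hinj : ∀ l, Φ (SkewLaurent.const _ (LaurentPolynomial.C l)) = 0 → l = 0) :
    Function.Injective Φ := by
  let f := SkewLaurent.restrict Φ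
  let k : Bˣ := Units.map (f : (𝕜[X] ⧸ 𝔞)[T;T⁻¹] →* B) (unitT (𝕜[X] ⧸ 𝔞))
  let y : Bˣ := SkewLaurent.imageVar Φ
  have hk : (k : B) = f (LaurentPolynomial.T 1) := rfl
  have hy : ∀ d, (y : B) * f d = f (rho q 𝔞 d) * y := SkewLaurent.imageVar_mul_restrict Φ
  have hyk : QComm q 1 (y : B) (k : B) := by
    unfold QComm
    rw [hk, hy, rho_T, map_mul, zpow_one, Algebra.smul_def, ← h𝕜, mul_assoc]; rfl
  have hyl : ∀ l, Commute (y : B) (f (LaurentPolynomial.C l)) := fun l => by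
    have := hy (LaurentPolynomial.C l)
    rwa [rho_C] at this
  -- On coefficients: conjugation by the image of `Y` fixes the constants and multiplies `Kⁿ` by
  -- `qⁿ`, which separates the powers of `K`.
  have hfinj : ∀ d, f d = 0 → d = 0 := by
    intro d hd
    have h1 := congrArg f (eq_sum_C_mul_T d)
    rw [hd, map_finsuppSum] at h1
    have h2 := QComm.left_coeff_eq_zero hq one_ne_zero hyk d.coeff.support
      (fun n => f (LaurentPolynomial.C (d.coeff n))) (fun i _ => hyl _) (by
        rw [h1, Finsupp.sum]
        refine Finset.sum_congr rfl fun n _ => ?_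
        rw [map_mul, ← map_zpow, Units.coe_map]; rfl)
    ext n
    by_cases hn : n ∈ d.coeff.support
    · exact hinj _ (h2 n hn)
    · simpa using hn
  rw [injective_iff_map_eq_zero]
  intro s hs
  obtain ⟨c, rfl⟩ := SkewLaurent.exists_sum _ s
  rw [map_finsuppSum] at hs
  -- Now the roles are exchanged: conjugation by `K` fixes the coefficient ring and separates the
  -- powers of `Y`.
  have h2 := QComm.left_coeff_eq_zero hq (by norm_num) hyk.symm c.support
    (fun n => f (c n)) (fun i _ => SkewLaurent.commute_restrict Φ _ _) (by
      rw [← hs, Finsupp.sum]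
      exact Finset.sum_congr rfl fun n _ => (SkewLaurent.map_term Φ n (c n)).symm)
  have hc : c = 0 := by
    ext1 n
    by_cases hn : n ∈ c.support
    · exact hfinj _ (h2 n hn)
    · exact Finsupp.notMem_support_iff.1 hn
  rw [hc, Finsupp.sum_zero_index]

/-- Representations in which `Y` is invertible and `E` is a multiple of `z Kᵃ Yᵇ` for a central
element `z`. -/
structure TorusRep (r : Rep q B) (z : B) (y : Bˣ) : Prop where
  y_eq : (y : B) = r.Y
  comm : ∀ a, Commute z (r.lift a)
  E_eq : ∃ (s : 𝕜) (a b : ℤ), r.E = s • (z * (↑(r.K ^ a) : B) * (↑(y ^ b) : B))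

namespace TorusRep

variable {r : Rep q B} {z : B} {y : Bˣ}

theorem commute_Y (h : TorusRep r z y) : Commute z y := by
  rw [h.y_eq, ← r.lift_Y]; exact h.comm _

theorem commute_K (h : TorusRep r z y) : Commute z r.K := by
  rw [← r.lift_K]; exact h.comm _

theorem yK (h : TorusRep r z y) : QComm q 1 (y : B) (r.K : B) := by
  rw [h.y_eq]; exact r.YK

/-- The central subring. -/
def constHom (z : B) {𝔞 : Ideal 𝕜[X]} (h𝔞 : ∀ f ∈ 𝔞, Polynomial.aeval z f = 0) :
    𝕜[X] ⧸ 𝔞 →+* B :=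
  Ideal.Quotient.lift 𝔞 (Polynomial.aeval (R := 𝕜) z).toRingHom h𝔞

theorem constHom_mk {𝔞 : Ideal 𝕜[X]} (h𝔞 : ∀ f ∈ 𝔞, Polynomial.aeval z f = 0) (f : 𝕜[X]) :
    constHom z h𝔞 (Ideal.Quotient.mk 𝔞 f) = Polynomial.aeval z f := rfl

theorem commute_constHom {x : B} (hx : Commute z x) {𝔞 : Ideal 𝕜[X]}
    (h𝔞 : ∀ f ∈ 𝔞, Polynomial.aeval z f = 0) (l : 𝕜[X] ⧸ 𝔞) : Commute (constHom z h𝔞 l) x := by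
  obtain ⟨f, rfl⟩ := Ideal.Quotient.mk_surjective l
  rw [constHom_mk]
  induction f using Polynomial.induction_on' with
  | add f g hf hg => rw [map_add]; exact hf.add_left hg
  | monomial n a =>
    rw [Polynomial.aeval_monomial]
    exact (show Commute _ x from Algebra.commutes a x).mul_left (hx.pow_left n)

/-- The homomorphism on `L[K^{±1}]`. -/
def laurentMap (h : TorusRep r z y) {𝔞 : Ideal 𝕜[X]} (h𝔞 : ∀ f ∈ 𝔞, Polynomial.aeval z f = 0) :
    (𝕜[X] ⧸ 𝔞)[T;T⁻¹] →+* B :=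
  AddMonoidAlgebra.liftNCRingHom (constHom z h𝔞) ((Units.coeHom B).comp (zpowersHom Bˣ r.K))
    fun l n => commute_constHom (h.commute_K.units_zpow_right n.toAdd) h𝔞 l

theorem laurentMap_C_mul_T (h : TorusRep r z y) {𝔞 : Ideal 𝕜[X]}
    (h𝔞 : ∀ f ∈ 𝔞, Polynomial.aeval z f = 0) (l : 𝕜[X] ⧸ 𝔞) (n : ℤ) :
    h.laurentMap h𝔞 (LaurentPolynomial.C l * LaurentPolynomial.T n) =
      constHom z h𝔞 l * (↑(r.K ^ n) : B) := by
  rw [← LaurentPolynomial.single_eq_C_mul_T]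
  exact AddMonoidAlgebra.liftNCRingHom_single ..

theorem laurentMap_C (h : TorusRep r z y) {𝔞 : Ideal 𝕜[X]}
    (h𝔞 : ∀ f ∈ 𝔞, Polynomial.aeval z f = 0) (l : 𝕜[X] ⧸ 𝔞) :
    h.laurentMap h𝔞 (LaurentPolynomial.C l) = constHom z h𝔞 l := by
  have := h.laurentMap_C_mul_T h𝔞 l 0
  simpa using this

theorem laurentMap_T (h : TorusRep r z y) {𝔞 : Ideal 𝕜[X]}
    (h𝔞 : ∀ f ∈ 𝔞, Polynomial.aeval z f = 0) (n : ℤ) :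
    h.laurentMap h𝔞 (LaurentPolynomial.T n) = (↑(r.K ^ n) : B) := by
  have := h.laurentMap_C_mul_T h𝔞 1 n
  simpa using this

theorem y_mul_laurentMap (h : TorusRep r z y) {𝔞 : Ideal 𝕜[X]}
    (h𝔞 : ∀ f ∈ 𝔞, Polynomial.aeval z f = 0) (d : (𝕜[X] ⧸ 𝔞)[T;T⁻¹]) :
    (y : B) * h.laurentMap h𝔞 d = h.laurentMap h𝔞 (rho q 𝔞 d) * y := by
  -- After conjugation by `y` the claim is an equality of two ring homomorphisms, to be checked on
  -- constants and on `T`.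
  let u : B →+* B :=
    { toFun := fun b => y * b * (↑y⁻¹ : B)
      map_one' := by simp
      map_mul' := fun a b => by simp [mul_assoc]
      map_zero' := by simp
      map_add' := fun a b => by simp [mul_add, add_mul] }
  have : u.comp (h.laurentMap h𝔞) = (h.laurentMap h𝔞).comp (rho q 𝔞 : _ →+* _) := by
    refine AddMonoidAlgebra.ringHom_ext' ?_ ?_
    · refine RingHom.ext fun l => ?_
      change (y : B) * h.laurentMap h𝔞 (LaurentPolynomial.C l) * (↑y⁻¹ : B) =
        h.laurentMap h𝔞 (rho q 𝔞 (LaurentPolynomial.C l))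
      rw [rho_C, laurentMap_C, ← (commute_constHom h.commute_Y h𝔞 l).eq,
        Units.mul_inv_cancel_right]
    · refine MonoidHom.ext_mint ?_
      change (y : B) * h.laurentMap h𝔞 (LaurentPolynomial.T 1) * (↑y⁻¹ : B) =
        h.laurentMap h𝔞 (rho q 𝔞 (LaurentPolynomial.T 1))
      rw [rho_T, laurentMap_C_mul_T, laurentMap_T, constHom_mk, zpow_one, h.yK.eq, zpow_one,
        smul_mul_assoc, Units.mul_inv_cancel_right, Polynomial.aeval_C, Algebra.smul_def]
  have := DFunLike.congr_fun this d
  change (y : B) * h.laurentMap h𝔞 d * (↑y⁻¹ : B) = h.laurentMap h𝔞 (rho q 𝔞 d) at this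
  rw [← this, Units.inv_mul_cancel_right]

/-- The homomorphism from the skew Laurent polynomial ring. -/
def hom (h : TorusRep r z y) {𝔞 : Ideal 𝕜[X]} (h𝔞 : ∀ f ∈ 𝔞, Polynomial.aeval z f = 0) :
    SkewLaurent (D := (𝕜[X] ⧸ 𝔞)[T;T⁻¹]) (rho q 𝔞) →+* B :=
  SkewLaurent.lift (h.y_mul_laurentMap h𝔞)

variable (h : TorusRep r z y) {𝔞 : Ideal 𝕜[X]} (h𝔞 : ∀ f ∈ 𝔞, Polynomial.aeval z f = 0)

theorem hom_C (l : 𝕜[X] ⧸ 𝔞) :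
    h.hom h𝔞 (SkewLaurent.const _ (LaurentPolynomial.C l)) = constHom z h𝔞 l := by
  unfold hom; rw [SkewLaurent.lift_const, laurentMap_C]

theorem hom_T (n : ℤ) :
    h.hom h𝔞 (SkewLaurent.const _ (LaurentPolynomial.T n)) = (↑(r.K ^ n) : B) := by
  unfold hom; rw [SkewLaurent.lift_const, laurentMap_T]

theorem hom_var : h.hom h𝔞 (SkewLaurent.var _) = y := SkewLaurent.lift_var _

theorem hom_varUnit_zpow (n : ℤ) :
    h.hom h𝔞 (↑(SkewLaurent.varUnit (D := (𝕜[X] ⧸ 𝔞)[T;T⁻¹]) (rho q 𝔞) ^ n)) = (↑(y ^ n) : B) := by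
  have : Units.map (h.hom h𝔞 : _ →* B) (SkewLaurent.varUnit (D := (𝕜[X] ⧸ 𝔞)[T;T⁻¹]) (rho q 𝔞)) = y :=
    Units.ext (h.hom_var h𝔞)
  have h2 := congrArg (fun u : Bˣ => (↑(u ^ n) : B)) this
  rw [← h2, ← map_zpow]; rfl

theorem hom_surjective (hr : Function.Surjective r.lift) : Function.Surjective (h.hom h𝔞) := by
  intro b
  obtain ⟨a, rfl⟩ := hr b
  have hs : ∀ s : 𝕜, h.hom h𝔞 (SkewLaurent.const _ (LaurentPolynomial.C
      (Ideal.Quotient.mk 𝔞 (Polynomial.C s)))) = algebraMap 𝕜 B s := fun s => by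
    rw [hom_C, constHom_mk, Polynomial.aeval_C]
  let S : Subalgebra 𝕜 B := { (h.hom h𝔞).range with algebraMap_mem' := fun s => ⟨_, hs s⟩ }
  have hK : ∀ n : ℤ, (↑(r.K ^ n) : B) ∈ S := fun n => ⟨_, h.hom_T h𝔞 n⟩
  have hy : ∀ n : ℤ, (↑(y ^ n) : B) ∈ S := fun n => ⟨_, h.hom_varUnit_zpow h𝔞 n⟩
  have hz : z ∈ S := ⟨_, (h.hom_C h𝔞 (Ideal.Quotient.mk 𝔞 Polynomial.X)).trans
    (by rw [constHom_mk, Polynomial.aeval_X])⟩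
  have := eq_top_of_elt_mem (S.comap r.lift) (by
      obtain ⟨s, a, b, e⟩ := h.E_eq
      rw [Subalgebra.mem_comap, Rep.lift_E, e]
      exact S.smul_mem (S.mul_mem (S.mul_mem hz (hK a)) (hy b)) s)
    (by rw [Subalgebra.mem_comap, Rep.lift_Y, ← h.y_eq]; simpa using hy 1)
    (by rw [Subalgebra.mem_comap, Rep.lift_K]; simpa using hK 1)
    (by rw [Subalgebra.mem_comap, Rep.lift_Kinv]; simpa using hK (-1)) a
  exact this

end TorusRep

end Torus


/-! ### Independence of weight vectors of different weights -/

section Separate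

variable {𝕜 : Type*} [Field 𝕜] {q : 𝕜ˣ}

/-- A weight vector is not a sum of vectors of other weights. -/
theorem eq_zero_of_eq_sum (hq : ∀ n : ℕ, 0 < n → q ^ n ≠ 1) {B : Type*} [Ring B] [Algebra 𝕜 B]
    {u : B} {n : ℤ} {v : B} (hv : QComm q n v u)
    (hs : v ∈ Submodule.span 𝕜 {b : B | ∃ m, m ≠ n ∧ QComm q m b u}) (hu : IsUnit u) : v = 0 := by
  classical
  obtain ⟨u, rfl⟩ := hu
  rw [Submodule.mem_span_set'] at hs
  obtain ⟨k, c, g, hs⟩ := hs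
  choose w hw hg using fun i => (g i).2
  -- The extra index `none` carries `-v`, so that the total is zero; it is the only index of weight
  -- `-n`.
  have h := QComm.sum_filter_eq_zero hq u (Finset.univ : Finset (Option (Fin k)))
    (fun i => i.elim (-v) fun i => c i • (g i : B)) (fun i => i.elim (-n) fun i => -w i)
    (fun i _ => by
      cases i with
      | none => simpa using (hv.symm.smul_right (-1))
      | some i => exact (hg i).symm.smul_right _)
    (by rw [Fintype.sum_option]; simp [hs]) (-n)
  rw [Finset.sum_filter, Fintype.sum_option] at h
  simpa [hw] using h

end Separate

section

variable {𝕜 : Type u} [Field 𝕜] {q : 𝕜ˣ}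

/-! ### The torus representations with `X = 0` or `φ = 0` -/

section TorusZC

variable {B : Type*} [Ring B] [Algebra 𝕜 B] {r : Rep q B} {y : Bˣ}

theorem phi_eq_of_X (hX : r.X = 0) : r.phi = cst q • (r.Y * r.E) := by
  rw [r.phi_eq, hX, zero_add]

/-- The rearrangement `y⁻¹ z Kᵃ y⁻¹ = qⁿ z Kᵃ y⁻²`. -/
theorem inv_mul_rearrange {z k : B} (hz : Commute z y) {n : ℤ} (hk : QComm q n (y : B) k) :
    (↑y⁻¹ : B) * (z * k * (↑y⁻¹ : B)) =
      ((q ^ (-n) : 𝕜ˣ) : 𝕜) • (z * k * (↑(y ^ (-2 : ℤ)) : B)) := by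
  have h1 : (↑y⁻¹ : B) * z = z * (↑y⁻¹ : B) := (hz.symm.units_inv_left).eq
  have h2 : (↑(y ^ (-2 : ℤ)) : B) = (↑y⁻¹ : B) * (↑y⁻¹ : B) := by
    rw [← Units.val_mul, ← zpow_neg_one, ← zpow_add]; rfl
  rw [h2, ← mul_assoc, ← mul_assoc, h1, mul_assoc z, hk.inv_left.eq, mul_smul_comm, smul_mul_assoc]
  simp only [mul_assoc]

/-- The weights of `φ`, `Y` and `K⁻¹` cancel against each of `E`, `Y`, `K`, so `Z` is central. From
`φ = Z K Y⁻¹` and `φ = (q⁻¹ - q) Y E` one gets `E` as a multiple of `Z K Y⁻²`. -/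
theorem torusRep_Z (hq : ∀ n : ℕ, 0 < n → q ^ n ≠ 1) (hX : r.X = 0) (hy : (y : B) = r.Y) :
    TorusRep r r.Z y := by
  have hEY := Rep.EY_of_X_eq_zero hX
  have hE : Commute r.Z r.E := QComm.commute (q := q)
    (((r.phi_E.mul_left hEY.symm).mul_left r.EK.symm.inv_left).congr (by norm_num))
  have hY : Commute r.Z r.Y := QComm.commute (q := q)
    (((r.phi_Y.mul_left (QComm.of_commute (Commute.refl r.Y))).mul_left
      r.YK.symm.inv_left).congr (by norm_num))
  have hK : Commute r.Z r.K := QComm.commute (q := q)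
    (((r.phi_K.mul_left r.YK).mul_left
      (QComm.of_commute (Commute.refl (r.K : B))).inv_left).congr (by norm_num))
  refine ⟨hy, Rep.commute_lift hE hY hK, ?_⟩
  have h1 : r.E = (cst q)⁻¹ • ((↑y⁻¹ : B) * r.phi) := by
    rw [phi_eq_of_X hX, ← hy, mul_smul_comm, Units.inv_mul_cancel_left,
      inv_smul_smul₀ (cst_ne_zero hq)]
  have h2 : r.phi = r.Z * (r.K : B) * (↑y⁻¹ : B) := by
    rw [Rep.Z, Units.inv_mul_cancel_right, ← hy, Units.mul_inv_cancel_right]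
  have h3 := inv_mul_rearrange (z := r.Z) (y := y) (hy ▸ hY) (hy ▸ r.YK)
  refine ⟨(cst q)⁻¹ * ((q ^ (-1 : ℤ) : 𝕜ˣ) : 𝕜), 1, -2, ?_⟩
  rw [h1, h2, h3, smul_smul, zpow_one]

/-- As for `Z`, now with `X = C K⁻¹ Y⁻¹` and `(q⁻¹ - q) Y E = -X`, so that `E` is a multiple of `C
K⁻¹ Y⁻²`. -/
theorem torusRep_C (hq : ∀ n : ℕ, 0 < n → q ^ n ≠ 1) (hphi : r.phi = 0) (hy : (y : B) = r.Y) :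
    TorusRep r r.C y := by
  have hEY := Rep.EY_of_phi_eq_zero hphi
  have hE : Commute r.C r.E := QComm.commute (q := q)
    (((r.XE.mul_left hEY.symm).mul_left r.EK.symm).congr (by norm_num))
  have hY : Commute r.C r.Y := QComm.commute (q := q)
    (((r.XY.mul_left (QComm.of_commute (Commute.refl r.Y))).mul_left
      r.YK.symm).congr (by norm_num))
  have hK : Commute r.C r.K := QComm.commute (q := q)
    (((r.XK.mul_left r.YK).mul_left
      (QComm.of_commute (Commute.refl (r.K : B)))).congr (by norm_num))
  refine ⟨hy, Rep.commute_lift hE hY hK, ?_⟩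
  have h1 : r.E = (cst q)⁻¹ • -((↑y⁻¹ : B) * r.X) := by
    have h := r.cst_smul_YE
    rw [hphi, zero_sub, ← hy] at h
    rw [← mul_neg, ← h, mul_smul_comm, Units.inv_mul_cancel_left, inv_smul_smul₀ (cst_ne_zero hq)]
  have h2 : r.X = r.C * (↑r.K⁻¹ : B) * (↑y⁻¹ : B) := by
    rw [Rep.C, Units.mul_inv_cancel_right, ← hy, Units.mul_inv_cancel_right]
  have h3 := inv_mul_rearrange (z := r.C) (y := y) (hy ▸ hY) (hy ▸ r.YK).inv_right
  refine ⟨(cst q)⁻¹ * -((q ^ (- -1 : ℤ) : 𝕜ˣ) : 𝕜), -1, -2, ?_⟩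
  rw [h1, h2, h3, ← neg_smul, smul_smul, zpow_neg_one]

theorem isUnit_smul_of_unit (c : 𝕜ˣ) {b : B} (hb : IsUnit b) : IsUnit ((c : 𝕜) • b) := by
  rw [Algebra.smul_def]
  exact (c.isUnit.map (algebraMap 𝕜 B)).mul hb

theorem isUnit_of_left_right_inv {a b c : B} (hb : a * b = 1) (hc : c * a = 1) : IsUnit a :=
  isUnit_iff_exists_and_exists.2 ⟨⟨b, hb⟩, ⟨c, hc⟩⟩

/-- `φY` is a unit, and so is its scalar multiple `Yφ`; hence `Y` has inverses on both sides. -/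
theorem isUnit_Y_of_Z (h : IsUnit r.Z) : IsUnit r.Y := by
  have h1 : IsUnit (r.phi * r.Y) := by
    have := h.mul r.K.isUnit
    rwa [Rep.Z, Units.inv_mul_cancel_right] at this
  have h2 : IsUnit (r.Y * r.phi) := by
    rw [r.phi_Y.symm.eq]
    exact isUnit_smul_of_unit _ h1
  obtain ⟨a, ha⟩ := h1.exists_left_inv
  obtain ⟨b, hb⟩ := h2.exists_right_inv
  exact isUnit_of_left_right_inv (a := r.Y) (b := r.phi * b) (c := a * r.phi)
    (by rw [← mul_assoc, hb]) (by rw [mul_assoc, ha])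

theorem isUnit_Y_of_C (h : IsUnit r.C) : IsUnit r.Y := by
  have h1 : IsUnit (r.X * r.Y) := by
    have := h.mul r.K⁻¹.isUnit
    rwa [Rep.C, Units.mul_inv_cancel_right] at this
  have h2 : IsUnit (r.Y * r.X) := by
    rw [r.XY.symm.eq]
    exact isUnit_smul_of_unit _ h1
  obtain ⟨a, ha⟩ := h1.exists_left_inv
  obtain ⟨b, hb⟩ := h2.exists_right_inv
  exact isUnit_of_left_right_inv (a := r.Y) (b := r.X * b) (c := a * r.X)
    (by rw [← mul_assoc, hb]) (by rw [mul_assoc, ha])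

end TorusZC

/-! ### Maximal ideals of the polynomial ring -/

/-- Otherwise all constant terms vanish and the maximal ideal lies in `(X)`. Such an `f` is what
makes `Z` or `C` invertible in the factor ring. -/
theorem exists_eval_ne_zero {𝔞 : Ideal 𝕜[X]} (h : 𝔞.IsMaximal)
    (hX : 𝔞 ≠ Ideal.span {Polynomial.X}) : ∃ f ∈ 𝔞, f.eval 0 ≠ 0 := by
  by_contra! H
  have hle : 𝔞 ≤ Ideal.span {Polynomial.X} := fun f hf => by
    rw [Ideal.mem_span_singleton, Polynomial.X_dvd_iff, Polynomial.coeff_zero_eq_eval_zero]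
    exact H f hf
  refine hX (h.eq_of_le ?_ hle)
  rw [Ne, Ideal.span_singleton_eq_top]
  exact Polynomial.not_isUnit_X

/-- Splitting off the constant term, `f(z) = 0` says that `z` times a polynomial in `z` is the
nonzero scalar `-f(0)`. -/
theorem isUnit_of_aeval_eq_zero {B : Type*} [Ring B] [Algebra 𝕜 B] {z : B} {f : 𝕜[X]}
    (hf : Polynomial.aeval z f = 0) (h0 : f.eval 0 ≠ 0) : IsUnit z := by
  have h1 : f = Polynomial.X * f.divX + Polynomial.C (f.eval 0) := by
    rw [← Polynomial.coeff_zero_eq_eval_zero]; exact (Polynomial.X_mul_divX_add f).symm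
  have h2 : z * Polynomial.aeval z f.divX = -algebraMap 𝕜 B (f.eval 0) := by
    rw [h1, map_add, map_mul, Polynomial.aeval_X, Polynomial.aeval_C] at hf
    exact eq_neg_of_add_eq_zero_left hf
  have h3 : IsUnit (z * Polynomial.aeval z f.divX) := by
    rw [h2]
    exact ((Ne.isUnit h0).map (algebraMap 𝕜 B)).neg
  have hc : Commute z (Polynomial.aeval z f.divX) := by
    have := Commute.all (Polynomial.X : 𝕜[X]) f.divX
    simpa using this.map (Polynomial.aeval (R := 𝕜) z)
  exact (hc.isUnit_mul_iff.1 h3).1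

theorem proj_aeval (I : TwoSidedIdeal (Alg q)) (z : Alg q) (f : 𝕜[X]) :
    proj I (Polynomial.aeval z f) = Polynomial.aeval (proj I z) f :=
  (Polynomial.aeval_algHom_apply (RingCon.mkₐ 𝕜 I.ringCon) z f).symm

/-! ### Ideals with a torus as factor ring -/

/-- The hypotheses on the ideals `(X, 𝔮)` and `(φ, 𝔯)` that are used below. -/
structure TorusIdeal (I : TwoSidedIdeal (Alg q)) (z : Alg q) (𝔞 : Ideal 𝕜[X])
    (y : (Factor I)ˣ) : Prop where
  ne_top : I ≠ ⊤
  isMaximal : 𝔞.IsMaximal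
  aeval_mem : ∀ f ∈ 𝔞, Polynomial.aeval z f ∈ I
  torus : TorusRep (quotRep I) (proj I z) y

namespace TorusIdeal

variable {I : TwoSidedIdeal (Alg q)} {z : Alg q} {𝔞 : Ideal 𝕜[X]} {y : (Factor I)ˣ}
  (h : TorusIdeal I z 𝔞 y)

include h in
theorem aeval_eq_zero : ∀ f ∈ 𝔞, Polynomial.aeval (proj I z) f = 0 := fun f hf => by
  rw [← proj_aeval, proj_eq_zero_iff]; exact h.aeval_mem f hf

/-- The homomorphism from the skew Laurent polynomial ring to the factor ring. -/
def hom : SkewLaurent (D := (𝕜[X] ⧸ 𝔞)[T;T⁻¹]) (rho q 𝔞) →+* Factor I :=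
  h.torus.hom h.aeval_eq_zero

theorem hom_surjective : Function.Surjective h.hom :=
  h.torus.hom_surjective _ (quotRep_lift_surjective I)

/-- The constants `𝕜[X]/𝔞` form a field, so they embed in any nonzero target. With the identity as
`g` this makes the factor ring a skew Laurent ring; with the projection to a smaller factor ring it
shows maximality. -/
theorem comp_hom_injective (hq : ∀ n : ℕ, 0 < n → q ^ n ≠ 1) {B : Type*} [Ring B] [Algebra 𝕜 B]
    [Nontrivial B] (g : Factor I →ₐ[𝕜] B) : Function.Injective (g.toRingHom.comp h.hom) := by
  have := h.isMaximal
  let _ := Ideal.Quotient.field 𝔞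
  refine skewLaurent_injective hq _ (fun c => ?_) fun l hl => ?_
  · change g (h.hom _) = _
    rw [hom, TorusRep.hom_C, TorusRep.constHom_mk, Polynomial.aeval_C, AlgHom.commutes]
  · change g (h.hom _) = _ at hl
    rw [hom, TorusRep.hom_C] at hl
    exact (map_eq_zero (g.toRingHom.comp (TorusRep.constHom (proj I z) h.aeval_eq_zero))).1 hl

theorem hom_bijective (hq : ∀ n : ℕ, 0 < n → q ^ n ≠ 1) : Function.Bijective h.hom :=
  have := nontrivial_factor h.ne_top
  ⟨h.comp_hom_injective hq (AlgHom.id 𝕜 _), h.hom_surjective⟩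

include h in
-- An element of a larger proper ideal `J` comes from a skew Laurent polynomial that dies in the
-- factor ring by `J`, where the map is still injective.
theorem isCoatom (hq : ∀ n : ℕ, 0 < n → q ^ n ≠ 1) : IsCoatom I := by
  refine isCoatom_of_forall h.ne_top fun J hJ hne a ha => ?_
  have := nontrivial_factor hne
  let g : Factor I →ₐ[𝕜] Factor J := RingCon.factorₐ 𝕜 (TwoSidedIdeal.ringCon_le_iff.1 hJ)
  have hg : ∀ a, g (proj I a) = proj J a := fun a => rfl
  obtain ⟨s, hs⟩ := h.hom_surjective (proj I a)
  have h1 : g.toRingHom.comp h.hom s = 0 := by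
    change g (h.hom s) = 0
    rw [hs, hg, proj_eq_zero_iff]
    exact ha
  rw [← proj_eq_zero_iff, ← hs, (injective_iff_map_eq_zero _).1 (h.comp_hom_injective hq g) s h1,
    map_zero]

/-- The factor ring is a skew Laurent polynomial ring. -/
def equiv (hq : ∀ n : ℕ, 0 < n → q ^ n ≠ 1) :
    SkewLaurent (D := (𝕜[X] ⧸ 𝔞)[T;T⁻¹]) (rho q 𝔞) ≃+* Factor I :=
  RingEquiv.ofBijective h.hom (h.hom_bijective hq)

theorem equiv_C (hq : ∀ n : ℕ, 0 < n → q ^ n ≠ 1) (f : 𝕜[X]) :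
    h.equiv hq (SkewLaurent.const _ (LaurentPolynomial.C (Ideal.Quotient.mk 𝔞 f))) =
      proj I (Polynomial.aeval z f) := by
  change h.hom _ = _
  rw [hom, TorusRep.hom_C, TorusRep.constHom_mk, proj_aeval]

theorem equiv_T (hq : ∀ n : ℕ, 0 < n → q ^ n ≠ 1) :
    h.equiv hq (SkewLaurent.const _ (LaurentPolynomial.T 1)) = proj I (elt q .K) := by
  change h.hom _ = _
  rw [hom, TorusRep.hom_T, zpow_one]; rfl

theorem equiv_var (hq : ∀ n : ℕ, 0 < n → q ^ n ≠ 1) :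
    h.equiv hq (SkewLaurent.var _) = proj I (elt q .Y) := by
  change h.hom _ = _
  rw [hom, TorusRep.hom_var, h.torus.y_eq]; rfl

end TorusIdeal

/-! ### A representation on the line -/

section Line

variable (q) {L : Type*} [CommRing L] [Algebra 𝕜 L]

/-- The image of `qⁿ`. -/
def qpow (L : Type*) [CommRing L] [Algebra 𝕜 L] (n : ℤ) : Lˣ :=
  Units.map (algebraMap 𝕜 L : 𝕜 →* L) (q ^ n)

theorem qpow_mul (n m : ℤ) : (qpow q L n : L) * qpow q L m = qpow q L (n + m) := by
  unfold qpow
  rw [← Units.val_mul, ← map_mul, zpow_add]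

theorem algebraMap_zpow (n : ℤ) : algebraMap 𝕜 L ((q ^ n : 𝕜ˣ) : 𝕜) = qpow q L n := rfl

theorem qpow_zero : (qpow q L 0 : L) = 1 := by simp [qpow]

/-- The representation on `L^{(ℤ)}` with `C = u` and `Z = v`. -/
def lineRep (hq : cst q ≠ 0) (u v : L) (huv : u * v = 0) : Rep q (Module.End L (ℤ →₀ L)) :=
  -- Here `K eᵢ = qⁱ eᵢ` and `Y eᵢ = eᵢ₋₁`. The exponents `-i - 1` and `i + 1` are those for which
  -- `C` and `Z` act as exactly `u` and `v`.
  Rep.ofXPhi hq (monop (fun i => i + 1) fun i => u * qpow q L (-i - 1))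
    (monop (fun i => i + 1) fun i => v * qpow q L (i + 1))
    (monopUnit (Equiv.addRight (-1)) fun _ => qpow q L 0) (monopUnit (Equiv.refl _) (qpow q L))
    (monop_qComm _ rfl fun i => by
      simp only [algebraMap_zpow, Equiv.refl_apply]
      rw [mul_left_comm, qpow_mul, mul_assoc u, mul_left_comm, qpow_mul, qpow_mul]
      congr 3; ring)
    (monop_qComm _ rfl fun i => by
      simp only [algebraMap_zpow, Equiv.refl_apply]
      rw [mul_left_comm, qpow_mul, mul_assoc v, mul_left_comm, qpow_mul, qpow_mul]
      congr 3; ring)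
    (monop_qComm _ rfl fun i => by
      simp only [algebraMap_zpow, Equiv.coe_addRight]
      rw [qpow_mul, qpow_mul, qpow_mul]
      congr 2; ring)
    (monop_qComm _ (by ext i; simp) fun i => by
      simp only [algebraMap_zpow, Equiv.coe_addRight]
      rw [mul_left_comm, qpow_mul, mul_assoc u, mul_left_comm, qpow_mul, qpow_mul]
      congr 3; ring)
    (monop_qComm _ (by ext i; simp) fun i => by
      simp only [algebraMap_zpow, Equiv.coe_addRight]
      rw [mul_left_comm, qpow_mul, mul_assoc v, mul_left_comm, qpow_mul, qpow_mul]
      congr 3; ring)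
    -- `X` and `φ` commute because both products are multiples of `u v = 0`.
    (monop_qComm _ rfl fun i => by
      rw [mul_mul_mul_comm, huv, mul_mul_mul_comm, mul_comm v u, huv, zero_mul, zero_mul, mul_zero])

variable {q} (hq : cst q ≠ 0) {u v : L} (huv : u * v = 0)

theorem lineRep_phi : (lineRep q hq u v huv).phi =
    monop (fun i => i + 1) fun i => v * qpow q L (i + 1) := Rep.ofXPhi_phi ..

theorem monop_const (σ : ℤ → ℤ) (hσ : ∀ i, σ i = i) (c : ℤ → L) (a : L) (hc : ∀ i, c i = a) :
    monop σ c = algebraMap L (Module.End L (ℤ →₀ L)) a := by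
  ext i : 2
  simp [hσ, hc]

theorem lineRep_Z : (lineRep q hq u v huv).Z = algebraMap L _ v := by
  rw [Rep.Z, lineRep_phi]
  change monop _ _ * monop (Equiv.addRight (-1 : ℤ)) (fun _ => (qpow q L 0 : L)) *
    monop (Equiv.refl ℤ).symm (fun i => (((qpow q L ((Equiv.refl ℤ).symm i))⁻¹ : Lˣ) : L)) = _
  rw [monop_mul, monop_mul]
  refine monop_const _ (by simp) _ _ fun i => ?_
  simp only [Equiv.refl_symm, Equiv.refl_apply, Equiv.coe_addRight]
  rw [mul_left_comm (qpow q L 0 : L), qpow_mul, mul_left_comm, show (0 : ℤ) + (i + -1 + 1) = i by ring,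
    Units.inv_mul, mul_one]

theorem lineRep_C : (lineRep q hq u v huv).C = algebraMap L _ u := by
  rw [Rep.C]
  change monop _ _ * monop (Equiv.addRight (-1 : ℤ)) (fun _ => (qpow q L 0 : L)) *
    monop (Equiv.refl ℤ) (fun i => (qpow q L i : L)) = _
  rw [monop_mul, monop_mul]
  refine monop_const _ (by simp) _ _ fun i => ?_
  simp only [Equiv.refl_apply, Equiv.coe_addRight]
  rw [mul_left_comm (qpow q L 0 : L), qpow_mul, mul_left_comm, qpow_mul,
    show i + (0 + (-(i + -1) - 1)) = 0 by ring, qpow_zero, mul_one]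

theorem lineRep_phi_eq_zero (hv : v = 0) : (lineRep q hq u v huv).phi = 0 := by
  rw [lineRep_phi]
  ext i : 2
  simp [hv]

theorem lineRep_X_eq_zero (hu : u = 0) : (lineRep q hq u v huv).X = 0 := by
  change monop _ _ = 0
  ext i : 2
  simp [hu]

end Line

theorem ne_top_of_le_ker {B : Type*} [Ring B] [Nontrivial B] {R : Type*} [Ring R] (f : R →+* B)
    {s : Set R} (h : ∀ a ∈ s, f a = 0) : TwoSidedIdeal.span s ≠ ⊤ := by
  have : TwoSidedIdeal.span s ≤ TwoSidedIdeal.ker f :=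
    TwoSidedIdeal.span_le.2 fun a ha => (TwoSidedIdeal.mem_ker _).2 (h a ha)
  rw [Ne, ← TwoSidedIdeal.one_mem_iff]
  intro h1
  have := (TwoSidedIdeal.mem_ker _).1 (this h1)
  rw [map_one] at this
  exact one_ne_zero this

theorem aeval_algebraMap_mk {𝔞 : Ideal 𝕜[X]} {f : 𝕜[X]} (hf : f ∈ 𝔞) {M : Type*} [AddCommGroup M]
    [Module (𝕜[X] ⧸ 𝔞) M] [Module 𝕜 M] [IsScalarTower 𝕜 (𝕜[X] ⧸ 𝔞) M] :
    Polynomial.aeval (algebraMap (𝕜[X] ⧸ 𝔞) (Module.End (𝕜[X] ⧸ 𝔞) M)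
      (Ideal.Quotient.mk 𝔞 Polynomial.X)) f = 0 := by
  rw [Polynomial.aeval_algebraMap_apply]
  have : Polynomial.aeval (Ideal.Quotient.mk 𝔞 Polynomial.X) f = Ideal.Quotient.mk 𝔞 f := by
    have := Polynomial.aeval_algHom_apply (Ideal.Quotient.mkₐ 𝕜 𝔞) Polynomial.X f
    simpa using this
  rw [this, Ideal.Quotient.eq_zero_iff_mem.2 hf, map_zero]

/-- The line representation with `C = 0` and `Z` the class of the variable in `𝕜[X]/𝔮` is nonzero
and kills all generators of the ideal. -/
theorem idealQ_ne_top (hq : ∀ n : ℕ, 0 < n → q ^ n ≠ 1) {𝔮 : Ideal 𝕜[X]} (h : 𝔮.IsMaximal) :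
    idealQ q 𝔮 ≠ ⊤ := by
  have : Nontrivial (𝕜[X] ⧸ 𝔮) := Ideal.Quotient.nontrivial_iff.2 h.ne_top
  let r := lineRep q (cst_ne_zero hq) (0 : 𝕜[X] ⧸ 𝔮) (Ideal.Quotient.mk 𝔮 Polynomial.X) (zero_mul _)
  refine ne_top_of_le_ker r.lift.toRingHom ?_
  rintro _ (rfl | ⟨f, hf, rfl⟩)
  · change r.lift _ = 0
    rw [Rep.lift_X]
    exact lineRep_X_eq_zero _ _ rfl
  · change r.lift _ = 0
    rw [← Polynomial.aeval_algHom_apply, Rep.lift_Z, lineRep_Z]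
    exact aeval_algebraMap_mk hf

theorem idealR_ne_top (hq : ∀ n : ℕ, 0 < n → q ^ n ≠ 1) {𝔯 : Ideal 𝕜[X]} (h : 𝔯.IsMaximal) :
    idealR q 𝔯 ≠ ⊤ := by
  have : Nontrivial (𝕜[X] ⧸ 𝔯) := Ideal.Quotient.nontrivial_iff.2 h.ne_top
  let r := lineRep q (cst_ne_zero hq) (Ideal.Quotient.mk 𝔯 Polynomial.X) (0 : 𝕜[X] ⧸ 𝔯) (mul_zero _)
  refine ne_top_of_le_ker r.lift.toRingHom ?_
  rintro _ (rfl | ⟨f, hf, rfl⟩)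
  · change r.lift _ = 0
    rw [Rep.lift_phi]
    exact lineRep_phi_eq_zero _ _ rfl
  · change r.lift _ = 0
    rw [← Polynomial.aeval_algHom_apply, Rep.lift_C, lineRep_C]
    exact aeval_algebraMap_mk hf

theorem quotRep_phi (I : TwoSidedIdeal (Alg q)) : (quotRep I).phi = proj I (elemPhi q) := by
  rw [← Rep.lift_phi, quotRep_lift]

theorem quotRep_Z (I : TwoSidedIdeal (Alg q)) : (quotRep I).Z = proj I (elemZ q) := by
  rw [← Rep.lift_Z, quotRep_lift]

theorem quotRep_C (I : TwoSidedIdeal (Alg q)) : (quotRep I).C = proj I (elemC q) := by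
  rw [← Rep.lift_C, quotRep_lift]

theorem X_mem_idealQ (𝔮 : Ideal 𝕜[X]) : elt q .X ∈ idealQ q 𝔮 :=
  TwoSidedIdeal.subset_span (Or.inl rfl)

theorem aeval_mem_idealQ {𝔮 : Ideal 𝕜[X]} {f : 𝕜[X]} (hf : f ∈ 𝔮) :
    Polynomial.aeval (elemZ q) f ∈ idealQ q 𝔮 := TwoSidedIdeal.subset_span (Or.inr ⟨f, hf, rfl⟩)

theorem phi_mem_idealR (𝔯 : Ideal 𝕜[X]) : elemPhi q ∈ idealR q 𝔯 :=
  TwoSidedIdeal.subset_span (Or.inl rfl)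

theorem aeval_mem_idealR {𝔯 : Ideal 𝕜[X]} {f : 𝕜[X]} (hf : f ∈ 𝔯) :
    Polynomial.aeval (elemC q) f ∈ idealR q 𝔯 := TwoSidedIdeal.subset_span (Or.inr ⟨f, hf, rfl⟩)

/-- A polynomial in `𝔮` with nonzero constant term makes `Z` invertible, and with it `Y`; this is
where `𝔮 ≠ (Z)` enters. -/
theorem torusIdeal_idealQ (hq : ∀ n : ℕ, 0 < n → q ^ n ≠ 1) {𝔮 : Ideal 𝕜[X]} (h : 𝔮.IsMaximal)
    (hX : 𝔮 ≠ Ideal.span {Polynomial.X}) :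
    ∃ y, TorusIdeal (idealQ q 𝔮) (elemZ q) 𝔮 y := by
  obtain ⟨f, hf, hf0⟩ := exists_eval_ne_zero h hX
  have hZ : IsUnit (quotRep (idealQ q 𝔮)).Z := by
    refine isUnit_of_aeval_eq_zero (f := f) ?_ hf0
    rw [quotRep_Z, ← proj_aeval, proj_eq_zero_iff]
    exact aeval_mem_idealQ hf
  obtain ⟨y, hy⟩ := isUnit_Y_of_Z hZ
  refine ⟨y, idealQ_ne_top hq h, h, fun f hf => aeval_mem_idealQ hf, ?_⟩
  rw [← quotRep_Z]
  exact torusRep_Z hq ((proj_eq_zero_iff _).2 (X_mem_idealQ 𝔮)) hy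

theorem torusIdeal_idealR (hq : ∀ n : ℕ, 0 < n → q ^ n ≠ 1) {𝔯 : Ideal 𝕜[X]} (h : 𝔯.IsMaximal)
    (hX : 𝔯 ≠ Ideal.span {Polynomial.X}) :
    ∃ y, TorusIdeal (idealR q 𝔯) (elemC q) 𝔯 y := by
  obtain ⟨f, hf, hf0⟩ := exists_eval_ne_zero h hX
  have hC : IsUnit (quotRep (idealR q 𝔯)).C := by
    refine isUnit_of_aeval_eq_zero (f := f) ?_ hf0
    rw [quotRep_C, ← proj_aeval, proj_eq_zero_iff]
    exact aeval_mem_idealR hf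
  obtain ⟨y, hy⟩ := isUnit_Y_of_C hC
  refine ⟨y, idealR_ne_top hq h, h, fun f hf => aeval_mem_idealR hf, ?_⟩
  rw [← quotRep_C]
  exact torusRep_C hq ((quotRep_phi _).trans ((proj_eq_zero_iff _).2 (phi_mem_idealR 𝔯))) hy

end


/-! ### The classification of the maximal ideals of the algebra -/

theorem SkewLaurent.coeffHom_const_mul {D : Type*} [CommRing D] (ρ : RingAut D) (n : ℤ) (d : D)
    (s : SkewLaurent ρ) : coeffHom ρ n (const ρ d * s) = d * coeffHom ρ n s := by
  obtain ⟨c, rfl⟩ := exists_sum ρ s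
  simp only [Finsupp.sum, Finset.mul_sum, ← mul_assoc, ← map_mul, map_sum,
    coeffHom_const_mul_zpow, mul_ite, mul_zero]

theorem SkewLaurent.coeffHom_one {D : Type*} [CommRing D] (ρ : RingAut D) :
    coeffHom ρ 0 1 = 1 := by
  have := coeffHom_const_mul_zpow ρ 0 0 1
  simpa using this

section

variable {𝕜 : Type u} [Field 𝕜] {q : 𝕜ˣ}

/-- The kernel of an evaluation homomorphism whose values are zero or invertible. -/
theorem exists_maximal_of_aeval {B : Type*} [Ring B] [Algebra 𝕜 B] [Nontrivial B] {z : B}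
    (hz : IsUnit z) (h : ∀ f : 𝕜[X], Polynomial.aeval z f = 0 ∨ IsUnit (Polynomial.aeval z f))
    (hg : ∃ g : 𝕜[X], g ≠ 0 ∧ Polynomial.aeval z g = 0) :
    ∃ 𝔮 : Ideal 𝕜[X], 𝔮.IsMaximal ∧ 𝔮 ≠ Ideal.span {Polynomial.X} ∧
      ∀ f ∈ 𝔮, Polynomial.aeval z f = 0 := by
  let e : 𝕜[X] →+* B := (Polynomial.aeval (R := 𝕜) z).toRingHom
  -- Values that are zero or invertible leave no zero divisors, so the kernel is prime. It is
  -- nonzero by the existence of `g`, hence maximal in `𝕜[X]`, and differs from `(X)` because `z` is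
  -- invertible.
  have hp : (RingHom.ker e).IsPrime := by
    refine ⟨RingHom.ker_ne_top e, fun {f g} hfg => ?_⟩
    have h1 : Polynomial.aeval z f * Polynomial.aeval z g = 0 := by
      rw [← map_mul]; exact hfg
    rcases h f with h2 | h2
    · exact Or.inl h2
    · exact Or.inr (h2.mul_right_eq_zero.1 h1)
  obtain ⟨g, hg, hg0⟩ := hg
  refine ⟨RingHom.ker e, hp.isMaximal fun hb => hg ?_, fun hX => ?_, fun f hf => hf⟩
  · have : g ∈ RingHom.ker e := hg0
    rwa [hb, Ideal.mem_bot] at this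
  · have : (Polynomial.X : 𝕜[X]) ∈ RingHom.ker e := hX ▸ Ideal.mem_span_singleton_self _
    have h3 : Polynomial.aeval z (Polynomial.X : 𝕜[X]) = 0 := this
    rw [Polynomial.aeval_X] at h3
    exact hz.ne_zero h3

theorem TorusRep.commute_aeval {B : Type*} [Ring B] [Algebra 𝕜 B] {r : Rep q B} {z : B} {y : Bˣ}
    (h : TorusRep r z y) (f : 𝕜[X]) (a : Alg q) : Commute (Polynomial.aeval z f) (r.lift a) :=
  commute_constHom (𝔞 := ⊥) (h.comm a) (fun f hf => by
    rw [(Submodule.mem_bot _).1 hf, map_zero]) (Ideal.Quotient.mk ⊥ f)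

/-- The centre of a simple torus is algebraic over the ground field. -/
theorem TorusRep.exists_aeval_eq_zero (hq : ∀ n : ℕ, 0 < n → q ^ n ≠ 1) {B : Type*} [Ring B]
    [Algebra 𝕜 B] [Nontrivial B] {r : Rep q B} {z : B} {y : Bˣ} (h : TorusRep r z y)
    (hr : Function.Surjective r.lift)
    (hu : ∀ f : 𝕜[X], Polynomial.aeval z f = 0 ∨ IsUnit (Polynomial.aeval z f)) :
    ∃ g : 𝕜[X], g ≠ 0 ∧ Polynomial.aeval z g = 0 := by
  have h1 : (1 + Polynomial.X : 𝕜[X]) ≠ 0 := by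
    intro e
    have := congrArg (Polynomial.eval 0) e
    simp at this
  rcases hu (1 + Polynomial.X) with h0 | h0
  · exact ⟨_, h1, h0⟩
  obtain ⟨b, hb⟩ := h0.exists_right_inv
  -- With all relations of `z` divided out, the skew Laurent ring embeds, and `(1 + z) b = 1` can be
  -- compared in degree zero of `Y` and of `K`. This yields a polynomial `g` with `(1 + z) g(z) =
  -- 1`.
  let 𝔞 : Ideal 𝕜[X] := RingHom.ker (Polynomial.aeval (R := 𝕜) z).toRingHom
  have h𝔞 : ∀ f ∈ 𝔞, Polynomial.aeval z f = 0 := fun f hf => hf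
  obtain ⟨s, rfl⟩ := h.hom_surjective h𝔞 hr b
  have hinj : Function.Injective (h.hom h𝔞) := by
    refine skewLaurent_injective hq _ (fun c => ?_) fun l hl => ?_
    · rw [hom_C, constHom_mk, Polynomial.aeval_C]
    · rw [hom_C] at hl
      obtain ⟨f, rfl⟩ := Ideal.Quotient.mk_surjective l
      exact Ideal.Quotient.eq_zero_iff_mem.2 hl
  have h2 : SkewLaurent.const _ (LaurentPolynomial.C (Ideal.Quotient.mk 𝔞 (1 + Polynomial.X))) * s
      = 1 := by
    apply hinj
    rw [map_mul, hom_C, constHom_mk, hb, map_one]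
  have h3 := congrArg (SkewLaurent.coeffHom _ 0) h2
  rw [SkewLaurent.coeffHom_const_mul, SkewLaurent.coeffHom_one, ← LaurentPolynomial.smul_eq_C_mul] at h3
  have h4 := congrArg (fun p => p.coeff 0) h3
  obtain ⟨g, hg⟩ := Ideal.Quotient.mk_surjective ((SkewLaurent.coeffHom _ 0 s).coeff 0)
  have h5 : Ideal.Quotient.mk 𝔞 ((1 + Polynomial.X) * g - 1) = 0 := by
    rw [map_sub, map_mul, hg, map_one, sub_eq_zero]
    refine Eq.trans h4 ?_
    rw [AddMonoidAlgebra.one_def]; simp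
  refine ⟨(1 + Polynomial.X) * g - 1, fun e => ?_, Ideal.Quotient.eq_zero_iff_mem.1 h5⟩
  -- At `-1` the polynomial `(1 + X) g - 1` has the value `-1`, so it is a nontrivial relation.
  have := congrArg (Polynomial.eval (-1)) e
  simp at this

/-- `I` contains the maximal ideal `(X, 𝔮)` and is proper, so the two coincide. -/
theorem mem_famQ_of_aeval (hq : ∀ n : ℕ, 0 < n → q ^ n ≠ 1) {I : TwoSidedIdeal (Alg q)}
    (hI : I ≠ ⊤) (hX : elt q .X ∈ I) {𝔮 : Ideal 𝕜[X]} (h : 𝔮.IsMaximal)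
    (h' : 𝔮 ≠ Ideal.span {Polynomial.X}) (hm : ∀ f ∈ 𝔮, Polynomial.aeval (elemZ q) f ∈ I) :
    I ∈ famQ q := by
  obtain ⟨y, hy⟩ := torusIdeal_idealQ (q := q) hq h h'
  refine ⟨𝔮, h, h', (((hy.isCoatom hq).le_iff.1 ?_).resolve_left hI)⟩
  refine TwoSidedIdeal.span_le.2 ?_
  rintro _ (rfl | ⟨f, hf, rfl⟩)
  exacts [hX, hm f hf]

theorem mem_famR_of_aeval (hq : ∀ n : ℕ, 0 < n → q ^ n ≠ 1) {I : TwoSidedIdeal (Alg q)}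
    (hI : I ≠ ⊤) (hX : elemPhi q ∈ I) {𝔯 : Ideal 𝕜[X]} (h : 𝔯.IsMaximal)
    (h' : 𝔯 ≠ Ideal.span {Polynomial.X}) (hm : ∀ f ∈ 𝔯, Polynomial.aeval (elemC q) f ∈ I) :
    I ∈ famR q := by
  obtain ⟨y, hy⟩ := torusIdeal_idealR (q := q) hq h h'
  refine ⟨𝔯, h, h', (((hy.isCoatom hq).le_iff.1 ?_).resolve_left hI)⟩
  refine TwoSidedIdeal.span_le.2 ?_
  rintro _ (rfl | ⟨f, hf, rfl⟩)
  exacts [hX, hm f hf]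

/-- In a representation generated by `K` and one element of non-zero weight, that element is not
invertible. -/
theorem not_isUnit_of_weight (hq : ∀ n : ℕ, 0 < n → q ^ n ≠ 1) {B : Type*} [Ring B] [Algebra 𝕜 B]
    [Nontrivial B] {r : Rep q B} (hr : Function.Surjective r.lift) {G : B} {n : ℤ} (hn : n ≠ 0)
    (hG : QComm q n G r.K) (hE : r.E = 0 ∨ r.E = G) (hY : r.Y = 0 ∨ r.Y = G) : ¬ IsUnit G := by
  intro hu
  -- The weights `n j` with `j ≥ 0` account for the whole image. If `G b = 1`, then `1`, of weight
  -- zero, is a sum of vectors of weights `n (j + 1)`, none of which is zero.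
  let V : Submodule 𝕜 B := Submodule.span 𝕜 {b : B | ∃ j : ℕ, QComm q (n * j) b r.K}
  have hV : ∀ v ∈ V, G * v ∈ V := fun v hv => by
    refine Submodule.span_induction (p := fun v _ => G * v ∈ V) ?_ ?_ ?_ ?_ hv
    · rintro v ⟨j, hj⟩
      exact Submodule.subset_span ⟨j + 1, (hG.mul_left hj).congr (by push_cast; ring)⟩
    · rw [mul_zero]; exact V.zero_mem
    · intro a b _ _ ha hb; rw [mul_add]; exact V.add_mem ha hb
    · intro c a _ ha; rw [mul_smul_comm]; exact V.smul_mem _ ha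
  have hV0 : ∀ (b : B), b = 0 ∨ b = G → ∀ v ∈ V, b * v ∈ V := by
    rintro b (rfl | rfl) v hv
    · rw [zero_mul]; exact V.zero_mem
    · exact hV v hv
  have hK : ∀ k : B, Commute k r.K → ∀ v ∈ V, k * v ∈ V := fun k hk v hv => by
    refine Submodule.span_induction (p := fun v _ => k * v ∈ V) ?_ ?_ ?_ ?_ hv
    · rintro v ⟨j, hj⟩
      exact Submodule.subset_span ⟨j, ((QComm.of_commute hk).mul_left hj).congr (zero_add _)⟩
    · rw [mul_zero]; exact V.zero_mem
    · intro a b _ _ ha hb; rw [mul_add]; exact V.add_mem ha hb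
    · intro c a _ ha; rw [mul_smul_comm]; exact V.smul_mem _ ha
  obtain ⟨b, hb⟩ := hu.exists_right_inv
  obtain ⟨a, rfl⟩ := hr b
  have hbV : r.lift a ∈ V := lift_mem_of_stable r V
    (Submodule.subset_span ⟨0, (QComm.of_commute (Commute.one_left _)).congr (by simp)⟩)
    (hV0 _ hE) (hV0 _ hY) (hK _ (Commute.refl _)) (hK _ (Commute.refl (r.K : B)).units_inv_left) a
  refine one_ne_zero (α := B) (eq_zero_of_eq_sum hq (QComm.of_commute (Commute.one_left _)) ?_
    r.K.isUnit)
  rw [← hb]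
  refine Submodule.span_induction (p := fun v _ => G * v ∈ Submodule.span 𝕜 _) ?_ ?_ ?_ ?_ hbV
  · rintro v ⟨j, hj⟩
    refine Submodule.subset_span ⟨n + n * j, ?_, hG.mul_left hj⟩
    have : n * ((j : ℤ) + 1) ≠ 0 := mul_ne_zero hn (by positivity)
    intro e
    exact this (by linarith)
  · rw [mul_zero]; exact Submodule.zero_mem _
  · intro a b _ _ ha hb; rw [mul_add]; exact Submodule.add_mem _ ha hb
  · intro c a _ ha; rw [mul_smul_comm]; exact Submodule.smul_mem _ _ ha

theorem Rep.isUnit_phi_of_X (hq : ∀ n : ℕ, 0 < n → q ^ n ≠ 1) {B : Type*} [Ring B] [Algebra 𝕜 B]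
    {r : Rep q B} (hX : r.X = 0) (hE : IsUnit r.E) (hY : IsUnit r.Y) : IsUnit r.phi := by
  rw [phi_eq_of_X hX]
  exact isUnit_smul_of_unit (Units.mk0 _ (cst_ne_zero hq)) (hY.mul hE)

/-- The classification of the maximal ideals. -/
theorem mem_fam_of_isCoatom (hq : ∀ n : ℕ, 0 < n → q ^ n ≠ 1) {I : TwoSidedIdeal (Alg q)}
    (hI : IsCoatom I) : I ∈ famP q ∪ famQ q ∪ famR q := by
  have := nontrivial_factor hI.1
  set r := quotRep I with hr
  have hsurj := quotRep_lift_surjective I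
  have hmax : ∀ {z : Factor I} {y : (Factor I)ˣ}, IsUnit z → TorusRep r z y →
      ∃ 𝔮 : Ideal 𝕜[X], 𝔮.IsMaximal ∧ 𝔮 ≠ Ideal.span {Polynomial.X} ∧
        ∀ f ∈ 𝔮, Polynomial.aeval z f = 0 := fun {z y} hz ht => by
    have hu : ∀ f : 𝕜[X], Polynomial.aeval z f = 0 ∨ IsUnit (Polynomial.aeval z f) := fun f =>
      eq_zero_or_isUnit_of_isCoatom hI (Rep.normal_of_commute (ht.commute_aeval f))
    exact exists_maximal_of_aeval hz hu (ht.exists_aeval_eq_zero hq hsurj hu)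
  have htop : I ≠ ⊤ := hI.1
  rcases eq_zero_or_isUnit_of_isCoatom hI (Rep.normal_X (r := r)) with hX | hX
  · have hmemX : elt q .X ∈ I := (proj_eq_zero_iff I).1 hX
    rcases eq_zero_or_isUnit_of_isCoatom hI (Rep.normal_E_of_X hX) with hE | hE <;>
    rcases eq_zero_or_isUnit_of_isCoatom hI (Rep.normal_Y_of_X hX) with hY | hY
    · exact Or.inl (Or.inl (mem_famP_of_isCoatom hI ((proj_eq_zero_iff I).1 hY)
        ((proj_eq_zero_iff I).1 hE)))
    · exact absurd hY (not_isUnit_of_weight hq hsurj one_ne_zero r.YK (Or.inl hE) (Or.inr rfl))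
    · exact absurd hE (not_isUnit_of_weight hq hsurj (by norm_num) r.EK (Or.inr rfl) (Or.inl hY))
    · obtain ⟨y, hy⟩ := id hY
      have hZ : IsUnit r.Z := ((Rep.isUnit_phi_of_X hq hX hE hY).mul hY).mul r.K⁻¹.isUnit
      obtain ⟨𝔮, h1, h2, h3⟩ := hmax hZ (torusRep_Z hq hX hy)
      refine Or.inl (Or.inr (mem_famQ_of_aeval hq htop hmemX h1 h2 fun f hf => ?_))
      rw [← proj_eq_zero_iff, proj_aeval, ← quotRep_Z]
      exact h3 f hf
  rcases eq_zero_or_isUnit_of_isCoatom hI (Rep.normal_phi (r := r)) with hphi | hphi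
  · have hY : IsUnit r.Y := by
      refine (eq_zero_or_isUnit_of_isCoatom hI (Rep.normal_Y_of_phi hphi)).resolve_left fun h0 => ?_
      have h := r.cst_smul_YE
      rw [h0, zero_mul, smul_zero, hphi, zero_sub, eq_comm, neg_eq_zero] at h
      exact hX.ne_zero h
    obtain ⟨y, hy⟩ := id hY
    obtain ⟨𝔮, h1, h2, h3⟩ := hmax ((hX.mul hY).mul r.K.isUnit) (torusRep_C hq hphi hy)
    refine Or.inr (mem_famR_of_aeval hq htop ?_ h1 h2 fun f hf => ?_)
    · rw [← proj_eq_zero_iff, ← quotRep_phi]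
      exact hphi
    · rw [← proj_eq_zero_iff, proj_aeval, ← quotRep_C]
      exact h3 f hf
  -- With `X` and `φ` invertible the projection is injective, which leaves only the zero ideal.
  · exfalso
    refine not_isCoatom_bot (q := q) ?_
    have : I = ⊥ := by
      rw [eq_bot_iff]
      intro a ha
      rw [TwoSidedIdeal.mem_bot]
      refine r.lift_injective hq hX hphi ?_
      rw [(quotRep_lift_eq_zero_iff I).2 ha, map_zero]
    exact this ▸ hI

theorem isCoatom_idealQ (hq : ∀ n : ℕ, 0 < n → q ^ n ≠ 1) {𝔮 : Ideal 𝕜[X]} (h : 𝔮.IsMaximal)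
    (h' : 𝔮 ≠ Ideal.span {Polynomial.X}) : IsCoatom (idealQ q 𝔮) := by
  obtain ⟨y, hy⟩ := torusIdeal_idealQ (q := q) hq h h'
  exact hy.isCoatom hq

theorem isCoatom_idealR (hq : ∀ n : ℕ, 0 < n → q ^ n ≠ 1) {𝔯 : Ideal 𝕜[X]} (h : 𝔯.IsMaximal)
    (h' : 𝔯 ≠ Ideal.span {Polynomial.X}) : IsCoatom (idealR q 𝔯) := by
  obtain ⟨y, hy⟩ := torusIdeal_idealR (q := q) hq h h'
  exact hy.isCoatom hq

theorem maxSpec_eq (hq : ∀ n : ℕ, 0 < n → q ^ n ≠ 1) :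
    maxSpec (Alg q) = famP q ∪ famQ q ∪ famR q := by
  refine Set.Subset.antisymm (fun I hI => mem_fam_of_isCoatom hq hI) ?_
  rintro _ ((⟨𝔭, h, rfl⟩ | ⟨𝔮, h, h', rfl⟩) | ⟨𝔯, h, h', rfl⟩)
  exacts [isCoatom_idealP h, isCoatom_idealQ hq h h', isCoatom_idealR hq h h']

theorem Z_mem_of_phi {I : TwoSidedIdeal (Alg q)} (h : elemPhi q ∈ I) : elemZ q ∈ I :=
  I.mul_mem_right _ _ (I.mul_mem_right _ _ h)

theorem Z_mem_of_Y {I : TwoSidedIdeal (Alg q)} (h : elt q .Y ∈ I) : elemZ q ∈ I :=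
  I.mul_mem_right _ _ (I.mul_mem_left _ _ h)

theorem C_mem_of_Y {I : TwoSidedIdeal (Alg q)} (h : elt q .Y ∈ I) : elemC q ∈ I :=
  I.mul_mem_right _ _ (I.mul_mem_left _ _ h)

/-- Modulo `I` the element `z` would be both zero and invertible. The three families are disjoint
for this reason: an ideal in two of them would contain the `Z` or `C` that it makes invertible. -/
theorem eq_top_of_aeval_mem {I : TwoSidedIdeal (Alg q)} {z : Alg q} (hz : z ∈ I) {𝔮 : Ideal 𝕜[X]}
    (h : 𝔮.IsMaximal) (h' : 𝔮 ≠ Ideal.span {Polynomial.X})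
    (hm : ∀ f ∈ 𝔮, Polynomial.aeval z f ∈ I) : I = ⊤ := by
  obtain ⟨f, hf, hf0⟩ := exists_eval_ne_zero h h'
  by_contra hI
  have := nontrivial_factor hI
  have h1 : IsUnit (proj I z) := by
    refine isUnit_of_aeval_eq_zero (f := f) ?_ hf0
    rw [← proj_aeval, proj_eq_zero_iff]
    exact hm f hf
  exact h1.ne_zero ((proj_eq_zero_iff I).2 hz)

theorem disjoint_famP_famQ (hq : ∀ n : ℕ, 0 < n → q ^ n ≠ 1) : Disjoint (famP q) (famQ q) := by
  rw [Set.disjoint_left]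
  rintro _ ⟨𝔭, h, rfl⟩ ⟨𝔮, h1, h2, e⟩
  refine idealQ_ne_top (q := q) hq h1 (eq_top_of_aeval_mem (z := elemZ q) ?_ h1 h2
    fun f hf => aeval_mem_idealQ hf)
  rw [← e]
  exact Z_mem_of_Y (Y_mem_idealP 𝔭)

theorem disjoint_famP_famR (hq : ∀ n : ℕ, 0 < n → q ^ n ≠ 1) : Disjoint (famP q) (famR q) := by
  rw [Set.disjoint_left]
  rintro _ ⟨𝔭, h, rfl⟩ ⟨𝔮, h1, h2, e⟩
  refine idealR_ne_top (q := q) hq h1 (eq_top_of_aeval_mem (z := elemC q) ?_ h1 h2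
    fun f hf => aeval_mem_idealR hf)
  rw [← e]
  exact C_mem_of_Y (Y_mem_idealP 𝔭)

theorem disjoint_famQ_famR (hq : ∀ n : ℕ, 0 < n → q ^ n ≠ 1) : Disjoint (famQ q) (famR q) := by
  rw [Set.disjoint_left]
  rintro _ ⟨𝔮, h1, h2, rfl⟩ ⟨𝔯, h3, h4, e⟩
  refine idealQ_ne_top (q := q) hq h1 (eq_top_of_aeval_mem (z := elemZ q) ?_ h1 h2
    fun f hf => aeval_mem_idealQ hf)
  rw [e]
  exact Z_mem_of_phi (phi_mem_idealR 𝔯)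

end


/-! ### Vectors killed by a maximal ideal -/

section Killed

variable {D R M : Type*} [CommRing D] [Ring R] [AddCommGroup M] [Module R M]

/-- The vector `v` is killed by the ideal `𝔪`. -/
def Killed (f : D →+* R) (𝔪 : Ideal D) (v : M) : Prop := ∀ d ∈ 𝔪, f d • v = 0

theorem Killed.smul {f : D →+* R} {𝔪 : Ideal D} {v : M} (h : Killed f 𝔪 v) (d : D) :
    Killed f 𝔪 (f d • v) := fun d' hd' => by
  rw [← mul_smul, ← map_mul, mul_comm, map_mul, mul_smul, h d' hd', smul_zero]

theorem Killed.exists_smul_eq {f : D →+* R} {𝔪 : Ideal D} [h𝔪 : 𝔪.IsMaximal] {v : M}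
    (h : Killed f 𝔪 v) {d : D} (hd : d ∉ 𝔪) : ∃ e, f (e * d) • v = v := by
  obtain ⟨e, he⟩ := Ideal.IsMaximal.exists_inv h𝔪 hd
  obtain ⟨i, hi, h1⟩ := he
  refine ⟨e, ?_⟩
  have h2 : f (e * d + i) • v = v := by rw [h1, map_one, one_smul]
  rwa [map_add, add_smul, h i hi, add_zero] at h2

theorem Killed.eq_zero {f : D →+* R} {𝔪 : Ideal D} [𝔪.IsMaximal] {v : M} (h : Killed f 𝔪 v)
    {d : D} (hd : d ∉ 𝔪) (hv : f d • v = 0) : v = 0 := by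
  obtain ⟨e, he⟩ := h.exists_smul_eq hd
  rw [← he, map_mul, mul_smul, hv, smul_zero]

/-- A sum of vectors that are killed by other maximal ideals is killed by an element outside of a
given maximal ideal. -/
theorem exists_smul_eq_zero_of_mem_span {S : Type*} [Semiring S] [Module S M] [SMulCommClass R S M]
    {f : D →+* R} {𝔪 : Ideal D} [h𝔪 : 𝔪.IsMaximal] {v : M}
    (h : v ∈ Submodule.span S {w : M | ∃ 𝔫 : Ideal D, 𝔫.IsMaximal ∧ 𝔫 ≠ 𝔪 ∧ Killed f 𝔫 w}) :
    ∃ d ∉ 𝔪, f d • v = 0 := by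
  induction h using Submodule.span_induction with
  | mem w hw =>
    obtain ⟨𝔫, h𝔫, hne, hw⟩ := hw
    have : ¬ 𝔫 ≤ 𝔪 := fun hle => hne (h𝔫.eq_of_le h𝔪.ne_top hle)
    obtain ⟨d, hd, hd'⟩ := SetLike.not_le_iff_exists.1 this
    exact ⟨d, hd', hw d hd⟩
  | zero => exact ⟨1, (Ideal.ne_top_iff_one _).1 h𝔪.ne_top, smul_zero _⟩
  | add a b _ _ ha hb =>
    obtain ⟨d, hd, h1⟩ := ha
    obtain ⟨e, he, h2⟩ := hb
    refine ⟨d * e, fun h => (h𝔪.isPrime.mem_or_mem h).elim hd he, ?_⟩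
    rw [smul_add, map_mul, mul_smul, mul_smul, h2, smul_zero, add_zero, ← mul_smul, ← map_mul,
      mul_comm, map_mul, mul_smul, h1, smul_zero]
  | smul c a _ ha =>
    obtain ⟨d, hd, h1⟩ := ha
    exact ⟨d, hd, by rw [smul_comm, h1, smul_zero]⟩

/-- Some `d ∉ 𝔪` kills `v`, but `d` is invertible modulo `𝔪`. This is the independence of vectors
killed by distinct maximal ideals. -/
theorem Killed.eq_zero_of_mem_span {S : Type*} [Semiring S] [Module S M] [SMulCommClass R S M]
    {f : D →+* R} {𝔪 : Ideal D} [𝔪.IsMaximal] {v : M} (hv : Killed f 𝔪 v)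
    (h : v ∈ Submodule.span S {w : M | ∃ 𝔫 : Ideal D, 𝔫.IsMaximal ∧ 𝔫 ≠ 𝔪 ∧ Killed f 𝔫 w}) :
    v = 0 := by
  obtain ⟨d, hd, h⟩ := exists_smul_eq_zero_of_mem_span h
  exact hv.eq_zero hd h

/-- Torsion modules have a non-empty support. -/
theorem exists_killed [IsNoetherianRing D] [Ring.DimensionLEOne D] [Nontrivial M] (f : D →+* R)
    (h : ∀ v : M, ∃ d : D, d ≠ 0 ∧ f d • v = 0) :
    ∃ 𝔪 : Ideal D, 𝔪.IsMaximal ∧ ∃ v : M, v ≠ 0 ∧ Killed f 𝔪 v := by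
  let I : M → Ideal D := fun v =>
    { carrier := {d | f d • v = 0}
      zero_mem' := by simp
      add_mem' := fun {a b} ha hb => by
        change f (a + b) • v = 0
        rw [map_add, add_smul, show f a • v = 0 from ha, show f b • v = 0 from hb, add_zero]
      smul_mem' := fun c a ha => by
        change f (c * a) • v = 0
        rw [map_mul, mul_smul, show f a • v = 0 from ha, smul_zero] }
  have hI : ∀ v d, d ∈ I v ↔ f d • v = 0 := fun v d => Iff.rfl
  obtain ⟨v₀, hv₀⟩ := exists_ne (0 : M)
  -- A maximal one among the annihilators of nonzero vectors is prime; by torsion it is nonzero, so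
  -- it is maximal in dimension one.
  obtain ⟨_, ⟨v, hv, rfl⟩, hmax⟩ := set_has_maximal_iff_noetherian.2 (inferInstanceAs (IsNoetherianRing D))
    {J | ∃ v : M, v ≠ 0 ∧ J = I v} ⟨_, v₀, hv₀, rfl⟩
  have hp : (I v).IsPrime := by
    refine ⟨fun h => hv ?_, fun {a b} hab => or_iff_not_imp_right.2 fun hb => ?_⟩
    · have : (1 : D) ∈ I v := by rw [h]; trivial
      rwa [hI, map_one, one_smul] at this
    · by_contra ha
      refine hmax (I (f b • v)) ⟨_, hb, rfl⟩ (lt_of_le_of_ne (fun d hd => ?_) fun e => ha ?_)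
      · rw [hI, ← mul_smul, ← map_mul, mul_comm, map_mul, mul_smul, (hI v d).1 hd, smul_zero]
      · rw [e, hI, ← mul_smul, ← map_mul]
        exact hab
  obtain ⟨d, hd, hdv⟩ := h v
  exact ⟨I v, hp.isMaximal fun hb => hd (by rwa [← hI, hb, Ideal.mem_bot] at hdv), v, hv,
    fun d hd => hd⟩

end Killed

/-! ### Laurent polynomials over a field -/

section LaurentField

theorem isNoetherianRing_laurent (k : Type*) [Field k] : IsNoetherianRing k[T;T⁻¹] :=
  IsLocalization.isNoetherianRing (Submonoid.powers (Polynomial.X : k[X])) _ inferInstance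

theorem dimensionLEOne_laurent (k : Type*) [Field k] : Ring.DimensionLEOne k[T;T⁻¹] :=
  Ring.DimensionLEOne.localization (R := k[X]) _
    (powers_le_nonZeroDivisors_of_noZeroDivisors Polynomial.X_ne_zero)

theorem finite_laurent_quotient {k : Type*} [Field k] (𝔪 : Ideal k[T;T⁻¹]) [𝔪.IsMaximal] :
    Module.Finite k (k[T;T⁻¹] ⧸ 𝔪) :=
  let := Ideal.Quotient.field 𝔪
  finite_of_finite_type_of_isJacobsonRing k (k[T;T⁻¹] ⧸ 𝔪)

/-- Invertible operators `a`, `b` with `a b = c b a` force `c` to be a root of unity. -/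
theorem pow_finrank_eq_one {k V : Type*} [Field k] [AddCommGroup V] [Module k V]
    [Module.Finite k V] {a b : Module.End k V} (ha : IsUnit a) (hb : IsUnit b) {c : k}
    (h : a * b = c • (b * a)) : c ^ Module.finrank k V = 1 := by
  have h1 := congrArg LinearMap.det h
  rw [LinearMap.det_smul, map_mul, map_mul, mul_comm (LinearMap.det b)] at h1
  have h2 : LinearMap.det a * LinearMap.det b ≠ 0 :=
    ((ha.map LinearMap.det).mul (hb.map LinearMap.det)).ne_zero
  exact mul_right_cancel₀ h2 (by rw [← h1, one_mul])

/-- `σ` and multiplication by `t` are invertible operators that commute up to the factor `c`. -/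
theorem pow_finrank_eq_one_of_algHom {k A : Type*} [Field k] [CommRing A] [Algebra k A]
    [Module.Finite k A] {σ : A →ₐ[k] A} (hσ : Function.Surjective σ) (t : Aˣ) {c : k}
    (h : σ t = c • (t : A)) : c ^ Module.finrank k A = 1 := by
  have hb : IsUnit (σ.toLinearMap : Module.End k A) :=
    (Module.End.isUnit_iff _).2 ⟨LinearMap.injective_iff_surjective.2 hσ, hσ⟩
  have ha : IsUnit (LinearMap.mulLeft k (t : A)) := t.isUnit.map (Algebra.lmul k A)
  refine pow_finrank_eq_one hb ha (LinearMap.ext fun x => ?_)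
  change σ (t * x) = c • ((t : A) * σ x)
  rw [map_mul, h, smul_mul_assoc]

/-- Scaling by a scalar that is not a root of unity does not fix a maximal ideal. -/
theorem comap_scale_ne {k : Type*} [Field k] {c : kˣ} (hc : ∀ n : ℕ, 0 < n → c ^ n ≠ 1)
    (𝔪 : Ideal k[T;T⁻¹]) [𝔪.IsMaximal] : 𝔪.comap (scale c : k[T;T⁻¹] →+* k[T;T⁻¹]) ≠ 𝔪 := by
  intro h
  have := finite_laurent_quotient 𝔪
  -- If `𝔪` were fixed, scaling would induce an automorphism of the finite extension `k[T;T⁻¹]/𝔪`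
  -- with `T ↦ cT`, which forces `c` to be a root of unity.
  let σ : (k[T;T⁻¹] ⧸ 𝔪) →ₐ[k] k[T;T⁻¹] ⧸ 𝔪 :=
    Ideal.quotientMapₐ 𝔪 (scale c : k[T;T⁻¹] →ₐ[k] k[T;T⁻¹]) h.ge
  have hσ : Function.Surjective σ :=
    Ideal.quotientMap_surjective (f := (scale c : k[T;T⁻¹] →+* k[T;T⁻¹])) (H := h.ge)
      (scale c).surjective
  have h1 := pow_finrank_eq_one_of_algHom hσ ((unitT k).map (Ideal.Quotient.mk 𝔪 : _ →* _))
    (c := (c : k)) (by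
      change Ideal.Quotient.mk 𝔪 (scale c (LaurentPolynomial.T 1)) =
        (c : k) • Ideal.Quotient.mk 𝔪 (LaurentPolynomial.T 1)
      rw [scale_T, ← LaurentPolynomial.smul_eq_C_mul]
      rfl)
  exact hc _ Module.finrank_pos (Units.ext (by simpa using h1))

end LaurentField

/-! ### Weights -/

section Weights

variable {𝕜 : Type u} [Field 𝕜] {q : 𝕜ˣ}

theorem scaledT_zpow {k : Type*} [CommRing k] (c : kˣ) (m : ℤ) :
    ((scaledT c ^ m : (k[T;T⁻¹])ˣ) : k[T;T⁻¹]) =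
      LaurentPolynomial.C ((c ^ m : kˣ) : k) * LaurentPolynomial.T m := by
  have h : scaledT c = Units.map (LaurentPolynomial.C (R := k) : k →* k[T;T⁻¹]) c * unitT k :=
    Units.ext rfl
  rw [h, mul_zpow, Units.val_mul, unitT_zpow, ← map_zpow]
  rfl

theorem scale_T_zpow {k : Type*} [CommRing k] (c : kˣ) (m : ℤ) :
    scale c (LaurentPolynomial.T m) =
      LaurentPolynomial.C ((c ^ m : kˣ) : k) * LaurentPolynomial.T m :=
  (laurentHom_T _ m).trans (scaledT_zpow c m)

theorem scale_C {k : Type*} [CommRing k] (c : kˣ) (a : k) :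
    scale c (LaurentPolynomial.C a) = LaurentPolynomial.C a := (scale c).commutes a

/-- Moving `Kᵐ` past `x` costs `q^(-mn)`, which is the effect of the substitution `K ↦ q⁻ⁿK`. -/
theorem QComm.laurentHom_mul {B : Type*} [Ring B] [Algebra 𝕜 B] {n : ℤ} {x : B} {k : Bˣ}
    (h : QComm q n x (k : B)) (d : 𝕜[T;T⁻¹]) :
    laurentHom k d * x = x * laurentHom (k := 𝕜) k (scale (q ^ (-n)) d) := by
  induction d using LaurentPolynomial.induction_on' with
  | add a b ha hb => rw [map_add, add_mul, ha, hb, map_add, map_add, mul_add]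
  | C_mul_T m a =>
    have h1 : scale (q ^ (-n)) (LaurentPolynomial.T (R := 𝕜) m) =
        LaurentPolynomial.C ((q ^ (-(m * n)) : 𝕜ˣ) : 𝕜) * LaurentPolynomial.T m := by
      rw [scale_T_zpow, ← zpow_mul, neg_mul, mul_comm n]
    have h2 : ∀ a : 𝕜, laurentHom (k := 𝕜) k (LaurentPolynomial.C a) = algebraMap 𝕜 B a :=
      fun a => (laurentHom k).commutes a
    rw [map_mul, map_mul, map_mul, h1, map_mul, h2, laurentHom_T,
      scale_C, h2, h2, mul_assoc, ((h.zpow_right m).symm).eq,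
        ← Algebra.smul_def, ← Algebra.smul_def, ← Algebra.smul_def, mul_smul_comm, mul_smul_comm]

/-- The shift of an ideal of `𝕜[K^{±1}]`. -/
def shift (q : 𝕜ˣ) (n : ℤ) (𝔪 : Ideal 𝕜[T;T⁻¹]) : Ideal 𝕜[T;T⁻¹] :=
  𝔪.comap (scale (q ^ (-n)) : 𝕜[T;T⁻¹] →+* 𝕜[T;T⁻¹])

theorem shift_isMaximal (n : ℤ) (𝔪 : Ideal 𝕜[T;T⁻¹]) [𝔪.IsMaximal] : (shift q n 𝔪).IsMaximal :=
  Ideal.comap_isMaximal_of_surjective _ (scale (q ^ (-n))).surjective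

theorem shift_ne (hq : ∀ n : ℕ, 0 < n → q ^ n ≠ 1) {n : ℤ} (hn : n ≠ 0) (𝔪 : Ideal 𝕜[T;T⁻¹])
    [𝔪.IsMaximal] : shift q n 𝔪 ≠ 𝔪 := by
  refine comap_scale_ne (fun m hm h => ?_) 𝔪
  rw [← zpow_natCast, ← zpow_mul, ← zpow_zero q] at h
  have := zpow_injective hq h
  simp [hn, hm.ne'] at this

theorem shift_zero (𝔪 : Ideal 𝕜[T;T⁻¹]) : shift q 0 𝔪 = 𝔪 := by
  have : (scale (q ^ (-0 : ℤ)) : 𝕜[T;T⁻¹] →ₐ[𝕜] 𝕜[T;T⁻¹]) = AlgHom.id 𝕜 _ := by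
    apply laurentHom_ext
    change scale _ _ = _
    rw [scale_T]; simp
  ext d
  change scale _ d ∈ 𝔪 ↔ _
  rw [show scale (q ^ (-0 : ℤ)) d = d from DFunLike.congr_fun this d]

theorem shift_shift (n m : ℤ) (𝔪 : Ideal 𝕜[T;T⁻¹]) :
    shift q n (shift q m 𝔪) = shift q (n + m) 𝔪 := by
  have : (scale (q ^ (-m)) : 𝕜[T;T⁻¹] →ₐ[𝕜] 𝕜[T;T⁻¹]).comp (scale (q ^ (-n))) =
      (scale (q ^ (-(n + m))) : 𝕜[T;T⁻¹] →ₐ[𝕜] 𝕜[T;T⁻¹]) := by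
    apply laurentHom_ext
    change scale _ (scale _ _) = scale _ _
    rw [scale_T, scale_T, map_mul, scale_T, scale_C, ← mul_assoc, ← map_mul, ← Units.val_mul, ← zpow_add]
    congr 4; ring
  ext d
  change scale _ (scale _ d) ∈ 𝔪 ↔ scale _ d ∈ 𝔪
  rw [show scale (q ^ (-m)) (scale (q ^ (-n)) d) = scale (q ^ (-(n + m))) d from
    DFunLike.congr_fun this d]

variable {M : Type*} [AddCommGroup M] [Module 𝕜 M] [Module (Alg q) M] [IsScalarTower 𝕜 (Alg q) M]

theorem modRep_laurentHom (d : 𝕜[T;T⁻¹]) (v : M) :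
    laurentHom (k := 𝕜) (modRep q M).K d v = inclD q d • v := by
  have : laurentHom (k := 𝕜) (modRep q M).K = (modRep q M).lift.comp (inclD q) := by
    apply laurentHom_ext
    rw [AlgHom.comp_apply, inclD_T_one, Rep.lift_K, laurentHom_T, zpow_one]
  rw [this, AlgHom.comp_apply, modRep_lift]

/-- Operators that `q`-commute with `K` shift the weights. -/
theorem Killed.apply {𝔪 : Ideal 𝕜[T;T⁻¹]} {v : M} (h : Killed (inclD q).toRingHom 𝔪 v) {n : ℤ}
    {x : Module.End 𝕜 M} (hx : QComm q n x (modRep q M).K) :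
    Killed (inclD q).toRingHom (shift q n 𝔪) (x v) := fun d hd => by
  have h1 := LinearMap.congr_fun (hx.laurentHom_mul d) v
  rw [Module.End.mul_apply, Module.End.mul_apply, modRep_laurentHom, modRep_laurentHom] at h1
  exact h1.trans (by rw [show inclD q (scale (q ^ (-n)) d) • v = 0 from h _ hd, map_zero])

end Weights


/-! ### The annihilators of the simple torsion modules -/

section

variable {𝕜 : Type u} [Field 𝕜] {q : 𝕜ˣ}
variable {M : Type*} [AddCommGroup M] [Module 𝕜 M] [Module (Alg q) M] [IsScalarTower 𝕜 (Alg q) M]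

theorem mem_of_generators_stable (V : Submodule 𝕜 M) (hE : ∀ v ∈ V, (modRep q M).E v ∈ V)
    (hY : ∀ v ∈ V, (modRep q M).Y v ∈ V) (hK : ∀ v ∈ V, ((modRep q M).K : Module.End 𝕜 M) v ∈ V)
    (hK' : ∀ v ∈ V, (↑(modRep q M).K⁻¹ : Module.End 𝕜 M) v ∈ V) [IsSimpleModule (Alg q) M]
    {v : M} (hv : v ∈ V) (hv0 : v ≠ 0) (w : M) : w ∈ V := by
  obtain ⟨a, rfl⟩ := IsSimpleModule.toSpanSingleton_surjective (Alg q) hv0 w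
  have := apply_mem_of_stable (modRep q M).lift V (by simpa using hE) (by simpa using hY)
    (by simpa using hK) (by simpa using hK') a hv
  rwa [modRep_lift] at this

/-- A simple torsion module is not generated over `K` by one invertible operator of non-zero
weight. -/
theorem not_isUnit_of_weight_module (hq : ∀ n : ℕ, 0 < n → q ^ n ≠ 1) [IsSimpleModule (Alg q) M]
    {𝔪 : Ideal 𝕜[T;T⁻¹]} [𝔪.IsMaximal] {v : M} (hv0 : v ≠ 0)
    (hv : Killed (inclD q).toRingHom 𝔪 v) {G : Module.End 𝕜 M} {n : ℤ} (hn : n ≠ 0)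
    (hG : QComm q n G (modRep q M).K) (hE : (modRep q M).E = 0 ∨ (modRep q M).E = G)
    (hY : (modRep q M).Y = 0 ∨ (modRep q M).Y = G) : ¬ IsUnit G := by
  intro hu
  let V : Submodule 𝕜 M := Submodule.span 𝕜
    {w : M | ∃ j : ℕ, Killed (inclD q).toRingHom (shift q (n * j) 𝔪) w}
  have key : ∀ (x : Module.End 𝕜 M) (S : Set M),
      (∀ w (j : ℕ), Killed (inclD q).toRingHom (shift q (n * j) 𝔪) w → x w ∈ S) →
      ∀ w ∈ V, x w ∈ Submodule.span 𝕜 S := fun x S h w hw => by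
    refine Submodule.span_le (p := (Submodule.span 𝕜 S).comap x).2 ?_ hw
    rintro w ⟨j, hj⟩
    exact Submodule.subset_span (h w j hj)
  have hGV : ∀ w ∈ V, G w ∈ V := key G _ fun w j hj => ⟨j + 1, by
    have := hj.apply hG
    rw [shift_shift] at this
    convert this using 2
    push_cast; ring⟩
  have hGV' : ∀ b : Module.End 𝕜 M, b = 0 ∨ b = G → ∀ w ∈ V, b w ∈ V := by
    rintro b (rfl | rfl) w hw
    · exact V.zero_mem
    · exact hGV w hw
  have hKV : ∀ k : Module.End 𝕜 M, Commute k (modRep q M).K → ∀ w ∈ V, k w ∈ V := fun k hk =>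
    key k _ fun w j hj => ⟨j, by
      have := hj.apply (QComm.of_commute hk)
      rwa [shift_shift, zero_add] at this⟩
  have hV : ∀ w, w ∈ V := mem_of_generators_stable V (hGV' _ hE) (hGV' _ hY)
    (hKV _ (Commute.refl _)) (hKV _ (Commute.refl ((modRep q M).K : Module.End 𝕜 M)).units_inv_left)
    (Submodule.subset_span ⟨0, by simpa [shift_zero] using hv⟩) hv0
  -- The module is spanned by vectors in the shifts of `𝔪` by `n j`, `j ≥ 0`. Writing `v = G u` puts
  -- `v` into the shifts by `n (j + 1)`, all different from `𝔪`, so `v = 0`.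
  obtain ⟨u, rfl⟩ := ((Module.End.isUnit_iff G).1 hu).2 v
  refine hv0 (hv.eq_zero_of_mem_span (S := 𝕜) (key G _ (fun w j hj => ?_) u (hV u)))
  refine ⟨shift q (n + n * j) 𝔪, shift_isMaximal _ _, shift_ne hq ?_ 𝔪, ?_⟩
  · have : n * ((j : ℤ) + 1) ≠ 0 := mul_ne_zero hn (by positivity)
    intro e
    exact this (by linarith)
  · have := hj.apply hG
    rwa [shift_shift] at this

/-- The subspace `{v | 𝔪 v = 0}` generates finite modules over polynomial rings. -/
theorem exists_finite_generators {𝔪 : Ideal 𝕜[T;T⁻¹]} [𝔪.IsMaximal] {v : M}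
    (hv : Killed (inclD q).toRingHom 𝔪 v) :
    ∃ (n : ℕ) (t : Fin n → 𝕜[T;T⁻¹]), ∀ d, ∃ c : Fin n → 𝕜,
      inclD q d • v = ∑ i, c i • inclD q (t i) • v := by
  have := finite_laurent_quotient 𝔪
  obtain ⟨n, s, hs⟩ := Module.Finite.exists_fin (R := 𝕜) (M := 𝕜[T;T⁻¹] ⧸ 𝔪)
  choose t ht using fun i => Ideal.Quotient.mk_surjective (s i)
  refine ⟨n, t, fun d => ?_⟩
  have hd : Ideal.Quotient.mk 𝔪 d ∈ Submodule.span 𝕜 (Set.range s) := by rw [hs]; trivial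
  obtain ⟨c, hc⟩ := (Submodule.mem_span_range_iff_exists_fun 𝕜).1 hd
  refine ⟨c, ?_⟩
  have h1 : d - ∑ i, c i • t i ∈ 𝔪 := by
    rw [← Ideal.Quotient.eq_zero_iff_mem, map_sub, ← hc, map_sum, sub_eq_zero]
    refine Finset.sum_congr rfl fun i _ => ?_
    rw [← ht i]
    rfl
  have h2 : inclD q (d - ∑ i, c i • t i) • v = 0 := hv _ h1
  rw [map_sub, sub_smul, sub_eq_zero] at h2
  rw [h2, map_sum, Finset.sum_smul]
  refine Finset.sum_congr rfl fun i _ => ?_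
  rw [map_smul, smul_assoc]

theorem TorusRep.commute_aeval_y {B : Type*} [Ring B] [Algebra 𝕜 B] {r : Rep q B} {z : B} {y : Bˣ}
    (h : TorusRep r z y) (f : 𝕜[X]) : Commute (Polynomial.aeval z f) y := by
  have := h.commute_aeval f (elt q .Y)
  rwa [Rep.lift_Y, ← h.y_eq] at this

/-- The central element is algebraic. -/
theorem TorusRep.exists_aeval_eq_zero_of_killed (hq : ∀ n : ℕ, 0 < n → q ^ n ≠ 1)
    [IsSimpleModule (Alg q) M] {𝔪 : Ideal 𝕜[T;T⁻¹]} [𝔪.IsMaximal] {v : M} (hv0 : v ≠ 0)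
    (hv : Killed (inclD q).toRingHom 𝔪 v) {z : Module.End 𝕜 M} {y : (Module.End 𝕜 M)ˣ}
    (h : TorusRep (modRep q M) z y)
    (hu : ∀ f : 𝕜[X], Polynomial.aeval z f = 0 ∨ IsUnit (Polynomial.aeval z f)) :
    ∃ g : 𝕜[X], g ≠ 0 ∧ Polynomial.aeval z g = 0 := by
  have h1 : (1 + Polynomial.X : 𝕜[X]) ≠ 0 := by
    intro e
    have := congrArg (Polynomial.eval 0) e
    simp at this
  rcases hu (1 + Polynomial.X) with h0 | h0
  · exact ⟨_, h1, h0⟩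
  let _ : Module 𝕜[X] M := Module.compHom M (Polynomial.aeval (R := 𝕜) z).toRingHom
  have hsmul : ∀ (f : 𝕜[X]) (w : M), f • w = Polynomial.aeval z f w := fun f w => rfl
  have hC : ∀ (c : 𝕜) (w : M), Polynomial.C c • w = c • w := fun c w => by
    rw [hsmul, Polynomial.aeval_C]; rfl
  have hcomm : ∀ (f : 𝕜[X]) (d : 𝕜[T;T⁻¹]) (w : M), f • inclD q d • w = inclD q d • f • w :=
    fun f d w => by
      have := LinearMap.congr_fun (h.commute_aeval f (inclD q d)).eq w
      rwa [Module.End.mul_apply, Module.End.mul_apply, modRep_lift, modRep_lift] at this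
  -- `N` is the `𝕜[z]`-span of `D v`. It is finitely generated over `𝕜[z]` because `D/𝔪` is finite
  -- over `𝕜`, and `𝔪` still kills it.
  let N : Submodule 𝕜[X] M := Submodule.span 𝕜[X] (Set.range fun d => inclD q d • v)
  have hvN : v ∈ N := Submodule.subset_span ⟨1, by simp⟩
  have hNfg : N.FG := by
    obtain ⟨n, t, ht⟩ := exists_finite_generators hv
    rw [Submodule.fg_def]
    refine ⟨Set.range fun i => inclD q (t i) • v, Set.finite_range _, le_antisymm ?_ ?_⟩
    · refine Submodule.span_mono ?_
      rintro _ ⟨i, rfl⟩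
      exact ⟨t i, rfl⟩
    · refine Submodule.span_le.2 ?_
      rintro _ ⟨d, rfl⟩
      obtain ⟨c, hc⟩ := ht d
      change inclD q d • v ∈ _
      rw [hc]
      refine Submodule.sum_mem _ fun i _ => ?_
      rw [← hC]
      exact Submodule.smul_mem _ _ (Submodule.subset_span ⟨i, rfl⟩)
  have hN𝕜 : ∀ (c : 𝕜), ∀ w ∈ N, c • w ∈ N := fun c w hw => hC c w ▸ N.smul_mem _ hw
  have hND : ∀ (d : 𝕜[T;T⁻¹]), ∀ w ∈ N, inclD q d • w ∈ N := fun d w hw => by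
    induction hw using Submodule.span_induction with
    | mem w hw =>
      obtain ⟨d', rfl⟩ := hw
      refine Submodule.subset_span ⟨d * d', ?_⟩
      change inclD q (d * d') • v = _
      rw [map_mul, mul_smul]
    | zero => rw [smul_zero]; exact N.zero_mem
    | add a b _ _ ha hb => rw [smul_add]; exact N.add_mem ha hb
    | smul c a _ ha => rw [← hcomm]; exact N.smul_mem _ ha
  have hNK : ∀ w ∈ N, Killed (inclD q).toRingHom 𝔪 w := fun w hw d hd => by
    change inclD q d • w = 0
    induction hw using Submodule.span_induction with
    | mem w hw =>
      obtain ⟨d', rfl⟩ := hw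
      exact hv.smul d' d hd
    | zero => rw [smul_zero]
    | add a b _ _ ha hb => rw [smul_add, ha, hb, add_zero]
    | smul c a _ ha => rw [← hcomm, ha, smul_zero]
  -- The translates `yᵏ N` span all of `M`: they are permuted by `y` and preserved by `K` and `z`,
  -- and `E` is a product of these.
  let V : Submodule 𝕜 M := Submodule.span 𝕜
    {w : M | ∃ k : ℤ, ∃ n ∈ N, w = (↑(y ^ k) : Module.End 𝕜 M) n}
  have hVstable : ∀ (x : Module.End 𝕜 M) (m : ℤ), QComm q m x (y : Module.End 𝕜 M) →
      (∀ w ∈ N, x w ∈ N) → ∀ w ∈ V, x w ∈ V := fun x m hx hxN w hw => by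
    refine Submodule.span_le (p := V.comap x).2 ?_ hw
    rintro _ ⟨k, n, hn, rfl⟩
    have h2 := LinearMap.congr_fun (hx.zpow_right k).eq n
    rw [LinearMap.smul_apply, Module.End.mul_apply, Module.End.mul_apply] at h2
    change x _ ∈ V
    rw [h2]
    exact V.smul_mem _ (Submodule.subset_span ⟨k, _, hxN n hn, rfl⟩)
  have hVy : ∀ (m : ℤ), ∀ w ∈ V, (↑(y ^ m) : Module.End 𝕜 M) w ∈ V := fun m w hw => by
    refine Submodule.span_le (p := V.comap (↑(y ^ m) : Module.End 𝕜 M)).2 ?_ hw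
    rintro _ ⟨k, n, hn, rfl⟩
    refine Submodule.subset_span ⟨m + k, n, hn, ?_⟩
    rw [zpow_add, Units.val_mul, Module.End.mul_apply]
  have hKN : ∀ (m : ℤ), ∀ w ∈ N, (↑((modRep q M).K ^ m) : Module.End 𝕜 M) w ∈ N :=
    fun m w hw => by
      have := modRep_laurentHom (q := q) (LaurentPolynomial.T m) w
      rw [laurentHom_T] at this
      rw [this]
      exact hND _ w hw
  have hVK : ∀ (m : ℤ), ∀ w ∈ V, (↑((modRep q M).K ^ m) : Module.End 𝕜 M) w ∈ V := fun m =>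
    hVstable _ _ (h.yK.symm.zpow_left m) (hKN m)
  have hVz : ∀ w ∈ V, z w ∈ V := hVstable z 0 (QComm.of_commute h.commute_Y) fun w hw => by
    have := N.smul_mem Polynomial.X hw
    rwa [hsmul, Polynomial.aeval_X] at this
  have hV : ∀ w, w ∈ V := by
    refine mem_of_generators_stable (q := q) V (fun w hw => ?_) (fun w hw => ?_) (fun w hw => ?_)
      (fun w hw => ?_) (Submodule.subset_span ⟨0, v, hvN, by simp⟩) hv0
    · obtain ⟨s, a, b, hE⟩ := h.E_eq
      rw [hE]
      exact V.smul_mem s (hVz _ (hVK a _ (hVy b w hw)))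
    · have := hVy 1 w hw
      rwa [zpow_one, h.y_eq] at this
    · simpa using hVK 1 w hw
    · simpa using hVK (-1) w hw
  let O : Set M := {w : M | ∃ 𝔫 : Ideal 𝕜[T;T⁻¹], 𝔫.IsMaximal ∧ 𝔫 ≠ 𝔪 ∧
    Killed (inclD q).toRingHom 𝔫 w}
  -- Up to vectors killed by other maximal ideals, `(1 + z) w` depends only on the component of `w`
  -- in `N`, since `yᵏ N` with `k ≠ 0` lives over a shift of `𝔪`.
  have hsplit : ∀ w ∈ V, ∃ n ∈ N, (1 + Polynomial.X : 𝕜[X]) • w - (1 + Polynomial.X : 𝕜[X]) • n ∈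
      Submodule.span 𝕜 O := fun w hw => by
    induction hw using Submodule.span_induction with
    | mem w hw =>
      obtain ⟨k, n, hn, rfl⟩ := hw
      by_cases hk : k = 0
      · refine ⟨n, hn, ?_⟩
        subst hk
        simp
      · refine ⟨0, N.zero_mem, ?_⟩
        rw [smul_zero, sub_zero]
        refine Submodule.subset_span ⟨shift q k 𝔪, shift_isMaximal _ _, shift_ne hq hk 𝔪, ?_⟩
        have h2 := LinearMap.congr_fun
          ((h.commute_aeval_y (1 + Polynomial.X)).units_zpow_right k).eq n
        rw [Module.End.mul_apply, Module.End.mul_apply] at h2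
        rw [hsmul, h2]
        exact (hNK _ (N.smul_mem (1 + Polynomial.X) hn)).apply
          ((h.yK.zpow_left k).congr (mul_one k))
    | zero => exact ⟨0, N.zero_mem, by simp⟩
    | add a b _ _ ha hb =>
      obtain ⟨n, hn, h2⟩ := ha
      obtain ⟨n', hn', h3⟩ := hb
      refine ⟨n + n', N.add_mem hn hn', ?_⟩
      rw [smul_add, smul_add, add_sub_add_comm]
      exact Submodule.add_mem _ h2 h3
    | smul c a _ ha =>
      obtain ⟨n, hn, h2⟩ := ha
      refine ⟨c • n, hN𝕜 c n hn, ?_⟩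
      rw [hsmul, hsmul, map_smul, map_smul, ← smul_sub]
      exact Submodule.smul_mem _ c h2
  -- `1 + z` is onto `M`, and projecting a preimage of `n` to `N` shows that it is onto `N` already.
  have hle : N ≤ Ideal.span {(1 + Polynomial.X : 𝕜[X])} • N := fun n hn => by
    obtain ⟨w, hw⟩ := ((Module.End.isUnit_iff _).1 h0).2 n
    obtain ⟨n', hn', h2⟩ := hsplit w (hV w)
    rw [hsmul, hw] at h2
    have hO : Killed (inclD q).toRingHom 𝔪 (n - (1 + Polynomial.X : 𝕜[X]) • n') := fun d hd => by
      rw [smul_sub, hNK n hn d hd, hNK _ (N.smul_mem _ hn') d hd, sub_zero]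
    rw [sub_eq_zero.1 (hO.eq_zero_of_mem_span (S := 𝕜) h2)]
    exact Submodule.smul_mem_smul (Ideal.mem_span_singleton_self _) hn'
  -- Nakayama: some `g ≡ 1` modulo `1 + X` kills `N`. It is nonzero as `g(-1) = 1`, and `g(z)` is
  -- not invertible as it kills `v`; so `g(z) = 0`.
  obtain ⟨g, hg, hgN⟩ := Submodule.exists_sub_one_mem_and_smul_eq_zero_of_fg_of_le_smul _ N hNfg hle
  refine ⟨g, fun e => ?_, (hu g).resolve_right fun hgu => hv0 ?_⟩
  · obtain ⟨f, hf⟩ := Ideal.mem_span_singleton.1 hg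
    have := congrArg (Polynomial.eval (-1)) hf
    simp [e] at this
  · exact ((Module.End.isUnit_iff _).1 hgu).1 ((hgN v hvN).trans (map_zero _).symm)

variable (q M) in
/-- The annihilator as a two-sided ideal. -/
def annIdeal : TwoSidedIdeal (Alg q) := (Module.annihilator (Alg q) M).toTwoSided

theorem mem_annIdeal {a : Alg q} : a ∈ annIdeal q M ↔ (modRep q M).lift a = 0 := by
  rw [annIdeal, Ideal.mem_toTwoSided, modRep_lift_eq_zero_iff]

theorem annIdeal_ne_top [Nontrivial M] : annIdeal q M ≠ ⊤ := by
  rw [Ne, ← TwoSidedIdeal.one_mem_iff, mem_annIdeal, map_one]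
  exact one_ne_zero

/-- The annihilators of the simple torsion modules. -/
theorem annIdeal_eq_bot_or_mem (hq : ∀ n : ℕ, 0 < n → q ^ n ≠ 1) [IsSimpleModule (Alg q) M]
    (ht : ∀ v : M, ∃ d : 𝕜[T;T⁻¹], d ≠ 0 ∧ inclD q d • v = 0) :
    annIdeal q M = ⊥ ∨ annIdeal q M ∈ famP q ∪ famQ q ∪ famR q := by
  have := IsSimpleModule.nontrivial (Alg q) M
  have := isNoetherianRing_laurent 𝕜
  have := dimensionLEOne_laurent 𝕜
  obtain ⟨𝔪, h𝔪, v, hv0, hv⟩ := exists_killed (inclD q).toRingHom ht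
  set r := modRep q M with hr
  have hmax : ∀ {z : Module.End 𝕜 M} {y : (Module.End 𝕜 M)ˣ}, IsUnit z → TorusRep r z y →
      ∃ 𝔮 : Ideal 𝕜[X], 𝔮.IsMaximal ∧ 𝔮 ≠ Ideal.span {Polynomial.X} ∧
        ∀ f ∈ 𝔮, Polynomial.aeval z f = 0 := fun {z y} hz h => by
    have hu : ∀ f : 𝕜[X], Polynomial.aeval z f = 0 ∨ IsUnit (Polynomial.aeval z f) := fun f =>
      eq_zero_or_isUnit_of_isSimpleModule (Rep.normal_of_commute (h.commute_aeval f))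
    exact exists_maximal_of_aeval hz hu (h.exists_aeval_eq_zero_of_killed hq hv0 hv hu)
  rcases eq_zero_or_isUnit_of_isSimpleModule (Rep.normal_X (r := r)) with hX | hX
  · right
    have hmemX : elt q .X ∈ annIdeal q M := by rw [mem_annIdeal, Rep.lift_X, hX]
    rcases eq_zero_or_isUnit_of_isSimpleModule (Rep.normal_E_of_X hX) with hE | hE <;>
    rcases eq_zero_or_isUnit_of_isSimpleModule (Rep.normal_Y_of_X hX) with hY | hY
    · have hmemE : elt q .E ∈ annIdeal q M := by rw [mem_annIdeal, Rep.lift_E, hE]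
      have hmemY : elt q .Y ∈ annIdeal q M := by rw [mem_annIdeal, Rep.lift_Y, hY]
      -- With `E` and `Y` acting as zero, `𝒜` acts through the commutative ring `D`, so `M = D v`
      -- and `𝔪` kills all of it.
      have hact : ∀ a : Alg q, a • v = inclD q ((counitRep q).lift a) • v := fun a => by
        have := mem_annIdeal.1 (sub_inclD_counit_mem q hmemY hmemE a)
        have := LinearMap.congr_fun this v
        rwa [modRep_lift, LinearMap.zero_apply, sub_smul, sub_eq_zero] at this
      refine Or.inl (Or.inl ⟨𝔪, h𝔪, ?_⟩)
      refine (((isCoatom_idealP (q := q) h𝔪).le_iff.1 ?_).resolve_left annIdeal_ne_top)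
      refine TwoSidedIdeal.span_le.2 ?_
      rintro _ ((rfl | rfl) | ⟨d, hd, rfl⟩)
      · exact hmemY
      · exact hmemE
      · refine mem_annIdeal.2 (LinearMap.ext fun w => ?_)
        obtain ⟨a, rfl⟩ := IsSimpleModule.toSpanSingleton_surjective (Alg q) hv0 w
        rw [modRep_lift, LinearMap.toSpanSingleton_apply, hact]
        exact hv.smul _ d hd
    · exact absurd hY (not_isUnit_of_weight_module hq hv0 hv one_ne_zero r.YK (Or.inl hE)
        (Or.inr rfl))
    · exact absurd hE (not_isUnit_of_weight_module hq hv0 hv (by norm_num) r.EK (Or.inr rfl)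
        (Or.inl hY))
    · obtain ⟨y, hy⟩ := id hY
      have hZ : IsUnit r.Z := ((Rep.isUnit_phi_of_X hq hX hE hY).mul hY).mul r.K⁻¹.isUnit
      obtain ⟨𝔮, h1, h2, h3⟩ := hmax hZ (torusRep_Z hq hX hy)
      refine Or.inl (Or.inr (mem_famQ_of_aeval hq annIdeal_ne_top hmemX h1 h2 fun f hf => ?_))
      rw [mem_annIdeal, ← Polynomial.aeval_algHom_apply, Rep.lift_Z]
      exact h3 f hf
  rcases eq_zero_or_isUnit_of_isSimpleModule (Rep.normal_phi (r := r)) with hphi | hphi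
  · right
    have hY : IsUnit r.Y := by
      refine (eq_zero_or_isUnit_of_isSimpleModule (Rep.normal_Y_of_phi hphi)).resolve_left
        fun h0 => ?_
      have h := r.cst_smul_YE
      rw [h0, zero_mul, smul_zero, hphi, zero_sub, eq_comm, neg_eq_zero] at h
      exact hX.ne_zero h
    obtain ⟨y, hy⟩ := id hY
    obtain ⟨𝔮, h1, h2, h3⟩ := hmax ((hX.mul hY).mul r.K.isUnit) (torusRep_C hq hphi hy)
    refine Or.inr (mem_famR_of_aeval hq annIdeal_ne_top ?_ h1 h2 fun f hf => ?_)
    · rw [mem_annIdeal, Rep.lift_phi, hphi]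
    · rw [mem_annIdeal, ← Polynomial.aeval_algHom_apply, Rep.lift_C]
      exact h3 f hf
  · left
    rw [eq_bot_iff]
    intro a ha
    rw [TwoSidedIdeal.mem_bot]
    refine r.lift_injective hq hX hphi ?_
    rw [mem_annIdeal.1 ha, map_zero]

end


/-! ### Simple modules over skew Laurent polynomial rings -/

section SkewModules

variable {D : Type*} [CommRing D] {ρ : RingAut D} {R : Type u} [Ring R] (Φ : SkewLaurent ρ ≃+* R)

/-- Elements are sums of terms `d Yⁿ`. -/
theorem exists_eq_sum (a : R) : ∃ c : ℤ →₀ D, a = ∑ n ∈ c.support,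
    inclOf Φ (c n) * (↑(SkewLaurent.imageVar (Φ : SkewLaurent ρ →+* R) ^ n) : R) := by
  obtain ⟨c, hc⟩ := SkewLaurent.exists_sum ρ (Φ.symm a)
  refine ⟨c, ?_⟩
  rw [← Φ.apply_symm_apply a, hc, Finsupp.sum, map_sum]
  exact Finset.sum_congr rfl fun n _ => SkewLaurent.map_term (Φ : SkewLaurent ρ →+* R) n (c n)

theorem imageVar_zpow_mul (n : ℤ) (d : D) :
    (↑(SkewLaurent.imageVar (Φ : SkewLaurent ρ →+* R) ^ n) : R) * inclOf Φ d =
      inclOf Φ ((ρ ^ n : RingAut D) d) *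
        (↑(SkewLaurent.imageVar (Φ : SkewLaurent ρ →+* R) ^ n) : R) :=
  SkewLaurent.zpow_mul_comm (f := inclOf Φ)
    (SkewLaurent.imageVar_mul_restrict (Φ : SkewLaurent ρ →+* R)) n d

/-- `ρⁿ(d) Yⁿ v = Yⁿ d v`: the variable permutes the weight spaces along the orbit. -/
theorem Killed.zpow_smul {M : Type*} [AddCommGroup M] [Module R M] {𝔪 : Ideal D} {v : M}
    (h : Killed (inclOf Φ) 𝔪 v) (n : ℤ) : Killed (inclOf Φ) (𝔪.map (ρ ^ n : RingAut D))
      ((↑(SkewLaurent.imageVar (Φ : SkewLaurent ρ →+* R) ^ n) : R) • v) := fun d hd => by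
  obtain ⟨d, hd', rfl⟩ := (Ideal.mem_map_of_equiv (ρ ^ n : RingAut D) _).1 hd
  rw [← mul_smul, ← imageVar_zpow_mul, mul_smul, h d hd', smul_zero]

theorem map_isMaximal (𝔪 : Ideal D) [𝔪.IsMaximal] (n : ℤ) :
    (𝔪.map (ρ ^ n : RingAut D)).IsMaximal := Ideal.map_isMaximal_of_equiv (ρ ^ n : RingAut D)

theorem map_map_zpow (𝔪 : Ideal D) (n m : ℤ) :
    (𝔪.map (ρ ^ n : RingAut D)).map (ρ ^ m : RingAut D) = 𝔪.map (ρ ^ (m + n) : RingAut D) := by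
  rw [zpow_add]
  exact Ideal.map_map (ρ ^ n : RingAut D).toRingHom (ρ ^ m : RingAut D).toRingHom

/-- The orbits of maximal ideals are infinite. -/
def InfiniteOrbits (ρ : RingAut D) : Prop :=
  ∀ (𝔪 : Ideal D), 𝔪.IsMaximal → ∀ n : ℤ, n ≠ 0 → 𝔪.map (ρ ^ n : RingAut D) ≠ 𝔪

theorem InfiniteOrbits.map_ne (hρ : InfiniteOrbits ρ) (𝔪 : Ideal D) [h𝔪 : 𝔪.IsMaximal] {n m : ℤ}
    (h : n ≠ m) : 𝔪.map (ρ ^ n : RingAut D) ≠ 𝔪.map (ρ ^ m : RingAut D) := fun e => by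
  have h1 := congrArg (Ideal.map (ρ ^ (-m) : RingAut D)) e
  rw [map_map_zpow, map_map_zpow, neg_add_cancel] at h1
  refine hρ 𝔪 h𝔪 (-m + n) (fun h0 => h (by linarith)) (h1.trans ?_)
  rw [zpow_zero]; exact Ideal.map_id 𝔪

/-- A submodule that meets the module generated by a vector killed by a maximal ideal contains the
vector. -/
theorem Killed.mem_of_smul_mem (hρ : InfiniteOrbits ρ) {M : Type*} [AddCommGroup M] [Module R M]
    {𝔪 : Ideal D} [h𝔪 : 𝔪.IsMaximal] {v : M} (hv : Killed (inclOf Φ) 𝔪 v) (P : Submodule R M)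
    {a : R} (ha : a • v ≠ 0) (haP : a • v ∈ P) : v ∈ P := by
  classical
  obtain ⟨c, hc⟩ := exists_eq_sum Φ a
  set y := SkewLaurent.imageVar (Φ : SkewLaurent ρ →+* R)
  have hmax : ∀ n : ℤ, (𝔪.map (ρ ^ n : RingAut D)).IsMaximal := fun n => map_isMaximal 𝔪 n
  have hw := hv.zpow_smul Φ
  have hsum : a • v = ∑ n ∈ c.support, inclOf Φ (c n) • (↑(y ^ n) : R) • v := by
    rw [hc, Finset.sum_smul]
    simp only [mul_smul]
  obtain ⟨n, hn, hn0⟩ : ∃ n ∈ c.support, inclOf Φ (c n) • (↑(y ^ n) : R) • v ≠ 0 := by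
    by_contra! H
    exact ha (hsum.trans (Finset.sum_eq_zero H))
  have hcn : c n ∉ 𝔪.map (ρ ^ n : RingAut D) := fun h => hn0 (hw n _ h)
  -- The other terms live over other points of the orbit, so some `e` outside `ρⁿ(𝔪)` kills them
  -- all. What survives is `Yⁿ v` times an element invertible modulo `ρⁿ(𝔪)`.
  obtain ⟨e, he, h0⟩ := exists_smul_eq_zero_of_mem_span (S := ℕ) (R := R) (f := inclOf Φ)
    (𝔪 := 𝔪.map (ρ ^ n : RingAut D)) (h𝔪 := hmax n)
    (v := ∑ m ∈ c.support.erase n, inclOf Φ (c m) • (↑(y ^ m) : R) • v)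
    (Submodule.sum_mem _ fun m hm => Submodule.subset_span ⟨_, hmax m,
      hρ.map_ne 𝔪 (Finset.ne_of_mem_erase hm), (hw m).smul _⟩)
  have h1 : inclOf Φ e • a • v = inclOf Φ (e * c n) • (↑(y ^ n) : R) • v := by
    rw [hsum, ← Finset.add_sum_erase _ _ hn, smul_add, h0, add_zero, map_mul, mul_smul]
  have := hmax n
  obtain ⟨d, hd⟩ := (hw n).exists_smul_eq (d := e * c n)
    fun h => ((hmax n).isPrime.mem_or_mem h).elim he hcn
  have h2 : (↑(y ^ n) : R) • v ∈ P := by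
    rw [← hd, map_mul, mul_smul, ← h1]
    exact P.smul_mem _ (P.smul_mem _ haP)
  have h3 := P.smul_mem (↑(y ^ n)⁻¹ : R) h2
  rwa [← mul_smul, Units.inv_mul, one_smul] at h3

/-- The coefficient of `Y⁰` in `(∑ cₙ Yⁿ) d` is `c₀ d`. This shows that `1` is not in `R𝔪`, so that
`R/R𝔪` is nonzero. -/
theorem coeff_mem_of_mem_span {𝔪 : Ideal D} {a : R}
    (ha : a ∈ Submodule.span R (inclOf Φ '' (𝔪 : Set D))) :
    SkewLaurent.coeffHom ρ 0 (Φ.symm a) ∈ 𝔪 := by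
  suffices ∀ b : R, SkewLaurent.coeffHom ρ 0 (Φ.symm (b * a)) ∈ 𝔪 by simpa using this 1
  induction ha using Submodule.span_induction with
  | mem w hw =>
    obtain ⟨d, hd, rfl⟩ := hw
    intro b
    obtain ⟨c, hc⟩ := SkewLaurent.exists_sum ρ (Φ.symm b)
    have h1 : Φ.symm (inclOf Φ d) = SkewLaurent.const ρ d := Φ.symm_apply_apply _
    rw [map_mul, h1, hc, Finsupp.sum, Finset.sum_mul, map_sum]
    refine Ideal.sum_mem _ fun n _ => ?_
    have h2 : (↑(SkewLaurent.varUnit ρ ^ n) : SkewLaurent ρ) * SkewLaurent.const ρ d =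
        SkewLaurent.const ρ ((ρ ^ n : RingAut D) d) * (↑(SkewLaurent.varUnit ρ ^ n)) :=
      SkewLaurent.zpow_mul_comm (SkewLaurent.var_mul_const ρ) n d
    rw [mul_assoc, h2, ← mul_assoc, ← map_mul, SkewLaurent.coeffHom_const_mul_zpow]
    split_ifs with hn
    · subst hn
      rw [zpow_zero]
      exact 𝔪.mul_mem_left _ hd
    · exact 𝔪.zero_mem
  | zero => intro b; rw [mul_zero, map_zero, map_zero]; exact 𝔪.zero_mem
  | add a b _ _ ha hb => intro c; rw [mul_add, map_add, map_add]; exact 𝔪.add_mem (ha c) (hb c)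
  | smul c a _ ha => intro b; rw [smul_eq_mul, ← mul_assoc]; exact ha _

/-- The generator of `R/R𝔪`. -/
def cyclicGen (f : D →+* R) (𝔪 : Ideal D) : cyclic f 𝔪 :=
  Submodule.Quotient.mk (p := Submodule.span R (f '' (𝔪 : Set D))) 1

theorem smul_cyclicGen (f : D →+* R) (𝔪 : Ideal D) (v : cyclic f 𝔪) :
    ∃ a : R, a • cyclicGen f 𝔪 = v := by
  obtain ⟨a, rfl⟩ := Submodule.Quotient.mk_surjective (Submodule.span R (f '' (𝔪 : Set D))) v
  refine ⟨a, ?_⟩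
  refine (Submodule.Quotient.mk_smul _ a (1 : R)).symm.trans ?_
  rw [smul_eq_mul, mul_one]

theorem killed_cyclicGen (f : D →+* R) (𝔪 : Ideal D) : Killed f 𝔪 (cyclicGen f 𝔪) := fun d hd => by
  refine (Submodule.Quotient.mk_smul _ (f d) (1 : R)).symm.trans ?_
  rw [smul_eq_mul, mul_one]
  exact (Submodule.Quotient.mk_eq_zero _).2 (Submodule.subset_span ⟨d, hd, rfl⟩)

theorem cyclicGen_ne_zero (𝔪 : Ideal D) [h𝔪 : 𝔪.IsMaximal] : cyclicGen (inclOf Φ) 𝔪 ≠ 0 := fun h => by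
  have h1 := coeff_mem_of_mem_span Φ ((Submodule.Quotient.mk_eq_zero _).1 h)
  rw [map_one, SkewLaurent.coeffHom_one] at h1
  exact h𝔪.ne_top ((Ideal.eq_top_iff_one _).2 h1)

theorem isSimpleModule_cyclic (hρ : InfiniteOrbits ρ) (𝔪 : Ideal D) [𝔪.IsMaximal] :
    IsSimpleModule R (cyclic (inclOf Φ) 𝔪) := by
  have : Nontrivial (cyclic (inclOf Φ) 𝔪) := ⟨_, _, cyclicGen_ne_zero Φ 𝔪⟩
  rw [isSimpleModule_iff_toSpanSingleton_surjective]
  refine ⟨this, fun v hv w => ?_⟩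
  obtain ⟨a, rfl⟩ := smul_cyclicGen _ _ v
  obtain ⟨b, rfl⟩ := smul_cyclicGen _ _ w
  obtain ⟨c, hc⟩ := Submodule.mem_span_singleton.1
    ((killed_cyclicGen (inclOf Φ) 𝔪).mem_of_smul_mem Φ hρ _ hv (Submodule.mem_span_singleton_self _))
  exact ⟨b * c, by rw [LinearMap.toSpanSingleton_apply, mul_smul, hc]⟩

/-- Infinite orbits exclude `𝔪 = 0`. For nonzero `d ∈ 𝔪`, a sum of terms `cₙ Yⁿ` applied to the
generator is killed by the product of the `ρⁿ(d)`, nonzero in a domain. -/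
theorem isTorsionOver_cyclic [IsDomain D] (hρ : InfiniteOrbits ρ) (𝔪 : Ideal D) [h𝔪 : 𝔪.IsMaximal] :
    IsTorsionOver (inclOf Φ) (cyclic (inclOf Φ) 𝔪) := by
  have hbot : 𝔪 ≠ ⊥ := fun h => hρ 𝔪 h𝔪 1 one_ne_zero (by rw [h]; exact Ideal.map_bot)
  obtain ⟨d, hd, hd0⟩ := Submodule.exists_mem_ne_zero_of_ne_bot hbot
  intro v
  obtain ⟨a, rfl⟩ := smul_cyclicGen _ _ v
  obtain ⟨c, hc⟩ := exists_eq_sum Φ a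
  have hk := (killed_cyclicGen (inclOf Φ) 𝔪).zpow_smul Φ
  set y := SkewLaurent.imageVar (Φ : SkewLaurent ρ →+* R)
  refine ⟨∏ n ∈ c.support, (ρ ^ n : RingAut D) d, Finset.prod_ne_zero_iff.2 fun n _ =>
    (map_ne_zero_iff (ρ ^ n : RingAut D) (ρ ^ n : RingAut D).injective).2 hd0, ?_⟩
  rw [hc, Finset.sum_smul, Finset.smul_sum]
  refine Finset.sum_eq_zero fun n hn => ?_
  rw [mul_smul]
  refine ((hk n).smul (c n)) _ ?_
  exact Ideal.mem_of_dvd _ (Finset.dvd_prod_of_mem _ hn) (Ideal.mem_map_of_mem _ hd)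

theorem mem_supp_iff {f : D →+* R} {M : ModuleCat.{u} R} {𝔪 : Ideal D} :
    𝔪 ∈ supp f M ↔ 𝔪.IsMaximal ∧ ∃ v : M, v ≠ 0 ∧ Killed f 𝔪 v := Iff.rfl

/-- `M = R v` consists of sums of vectors killed by the `ρⁿ(𝔪)`, and independence rules out any
further maximal ideal. -/
theorem supp_eq_orbit (M : ModuleCat.{u} R) [IsSimpleModule R M]
    {𝔪 : Ideal D} (h : 𝔪 ∈ supp (inclOf Φ) M) : supp (inclOf Φ) M = orbit ρ 𝔪 := by
  obtain ⟨h𝔪, v, hv0, hv⟩ := mem_supp_iff.1 h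
  ext 𝔫
  constructor
  · rintro ⟨h𝔫, w, hw0, hw⟩
    by_contra hne
    obtain ⟨a, rfl⟩ := IsSimpleModule.toSpanSingleton_surjective R hv0 w
    refine hw0 (Killed.eq_zero_of_mem_span (S := ℕ) (f := inclOf Φ) (𝔪 := 𝔫) hw ?_)
    obtain ⟨c, hc⟩ := exists_eq_sum Φ a
    rw [LinearMap.toSpanSingleton_apply, hc, Finset.sum_smul]
    refine Submodule.sum_mem _ fun n _ => Submodule.subset_span ⟨_, map_isMaximal 𝔪 n,
      fun e => hne ⟨n, e.symm⟩, ?_⟩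
    rw [mul_smul]
    exact (hv.zpow_smul Φ n).smul _
  · rintro ⟨n, rfl⟩
    refine ⟨map_isMaximal 𝔪 n, _, fun h0 => hv0 ?_, hv.zpow_smul Φ n⟩
    rw [← one_smul R v, ← Units.inv_mul (SkewLaurent.imageVar (Φ : SkewLaurent ρ →+* R) ^ n),
      mul_smul, h0, smul_zero]

/-- A vector killed by `𝔪` gives a nonzero map from the simple module `R/R𝔪` to `M`. -/
theorem isoClass_eq_cyclic (hρ : InfiniteOrbits ρ) (M : ModuleCat.{u} R) [IsSimpleModule R M]
    {𝔪 : Ideal D} (h : 𝔪 ∈ supp (inclOf Φ) M) : isoClass M = isoClass (cyclic (inclOf Φ) 𝔪) := by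
  obtain ⟨h𝔪, v, hv0, hv⟩ := mem_supp_iff.1 h
  have := isSimpleModule_cyclic Φ hρ 𝔪
  let g : cyclic (inclOf Φ) 𝔪 →ₗ[R] M :=
    Submodule.liftQ _ (LinearMap.toSpanSingleton R M v) (Submodule.span_le.2 (by
      rintro _ ⟨d, hd, rfl⟩
      exact hv d hd))
  have hg : g (cyclicGen (inclOf Φ) 𝔪) = v := by
    refine (Submodule.liftQ_apply _ _ _).trans ?_
    rw [LinearMap.toSpanSingleton_apply, one_smul]
  have hg0 : g ≠ 0 := fun h0 => hv0 (by rw [← hg, h0, LinearMap.zero_apply])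
  exact Quotient.sound ⟨(LinearEquiv.ofBijective g (LinearMap.bijective_of_ne_zero hg0)).toModuleIso.symm⟩

theorem supp_subset_of_iso {f : D →+* R} {M N : ModuleCat.{u} R} (e : M ≃ₗ[R] N) :
    supp f M ⊆ supp f N := by
  rintro 𝔪 ⟨h𝔪, v, hv0, hv⟩
  refine ⟨h𝔪, e v, fun h => hv0 (e.map_eq_zero_iff.1 h), fun d hd => ?_⟩
  rw [← map_smul, hv d hd, map_zero]

/-- The support of an isomorphism class. -/
def suppClass (f : D →+* R) : IsoClasses R → Set (Ideal D) :=
  Quotient.lift (supp f) fun _ _ ⟨i⟩ =>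
    Set.Subset.antisymm (supp_subset_of_iso i.toLinearEquiv) (supp_subset_of_iso i.symm.toLinearEquiv)

/-- The bijection is built from the support map, which is visibly well defined on isomorphism
classes; the map `𝔪 ↦ R/R𝔪` appears as its inverse, so its independence of the point in the orbit
comes for free. -/
theorem orbitClassification [IsDomain D] [IsNoetherianRing D] [Ring.DimensionLEOne D]
    (hρ : InfiniteOrbits ρ) : OrbitClassification ρ (inclOf Φ) := by
  have hne : ∀ M : ModuleCat.{u} R, IsSimpleModule R M → IsTorsionOver (inclOf Φ) M →
      ∃ 𝔪, 𝔪 ∈ supp (inclOf Φ) M := fun M hM ht => by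
    have := IsSimpleModule.nontrivial R M
    obtain ⟨𝔪, h⟩ := exists_killed (inclOf Φ) ht
    exact ⟨𝔪, h⟩
  have hc : ∀ 𝔪 : Ideal D, 𝔪.IsMaximal → 𝔪 ∈ supp (inclOf Φ) (cyclic (inclOf Φ) 𝔪) := fun 𝔪 h𝔪 =>
    ⟨h𝔪, _, cyclicGen_ne_zero Φ 𝔪, killed_cyclicGen _ 𝔪⟩
  have hcs : ∀ 𝔪 : Ideal D, 𝔪.IsMaximal →
      isoClass (cyclic (inclOf Φ) 𝔪) ∈ simpleTorsion (inclOf Φ) := fun 𝔪 h𝔪 =>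
    ⟨_, isSimpleModule_cyclic Φ hρ 𝔪, isTorsionOver_cyclic Φ hρ 𝔪, rfl⟩
  let g : simpleTorsion (inclOf Φ) → maxOrbits ρ := fun c => ⟨suppClass (inclOf Φ) c.1, by
    obtain ⟨M, hM, ht, hMc⟩ := c.2
    obtain ⟨𝔪, h⟩ := hne M hM ht
    exact ⟨𝔪, h.1, by rw [hMc]; exact supp_eq_orbit Φ M h⟩⟩
  have hg : Function.Bijective g := by
    constructor
    · rintro ⟨_, M, hM, ht, rfl⟩ ⟨_, M', hM', ht', rfl⟩ h
      have h1 : supp (inclOf Φ) M = supp (inclOf Φ) M' := congrArg Subtype.val h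
      obtain ⟨𝔪, h2⟩ := hne M hM ht
      exact Subtype.ext ((isoClass_eq_cyclic Φ hρ M h2).trans
        (isoClass_eq_cyclic Φ hρ M' (h1 ▸ h2)).symm)
    · rintro ⟨_, 𝔪, h𝔪, rfl⟩
      have := isSimpleModule_cyclic Φ hρ 𝔪
      exact ⟨⟨_, hcs 𝔪 h𝔪⟩, Subtype.ext (supp_eq_orbit Φ _ (hc 𝔪 h𝔪))⟩
  refine ⟨(Equiv.ofBijective g hg).symm, fun 𝔪 h𝔪 => ?_, fun M hM => rfl⟩
  have := isSimpleModule_cyclic Φ hρ 𝔪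
  have h1 : (Equiv.ofBijective g hg).symm ⟨orbit ρ 𝔪, 𝔪, h𝔪, rfl⟩ = ⟨_, hcs 𝔪 h𝔪⟩ := by
    rw [Equiv.symm_apply_eq]
    exact Subtype.ext (supp_eq_orbit Φ _ (hc 𝔪 h𝔪)).symm
  rw [h1]

end SkewModules


/-! ### The coefficient ring `L[K^{±1}]` -/

section CoefficientRing

theorem isNoetherianRing_laurent_of_isField {k : Type*} [CommRing k] (hk : IsField k) :
    IsNoetherianRing k[T;T⁻¹] :=
  let := hk.toField
  isNoetherianRing_laurent k

theorem dimensionLEOne_laurent_of_isField {k : Type*} [CommRing k] (hk : IsField k) :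
    Ring.DimensionLEOne k[T;T⁻¹] :=
  let := hk.toField
  dimensionLEOne_laurent k

theorem comap_scale_ne_of_isField {k : Type*} [CommRing k] (hk : IsField k) {c : kˣ}
    (hc : ∀ n : ℕ, 0 < n → c ^ n ≠ 1) (𝔪 : Ideal k[T;T⁻¹]) [𝔪.IsMaximal] :
    𝔪.comap (scale c : k[T;T⁻¹] →+* k[T;T⁻¹]) ≠ 𝔪 :=
  let := hk.toField
  comap_scale_ne hc 𝔪

variable {k : Type*} [CommRing k]

theorem scale_mul_apply (c d : kˣ) (x : k[T;T⁻¹]) : scale (c * d) x = scale c (scale d x) := by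
  have : (scale (c * d) : k[T;T⁻¹] →ₐ[k] k[T;T⁻¹]) =
      (scale c : k[T;T⁻¹] →ₐ[k] k[T;T⁻¹]).comp (scale d) := by
    apply laurentHom_ext
    change scale _ _ = scale _ (scale _ _)
    rw [scale_T, scale_T, map_mul, scale_T, scale_C, ← mul_assoc, ← map_mul, ← Units.val_mul,
      mul_comm d]
  exact DFunLike.congr_fun this x

variable (k) in
/-- The action of the units by scaling. -/
def scaleHom : kˣ →* RingAut k[T;T⁻¹] :=
  MonoidHom.mk' (fun c => (scale c).toRingEquiv) fun c d => RingEquiv.ext (scale_mul_apply c d)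

theorem infiniteOrbits_scale (hk : IsField k) {c : kˣ} (hc : ∀ n : ℤ, n ≠ 0 → c ^ n ≠ 1) :
    InfiniteOrbits ((scale c).toRingEquiv : RingAut k[T;T⁻¹]) := by
  intro 𝔪 h𝔪 n hn h
  have h1 : ((scale c).toRingEquiv : RingAut k[T;T⁻¹]) ^ n = (scale (c ^ n)).toRingEquiv :=
    (map_zpow (scaleHom k) c n).symm
  rw [h1] at h
  refine comap_scale_ne_of_isField hk (c := c ^ n) (fun m hm e => ?_) 𝔪 ?_
  · rw [← zpow_natCast, ← zpow_mul] at e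
    exact hc _ (mul_ne_zero hn (by exact_mod_cast hm.ne')) e
  · conv_lhs => rw [← h]
    exact Ideal.comap_map_of_bijective (scale (c ^ n)).toRingEquiv (scale (c ^ n)).bijective

variable {𝕜 : Type u} [Field 𝕜] {q : 𝕜ˣ}

theorem infiniteOrbits_rho (hq : ∀ n : ℕ, 0 < n → q ^ n ≠ 1) (𝔞 : Ideal 𝕜[X]) [h𝔞 : 𝔞.IsMaximal] :
    InfiniteOrbits (D := (𝕜[X] ⧸ 𝔞)[T;T⁻¹]) (rho q 𝔞) := by
  refine infiniteOrbits_scale ((Ideal.Quotient.maximal_ideal_iff_isField_quotient 𝔞).1 h𝔞)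
    fun n hn h => hn ?_
  have h1 := congrArg Units.val h
  rw [← map_zpow] at h1
  have h2 : algebraMap 𝕜 (𝕜[X] ⧸ 𝔞) ((q ^ n : 𝕜ˣ) : 𝕜) = algebraMap 𝕜 _ 1 :=
    h1.trans (map_one _).symm
  have : Nontrivial (𝕜[X] ⧸ 𝔞) := Ideal.Quotient.nontrivial_iff.2 h𝔞.ne_top
  refine zpow_injective hq (a₁ := n) (a₂ := 0) (Units.ext ?_)
  rw [(algebraMap 𝕜 (𝕜[X] ⧸ 𝔞)).injective h2]
  simp

theorem orbitClassification_rho (hq : ∀ n : ℕ, 0 < n → q ^ n ≠ 1) {R : Type u} [Ring R]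
    (𝔞 : Ideal 𝕜[X]) [h𝔞 : 𝔞.IsMaximal]
    (Φ : SkewLaurent (D := (𝕜[X] ⧸ 𝔞)[T;T⁻¹]) (rho q 𝔞) ≃+* R) :
    OrbitClassification (rho q 𝔞) (inclOf Φ) := by
  have hk := (Ideal.Quotient.maximal_ideal_iff_isField_quotient 𝔞).1 h𝔞
  have : IsDomain (𝕜[X] ⧸ 𝔞) := hk.isDomain
  have := isNoetherianRing_laurent_of_isField hk
  have := dimensionLEOne_laurent_of_isField hk
  exact orbitClassification Φ (infiniteOrbits_rho hq 𝔞)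

variable (k) in
/-- The inclusion of `𝕜[T;T⁻¹]` into `k[T;T⁻¹]`. -/
def laurentInclusion [Algebra 𝕜 k] : 𝕜[T;T⁻¹] →+* k[T;T⁻¹] :=
  (laurentHom (k := 𝕜) (unitT k)).toRingHom

theorem laurentInclusion_T [Algebra 𝕜 k] (n : ℤ) :
    laurentInclusion k (LaurentPolynomial.T n : 𝕜[T;T⁻¹]) = LaurentPolynomial.T n := by
  refine (laurentHom_T _ n).trans ?_
  rw [unitT_zpow]

theorem laurentInclusion_C [Algebra 𝕜 k] (a : 𝕜) :
    laurentInclusion k (LaurentPolynomial.C a : 𝕜[T;T⁻¹]) =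
      LaurentPolynomial.C (algebraMap 𝕜 k a) :=
  (laurentHom (k := 𝕜) (unitT k)).commutes a

theorem laurentInclusion_coeff [Algebra 𝕜 k] (d : 𝕜[T;T⁻¹]) (n : ℤ) :
    (laurentInclusion k d).coeff n = algebraMap 𝕜 k (d.coeff n) := by
  induction d using LaurentPolynomial.induction_on' with
  | add a b ha hb =>
    rw [map_add, AddMonoidAlgebra.coeff_add, Finsupp.add_apply, ha, hb,
      AddMonoidAlgebra.coeff_add, Finsupp.add_apply, map_add]
  | C_mul_T m a =>
    rw [map_mul, laurentInclusion_C, laurentInclusion_T, ← LaurentPolynomial.single_eq_C_mul_T,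
      ← LaurentPolynomial.single_eq_C_mul_T, AddMonoidAlgebra.coeff_single,
      AddMonoidAlgebra.coeff_single, Finsupp.single_apply, Finsupp.single_apply]
    split_ifs
    · rfl
    · exact (map_zero _).symm

theorem laurentInclusion_injective [Algebra 𝕜 k] [Nontrivial k] :
    Function.Injective (laurentInclusion (𝕜 := 𝕜) k) := by
  rw [injective_iff_map_eq_zero]
  intro d hd
  ext n
  have h := laurentInclusion_coeff (k := k) d n
  rw [hd] at h
  exact (algebraMap 𝕜 k).injective (h.symm.trans (by simp))

theorem laurentInclusion_isIntegral [Algebra 𝕜 k] [Algebra.IsIntegral 𝕜 k] :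
    (laurentInclusion (𝕜 := 𝕜) k).IsIntegral := by
  intro d
  induction d using LaurentPolynomial.induction_on' with
  | add a b ha hb => exact ha.add _ hb
  | C_mul_T m a =>
    refine RingHom.IsIntegralElem.mul _ ?_ ?_
    · obtain ⟨p, hp, hpa⟩ := Algebra.IsIntegral.isIntegral (R := 𝕜) a
      refine ⟨p.map LaurentPolynomial.C, hp.map _, ?_⟩
      rw [Polynomial.eval₂_map]
      have : (laurentInclusion (𝕜 := 𝕜) k).comp LaurentPolynomial.C =
          (LaurentPolynomial.C (R := k)).comp (algebraMap 𝕜 k) :=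
        RingHom.ext fun a => laurentInclusion_C a
      rw [this, ← Polynomial.hom_eval₂, hpa, map_zero]
    · rw [← laurentInclusion_T (𝕜 := 𝕜)]
      exact RingHom.isIntegralElem_map _

/-- In an integral extension of domains every nonzero ideal meets the base ring nontrivially. This
turns torsion over `L[K^{±1}]` into torsion over `𝕜[K^{±1}]`. -/
theorem exists_laurentInclusion_mem [Algebra 𝕜 k] [Algebra.IsIntegral 𝕜 k] [IsDomain k]
    {d : k[T;T⁻¹]} (hd : d ≠ 0) : ∃ d₀ : 𝕜[T;T⁻¹], d₀ ≠ 0 ∧ d ∣ laurentInclusion k d₀ := by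
  let := (laurentInclusion (𝕜 := 𝕜) k).toAlgebra
  have h := Ideal.comap_ne_bot_of_integral_mem (R := 𝕜[T;T⁻¹]) hd (Ideal.mem_span_singleton_self d)
    (laurentInclusion_isIntegral d)
  obtain ⟨d₀, h1, h2⟩ := Submodule.exists_mem_ne_zero_of_ne_bot h
  exact ⟨d₀, h2, Ideal.mem_span_singleton.1 h1⟩

theorem isIntegral_quotient (𝔞 : Ideal 𝕜[X]) [𝔞.IsMaximal] : Algebra.IsIntegral 𝕜 (𝕜[X] ⧸ 𝔞) :=
  let := Ideal.Quotient.field 𝔞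
  have : Module.Finite 𝕜 (𝕜[X] ⧸ 𝔞) := finite_of_finite_type_of_isJacobsonRing 𝕜 (𝕜[X] ⧸ 𝔞)
  inferInstance

end CoefficientRing


/-! ### Inflation -/

section Inflation

/-- Simplicity of modules over a ring and a factor ring. -/
theorem isSimpleModule_iff_of_surjective {R S M N : Type*} [Ring R] [Ring S] [AddCommGroup M]
    [AddCommGroup N] [Module R M] [Module S N] {f : R →+* S} (hf : Function.Surjective f)
    (e : M ≃+ N) (he : ∀ (r : R) (m : M), e (r • m) = f r • e m) :
    IsSimpleModule R M ↔ IsSimpleModule S N := by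
  have : RingHomSurjective f := ⟨hf⟩
  let l : M →ₛₗ[f] N := { e.toAddMonoidHom with map_smul' := he }
  exact l.isSimpleModule_iff_of_bijective e.bijective

variable {R : Type u} [Ring R] (I : TwoSidedIdeal R)

theorem isSimpleModule_restrictScalars (M : ModuleCat.{u} (Factor I)) :
    IsSimpleModule R ((ModuleCat.restrictScalars.{u} (proj I)).obj M) ↔
      IsSimpleModule (Factor I) M :=
  isSimpleModule_iff_of_surjective (proj_surjective I) (AddEquiv.refl M) fun _ _ => rfl

theorem inflate_injective : Function.Injective (inflate (proj I)) := by
  intro a b h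
  obtain ⟨M, rfl⟩ := Quotient.exists_rep a
  obtain ⟨N, rfl⟩ := Quotient.exists_rep b
  obtain ⟨i⟩ := Quotient.exact h
  let e := i.toLinearEquiv
  let e' : M ≃ₗ[Factor I] N :=
    { toFun := e
      map_add' := e.map_add
      map_smul' := fun s m => by
        obtain ⟨r, rfl⟩ := proj_surjective I s
        exact e.map_smul r m
      invFun := e.symm
      left_inv := e.left_inv
      right_inv := e.right_inv }
  exact Quotient.sound ⟨e'.toModuleIso⟩

theorem exists_restrictScalars_iso {M : ModuleCat.{u} R} (h : I ≤ ann M) :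
    ∃ N : ModuleCat.{u} (Factor I),
      Nonempty ((ModuleCat.restrictScalars.{u} (proj I)).obj N ≅ M) := by
  let g : Factor I →+* AddMonoid.End M := I.ringCon.lift (Module.toAddMonoidEnd R M) fun a b hab => by
    have h1 : a - b ∈ ann M := h ((TwoSidedIdeal.rel_iff I a b).1 hab)
    have h2 := Module.mem_annihilator.1 ((Ideal.mem_toTwoSided).1 h1)
    refine AddMonoidHom.ext fun v => ?_
    have := h2 v
    rw [sub_smul, sub_eq_zero] at this
    exact this
  let _ : Module (Factor I) M := Module.compHom M g
  refine ⟨ModuleCat.of (Factor I) M, ⟨LinearEquiv.toModuleIso ?_⟩⟩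
  exact { AddEquiv.refl M with map_smul' := fun _ _ => rfl }

theorem le_ann_restrictScalars (M : ModuleCat.{u} (Factor I)) :
    I ≤ ann ((ModuleCat.restrictScalars.{u} (proj I)).obj M) := fun a ha => by
  refine Ideal.mem_toTwoSided.2 (Module.mem_annihilator.2 fun v => ?_)
  change proj I a • (v : M) = 0
  rw [(proj_eq_zero_iff I).2 ha]
  exact zero_smul (Factor I) (v : M)

theorem ann_ne_top (M : ModuleCat.{u} R) [Nontrivial M] : ann M ≠ ⊤ := by
  rw [Ne, ← TwoSidedIdeal.one_mem_iff]
  intro h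
  have h1 := Module.mem_annihilator.1 (Ideal.mem_toTwoSided.1 h)
  obtain ⟨v, hv⟩ := exists_ne (0 : M)
  exact hv (by rw [← one_smul R v]; exact h1 v)

theorem ann_eq_of_iso {M N : ModuleCat.{u} R} (e : M ≃ₗ[R] N) : ann M = ann N := by
  unfold ann
  congr 1
  exact e.annihilator_eq

theorem ann_eq_of_isoClass {M N : ModuleCat.{u} R} (h : isoClass M = isoClass N) :
    ann M = ann N := by
  obtain ⟨i⟩ := Quotient.exact h
  exact ann_eq_of_iso i.toLinearEquiv

end Inflation

/-! ### Torsion modules over a torus factor ring as modules over the algebra -/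

section TorusInflation

variable {𝕜 : Type u} [Field 𝕜] {q : 𝕜ˣ}

namespace TorusIdeal

variable {I : TwoSidedIdeal (Alg q)} {z : Alg q} {𝔞 : Ideal 𝕜[X]} {y : (Factor I)ˣ}
  (h : TorusIdeal I z 𝔞 y) (hq : ∀ n : ℕ, 0 < n → q ^ n ≠ 1)

theorem inclOf_laurentInclusion (d : 𝕜[T;T⁻¹]) :
    inclOf (h.equiv hq) (laurentInclusion (𝕜[X] ⧸ 𝔞) d) = proj I (inclD q d) := by
  have hC : ∀ a : 𝕜, proj I (inclD q (LaurentPolynomial.C a)) =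
      proj I (Polynomial.aeval z (Polynomial.C a)) := fun a => by
    rw [Polynomial.aeval_C]
    exact congrArg _ ((inclD q).commutes a)
  have hT : ∀ n : ℤ, proj I (inclD q (LaurentPolynomial.T n)) =
      (↑((quotRep I).K ^ n) : Factor I) := fun n => by
    have : Units.map (proj I : Alg q →* Factor I) (unitK q) = (quotRep I).K := rfl
    rw [inclD, laurentHom_T, ← this, ← map_zpow]
    rfl
  induction d using LaurentPolynomial.induction_on' with
  | add a b ha hb => rw [map_add, map_add, ha, hb, map_add, map_add]
  | C_mul_T n a =>
    rw [map_mul, map_mul, map_mul, map_mul, hC, hT, laurentInclusion_C, laurentInclusion_T,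
      ← h.equiv_C hq, ← h.torus.hom_T h.aeval_eq_zero]
    rfl

theorem isTorsionOver_iff (M : ModuleCat.{u} (Factor I)) :
    IsTorsionOver (inclD q).toRingHom ((ModuleCat.restrictScalars.{u} (proj I)).obj M) ↔
      IsTorsionOver (inclOf (h.equiv hq)) M := by
  have := h.isMaximal
  have : IsDomain (𝕜[X] ⧸ 𝔞) := Ideal.Quotient.isDomain 𝔞
  have := isIntegral_quotient 𝔞
  constructor
  · intro ht v
    obtain ⟨d, hd, hdv⟩ := ht v
    refine ⟨laurentInclusion _ d, fun h0 => hd (laurentInclusion_injective (h0.trans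
      (map_zero (laurentInclusion (𝕜 := 𝕜) (𝕜[X] ⧸ 𝔞))).symm)), ?_⟩
    rw [h.inclOf_laurentInclusion hq]
    exact hdv
  · intro ht v
    obtain ⟨d, hd, hdv⟩ := ht v
    obtain ⟨d₀, hd₀, e, he⟩ := exists_laurentInclusion_mem (𝕜 := 𝕜) hd
    refine ⟨d₀, hd₀, ?_⟩
    change proj I (inclD q d₀) • (v : M) = 0
    rw [← h.inclOf_laurentInclusion hq, he, mul_comm, map_mul, mul_smul]
    exact (congrArg (fun w : M => inclOf (h.equiv hq) e • w) hdv).trans (smul_zero (A := M) _)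

/-- As `I` is maximal, a nonzero module killed by `I` has annihilator exactly `I`. -/
theorem bijOn_inflate :
    Set.BijOn (inflate (proj I)) (simpleTorsion (inclOf (h.equiv hq))) (torsionAt q I) := by
  refine ⟨?_, (inflate_injective I).injOn, ?_⟩
  · rintro _ ⟨M, hM, ht, rfl⟩
    have hs := (isSimpleModule_restrictScalars I M).2 hM
    refine ⟨_, hs, (h.isTorsionOver_iff hq M).2 ht, ?_, rfl⟩
    have := IsSimpleModule.nontrivial (Alg q) ((ModuleCat.restrictScalars.{u} (proj I)).obj M)
    exact ((h.isCoatom hq).le_iff.1 (le_ann_restrictScalars I M)).resolve_left (ann_ne_top _)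
  · rintro _ ⟨M, hM, ht, hann, rfl⟩
    have hann : ann M = I := hann
    obtain ⟨N, ⟨i⟩⟩ := exists_restrictScalars_iso I hann.ge
    let e := i.toLinearEquiv
    refine ⟨isoClass N, ⟨N, ?_, ?_, rfl⟩, Quotient.sound ⟨i⟩⟩
    · rw [← isSimpleModule_restrictScalars]
      exact IsSimpleModule.congr e
    · rw [← h.isTorsionOver_iff hq]
      intro v
      obtain ⟨d, hd, hdv⟩ := ht (e v)
      refine ⟨d, hd, ?_⟩
      rw [← map_smul] at hdv
      exact e.map_eq_zero_iff.1 hdv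

theorem orbitClassification : OrbitClassification (rho q 𝔞) (inclOf (h.equiv hq)) :=
  have := h.isMaximal
  orbitClassification_rho hq 𝔞 _

include h hq in
theorem torsionAt_nonempty : (torsionAt q I).Nonempty := by
  have := h.isMaximal
  have : Nontrivial (𝕜[X] ⧸ 𝔞) := Ideal.Quotient.nontrivial_iff.2 h.isMaximal.ne_top
  obtain ⟨𝔪, h𝔪⟩ := Ideal.exists_maximal ((𝕜[X] ⧸ 𝔞)[T;T⁻¹])
  obtain ⟨e, -⟩ := h.orbitClassification hq
  exact ⟨_, (h.bijOn_inflate hq).mapsTo (e ⟨_, 𝔪, h𝔪, rfl⟩).2⟩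

end TorusIdeal

end TorusInflation


/-! ### Annihilators, the faithful module and finite-dimensional modules -/

section

variable {𝕜 : Type u} [Field 𝕜] {q : 𝕜ˣ}

/-- A module over the ageing algebra as a vector space. -/
abbrev groundModule (q : 𝕜ˣ) (M : Type*) [AddCommGroup M] [Module (Alg q) M] : Module 𝕜 M :=
  Module.compHom M (algebraMap 𝕜 (Alg q))

theorem groundModule_isScalarTower (q : 𝕜ˣ) (M : Type*) [AddCommGroup M] [Module (Alg q) M] :
    letI := groundModule q M
    IsScalarTower 𝕜 (Alg q) M :=
  letI := groundModule q M
  ⟨fun c a v => by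
    rw [Algebra.smul_def, mul_smul]; rfl⟩

theorem ann_eq_bot_or_mem (hq : ∀ n : ℕ, 0 < n → q ^ n ≠ 1) (M : ModuleCat.{u} (Alg q))
    [IsSimpleModule (Alg q) M] (ht : IsTorsionOver (inclD q).toRingHom M) :
    ann M = ⊥ ∨ ann M ∈ maxSpec (Alg q) := by
  let := groundModule q M
  have := groundModule_isScalarTower q M
  rw [maxSpec_eq hq]
  exact annIdeal_eq_bot_or_mem hq ht

/-! ### The faithful simple module -/

theorem one_mem_of_single {P : Submodule 𝕜 (ℤ × ℤ →₀ 𝕜)} {v : ℤ × ℤ} {w : ℤ × ℤ → ℤ}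
    (h : ∀ x ∈ P, (latticeOp q v w : Module.End 𝕜 (ℤ × ℤ →₀ 𝕜)) x ∈ P) {i : ℤ × ℤ}
    (hi : Finsupp.single i (1 : 𝕜) ∈ P) : Finsupp.single (i + v) (1 : 𝕜) ∈ P := by
  have h1 := h _ hi
  rw [latticeOp_single, one_mul, ← mul_one ((q ^ w i : 𝕜ˣ) : 𝕜), ← smul_eq_mul,
    ← Finsupp.smul_single] at h1
  exact (P.smul_mem_iff (Units.ne_zero _)).1 h1

/-- A non-zero subspace that is stable under the representation on the lattice is everything. -/
theorem eq_top_of_lattice_stable (hq : ∀ n : ℕ, 0 < n → q ^ n ≠ 1)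
    {P : Submodule 𝕜 (ℤ × ℤ →₀ 𝕜)}
    (h : ∀ a : Alg q, ∀ x ∈ P, (latticeRep q (cst_ne_zero hq)).lift a x ∈ P) (hP : P ≠ ⊥) :
    P = ⊤ := by
  classical
  set r := latticeRep q (cst_ne_zero hq) with hr
  have hX : ∀ x ∈ P, (latticeOp q (1, 1) fun i => -i.1 : Module.End 𝕜 (ℤ × ℤ →₀ 𝕜)) x ∈ P :=
    fun x hx => by have := h (elt q .X) x hx; rwa [Rep.lift_X] at this
  have hY : ∀ x ∈ P, (latticeOp q (-1, 0) fun _ => 0 : Module.End 𝕜 (ℤ × ℤ →₀ 𝕜)) x ∈ P :=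
    fun x hx => by have := h (elt q .Y) x hx; rwa [Rep.lift_Y] at this
  have hphi : ∀ x ∈ P,
      (latticeOp q (1, -1) fun i => i.1 - 2 * i.2 : Module.End 𝕜 (ℤ × ℤ →₀ 𝕜)) x ∈ P :=
    fun x hx => by have := h (elemPhi q) x hx; rwa [Rep.lift_phi, latticeRep_phi] at this
  have hK : ∀ x ∈ P, (latticeOp q 0 fun i => i.1 : Module.End 𝕜 (ℤ × ℤ →₀ 𝕜)) x ∈ P :=
    fun x hx => by have := h (elt q .K) x hx; rwa [Rep.lift_K] at this
  obtain ⟨x, hx, hx0⟩ := Submodule.exists_mem_ne_zero_of_ne_bot hP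
  obtain ⟨i, hi⟩ := Finsupp.ne_iff.1 hx0
  -- `K` and `X Y φ Y` are diagonal with eigenvalues `q^(j.1)` and `q^(-2 j.2)`. Together they
  -- separate the lattice points, so `P` contains a basis vector.
  have h1 := sum_filter_mem hq _ P hK x.support (fun j => Finsupp.single j (x j)) (fun j => j.1)
    (fun j _ => by
      rw [latticeOp_single, add_zero, Finsupp.smul_single, smul_eq_mul, mul_comm])
    (by convert hx; exact x.sum_single) i.1
  have h2 := sum_filter_mem hq
    ((latticeOp q (1, 1) fun i => -i.1 : Module.End 𝕜 (ℤ × ℤ →₀ 𝕜)) *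
      (latticeOp q (-1, 0) fun _ => 0 : Module.End 𝕜 (ℤ × ℤ →₀ 𝕜)) *
      (latticeOp q (1, -1) fun i => i.1 - 2 * i.2 : Module.End 𝕜 (ℤ × ℤ →₀ 𝕜)) *
      (latticeOp q (-1, 0) fun _ => 0 : Module.End 𝕜 (ℤ × ℤ →₀ 𝕜))) P
    (fun x hx => hX _ (hY _ (hphi _ (hY _ hx)))) _ (fun j => Finsupp.single j (x j))
    (fun j => -2 * j.2)
    (fun j _ => by
      simp only [Module.End.mul_apply, latticeOp_single, Finsupp.smul_single, smul_eq_mul]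
      congr 1
      · ext <;> simp
      · simp only [mul_assoc, ← Units.val_mul, ← zpow_add]
        rw [mul_comm]
        congr 3
        simp; ring) h1 (-2 * i.2)
  have h3 : ((x.support.filter fun j => j.1 = i.1).filter fun j => -2 * j.2 = -2 * i.2) = {i} := by
    ext j
    simp only [Finset.mem_filter, Finset.mem_singleton, Finsupp.mem_support_iff]
    constructor
    · rintro ⟨⟨-, h4⟩, h5⟩
      exact Prod.ext h4 (by linarith)
    · rintro rfl
      exact ⟨⟨hi, rfl⟩, rfl⟩
  rw [h3, Finset.sum_singleton] at h2
  have h4 : Finsupp.single i (1 : 𝕜) ∈ P := by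
    rw [← mul_one (x i), ← smul_eq_mul, ← Finsupp.smul_single] at h2
    exact (P.smul_mem_iff hi).1 h2
  -- Unit steps in all four directions: `Y` goes left, `Y X` up, `Y φ` down, and `X` followed by a
  -- step down goes right.
  have step : ∀ v : ℤ × ℤ, (∀ j, Finsupp.single j (1 : 𝕜) ∈ P → Finsupp.single (j + v) (1 : 𝕜) ∈ P) →
      ∀ (n : ℕ) j, Finsupp.single j (1 : 𝕜) ∈ P → Finsupp.single (j + n • v) (1 : 𝕜) ∈ P := by
    intro v hv n j hj
    induction n with
    | zero => simpa using hj
    | succ n ih => rw [succ_nsmul, ← add_assoc]; exact hv _ ih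
  have hX' := fun j => one_mem_of_single (i := j) hX
  have hY' := fun j => one_mem_of_single (i := j) hY
  have hphi' := fun j => one_mem_of_single (i := j) hphi
  have hup : ∀ j, Finsupp.single j (1 : 𝕜) ∈ P → Finsupp.single (j + (0, 1)) (1 : 𝕜) ∈ P :=
    fun j hj => by convert hY' _ (hX' _ hj) using 2; ext <;> simp
  have hdown : ∀ j, Finsupp.single j (1 : 𝕜) ∈ P → Finsupp.single (j + (0, -1)) (1 : 𝕜) ∈ P :=
    fun j hj => by convert hY' _ (hphi' _ hj) using 2; ext <;> simp
  have hright : ∀ j, Finsupp.single j (1 : 𝕜) ∈ P → Finsupp.single (j + (1, 0)) (1 : 𝕜) ∈ P :=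
    fun j hj => by convert hdown _ (hX' _ hj) using 2; ext <;> simp
  have hall : ∀ j, Finsupp.single j (1 : 𝕜) ∈ P := fun j => by
    have h5 : j = i + (j.1 - i.1).toNat • ((1, 0) : ℤ × ℤ) + (i.1 - j.1).toNat • ((-1, 0) : ℤ × ℤ) +
        (j.2 - i.2).toNat • ((0, 1) : ℤ × ℤ) + (i.2 - j.2).toNat • ((0, -1) : ℤ × ℤ) := by
      ext <;> simp <;> omega
    rw [h5]
    exact step _ hdown _ _ (step _ hup _ _ (step _ hY' _ _ (step _ hright _ _ h4)))
  rw [eq_top_iff]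
  intro x _
  rw [← x.sum_single]
  refine Submodule.sum_mem _ fun j _ => ?_
  rw [← mul_one (x j), ← smul_eq_mul, ← Finsupp.smul_single]
  exact P.smul_mem _ (hall j)

theorem T_sub_C_ne_zero (c : 𝕜) : (LaurentPolynomial.T 1 - LaurentPolynomial.C c : 𝕜[T;T⁻¹]) ≠ 0 := by
  have h : (LaurentPolynomial.T 1 - LaurentPolynomial.C c : 𝕜[T;T⁻¹]) =
      Polynomial.toLaurent (Polynomial.X - Polynomial.C c) := by
    rw [map_sub, Polynomial.toLaurent_X, Polynomial.toLaurent_C]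
  rw [h]
  exact (map_ne_zero_iff _ Polynomial.toLaurent_injective).2 (Polynomial.X_sub_C_ne_zero c)

/-- There are faithful simple torsion modules. -/
theorem torsionAt_bot_nonempty (hq : ∀ n : ℕ, 0 < n → q ^ n ≠ 1) : (torsionAt q ⊥).Nonempty := by
  set r := latticeRep q (cst_ne_zero hq) with hr
  let _ : Module (Alg q) (ℤ × ℤ →₀ 𝕜) := Module.compHom (ℤ × ℤ →₀ 𝕜) r.lift.toRingHom
  have hsmul : ∀ (a : Alg q) (x : ℤ × ℤ →₀ 𝕜), a • x = r.lift a x := fun _ _ => rfl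
  refine ⟨_, ModuleCat.of (Alg q) (ℤ × ℤ →₀ 𝕜), ?_, ?_, ?_, rfl⟩
  · have hs : IsSimpleOrder (Submodule (Alg q) (ℤ × ℤ →₀ 𝕜)) :=
      { exists_pair_ne := ⟨⊥, ⊤, fun h => by
          have h1 : Finsupp.single (0, 0) (1 : 𝕜) ∈ (⊥ : Submodule (Alg q) (ℤ × ℤ →₀ 𝕜)) := by
            rw [h]; trivial
          rw [Submodule.mem_bot, Finsupp.single_eq_zero] at h1
          exact one_ne_zero h1⟩
        eq_bot_or_eq_top := fun P => by
          let P' : Submodule 𝕜 (ℤ × ℤ →₀ 𝕜) :=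
            { P.toAddSubmonoid with
              smul_mem' := fun c x hx => by
                have h1 := P.smul_mem (algebraMap 𝕜 (Alg q) c) hx
                rw [hsmul, AlgHom.commutes] at h1
                exact h1 }
          by_cases hP : P' = ⊥
          · left
            rw [eq_bot_iff]
            intro x hx
            have : x ∈ P' := hx
            rw [hP] at this
            exact this
          · right
            rw [eq_top_iff]
            intro x _
            have : x ∈ P' := by
              rw [eq_top_of_lattice_stable hq (fun a x hx => P.smul_mem a hx) hP]; trivial
            exact this }
    exact (isSimpleModule_iff _ _).2 hs
  · intro v
    change ∃ d : 𝕜[T;T⁻¹], d ≠ 0 ∧ inclD q d • (v : ℤ × ℤ →₀ 𝕜) = 0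
    induction v using Finsupp.induction_linear with
    | zero => exact ⟨1, one_ne_zero, smul_zero _⟩
    | add a b ha hb =>
      obtain ⟨d, hd, hda⟩ := ha
      obtain ⟨e, he, heb⟩ := hb
      refine ⟨d * e, mul_ne_zero hd he, ?_⟩
      rw [smul_add, map_mul, mul_smul, mul_smul, heb, smul_zero, add_zero, ← mul_smul, ← map_mul,
        mul_comm, map_mul, mul_smul, hda, smul_zero]
    | single i a =>
      -- The basis vector `eᵢ` is killed by `K - q^(i.1)`.
      refine ⟨_, T_sub_C_ne_zero ((q ^ i.1 : 𝕜ˣ) : 𝕜), ?_⟩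
      have h1 : inclD q (LaurentPolynomial.C ((q ^ i.1 : 𝕜ˣ) : 𝕜)) =
        algebraMap 𝕜 (Alg q) ((q ^ i.1 : 𝕜ˣ) : 𝕜) := (inclD q).commutes _
      rw [hsmul, map_sub, inclD_T_one, map_sub, Rep.lift_K, h1, AlgHom.commutes,
        LinearMap.sub_apply, Module.algebraMap_end_apply]
      change (latticeOp q 0 fun i => i.1 : Module.End 𝕜 (ℤ × ℤ →₀ 𝕜)) _ - _ = 0
      rw [latticeOp_single, add_zero, Finsupp.smul_single, smul_eq_mul, mul_comm, sub_self]
  · change ann _ = ⊥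
    rw [eq_bot_iff]
    intro a ha
    have h1 := Module.mem_annihilator.1 (Ideal.mem_toTwoSided.1 ha)
    rw [TwoSidedIdeal.mem_bot]
    refine r.lift_injective hq (latticeRep_X_isUnit _) (latticeRep_phi_isUnit _) ?_
    rw [map_zero]
    exact LinearMap.ext fun x => h1 x

/-! ### The annihilators of the simple torsion modules -/

theorem ne_bot_of_isMaximal_laurent {𝔭 : Ideal 𝕜[T;T⁻¹]} (h : 𝔭.IsMaximal) : 𝔭 ≠ ⊥ := by
  rintro rfl
  obtain ⟨𝔮, h𝔮, d, hd, hd0⟩ := exists_maximal_ne_bot 𝕜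
  exact hd0 (by rwa [← h.eq_of_le h𝔮.ne_top bot_le, Ideal.mem_bot] at hd)

/-- Divide `𝒜` by a maximal left ideal above `(Y, E, 𝔭)`. The annihilator of the quotient contains
this maximal two-sided ideal, and any nonzero element of `𝔭` shows torsion. -/
theorem torsionAt_idealP_nonempty {𝔭 : Ideal 𝕜[T;T⁻¹]} (h : 𝔭.IsMaximal) :
    (torsionAt q (idealP q 𝔭)).Nonempty := by
  have h1 : (idealP q 𝔭).asIdeal ≠ ⊤ := by
    rw [Ideal.ne_top_iff_one, TwoSidedIdeal.mem_asIdeal, TwoSidedIdeal.one_mem_iff]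
    exact idealP_ne_top h.ne_top
  obtain ⟨J, hJ, hle⟩ := Ideal.exists_le_maximal _ h1
  have hs : IsSimpleModule (Alg q) (Alg q ⧸ J) := isSimpleModule_iff_isCoatom.2 hJ.out
  have hkill : ∀ a ∈ idealP q 𝔭, ∀ v : Alg q ⧸ J, a • v = 0 := fun a ha v => by
    obtain ⟨b, rfl⟩ := Submodule.Quotient.mk_surjective J v
    rw [← Submodule.Quotient.mk_smul, Submodule.Quotient.mk_eq_zero]
    exact hle (TwoSidedIdeal.mem_asIdeal.2 ((idealP q 𝔭).mul_mem_right _ _ ha))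
  refine ⟨_, ModuleCat.of (Alg q) (Alg q ⧸ J), hs, fun v => ?_, ?_, rfl⟩
  · obtain ⟨d, hd, hd0⟩ := Submodule.exists_mem_ne_zero_of_ne_bot (ne_bot_of_isMaximal_laurent h)
    exact ⟨d, hd0, hkill _ (inclD_mem_idealP hd) v⟩
  · have : Nontrivial (ModuleCat.of (Alg q) (Alg q ⧸ J)) := IsSimpleModule.nontrivial (Alg q) _
    refine ((isCoatom_idealP (q := q) h).le_iff.1 fun a ha => ?_).resolve_left (ann_ne_top _)
    exact Ideal.mem_toTwoSided.2 (Module.mem_annihilator.2 (hkill a ha))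

theorem primTorsion_eq (hq : ∀ n : ℕ, 0 < n → q ^ n ≠ 1) :
    primTorsion q = maxSpec (Alg q) ∪ {⊥} := by
  have key : ∀ I, (torsionAt q I).Nonempty → I ∈ primTorsion q := by
    rintro I ⟨_, M, hM, ht, hann, -⟩
    exact ⟨M, hM, ht, (show ann M = I from hann).symm⟩
  refine Set.Subset.antisymm ?_ (Set.union_subset ?_ ?_)
  · rintro _ ⟨M, hM, ht, rfl⟩
    exact (ann_eq_bot_or_mem hq M ht).symm
  · rw [maxSpec_eq hq]
    rintro _ ((⟨𝔭, h, rfl⟩ | ⟨𝔮, h, h', rfl⟩) | ⟨𝔯, h, h', rfl⟩)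
    · exact key _ (torsionAt_idealP_nonempty h)
    · obtain ⟨y, hy⟩ := torusIdeal_idealQ (q := q) hq h h'
      exact key _ (hy.torsionAt_nonempty hq)
    · obtain ⟨y, hy⟩ := torusIdeal_idealR (q := q) hq h h'
      exact key _ (hy.torsionAt_nonempty hq)
  · rintro _ rfl
    exact key _ (torsionAt_bot_nonempty hq)

theorem torsionAt_eq_empty (hq : ∀ n : ℕ, 0 < n → q ^ n ≠ 1) {I : TwoSidedIdeal (Alg q)}
    (h : I ≠ ⊥) (h' : ¬ IsCoatom I) : torsionAt q I = ∅ := by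
  rw [Set.eq_empty_iff_forall_notMem]
  rintro _ ⟨M, hM, ht, hann, -⟩
  have hann : ann M = I := hann
  rcases ann_eq_bot_or_mem hq M ht with h1 | h1
  · exact h (hann.symm.trans h1)
  · exact h' (hann ▸ h1)

theorem span_singleton_ne_bot {R : Type*} [Ring R] {a : R} (h : a ≠ 0) :
    TwoSidedIdeal.span {a} ≠ ⊥ := fun e => h (by
  have : a ∈ TwoSidedIdeal.span {a} := TwoSidedIdeal.subset_span rfl
  rwa [e, TwoSidedIdeal.mem_bot] at this)

/-- `(Y)` is nonzero, as `Y` acts nontrivially on the lattice, and not maximal, as it vanishes in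
`𝕜[K^{±1}]`. -/
theorem torsionAt_Y (hq : ∀ n : ℕ, 0 < n → q ^ n ≠ 1) :
    torsionAt q (TwoSidedIdeal.span {elt q .Y}) = ∅ :=
  torsionAt_eq_empty hq (span_singleton_ne_bot (elt_Y_ne_zero hq))
    (not_isCoatom_span_of_counit (by simp [counitRep]))

theorem torsionAt_E (hq : ∀ n : ℕ, 0 < n → q ^ n ≠ 1) :
    torsionAt q (TwoSidedIdeal.span {elt q .E}) = ∅ :=
  torsionAt_eq_empty hq (span_singleton_ne_bot (elt_E_ne_zero hq))
    (not_isCoatom_span_of_counit (by simp [counitRep]))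

theorem torsionIn_eq_iUnion (S : Set (TwoSidedIdeal (Alg q))) :
    torsionIn q S = ⋃ I ∈ S, torsionAt q I := by
  ext c
  simp only [Set.mem_iUnion, exists_prop]
  constructor
  · rintro ⟨M, hM, ht, hann, rfl⟩
    exact ⟨ann M, hann, M, hM, ht, rfl, rfl⟩
  · rintro ⟨I, hI, M, hM, ht, hann, rfl⟩
    exact ⟨M, hM, ht, (show ann M = I from hann) ▸ hI, rfl⟩

theorem pairwiseDisjoint_torsionAt (S : Set (TwoSidedIdeal (Alg q))) :
    S.PairwiseDisjoint (torsionAt q) := by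
  intro I _ J _ hne
  rw [Function.onFun, Set.disjoint_left]
  rintro _ ⟨M, _, _, hM, rfl⟩ ⟨N, _, _, hN, e⟩
  exact hne ((show ann M = I from hM).symm.trans ((ann_eq_of_isoClass e).trans hN))

/-! ### Finite-dimensional modules -/

section FiniteDim

variable {M : Type*} [AddCommGroup M] [Module 𝕜 M] [Module (Alg q) M] [IsScalarTower 𝕜 (Alg q) M]

/-- Cayley–Hamilton for the action of `K`. -/
theorem exists_smul_eq_zero_of_finite [Module.Finite 𝕜 M] :
    ∃ d : 𝕜[T;T⁻¹], d ≠ 0 ∧ ∀ v : M, inclD q d • v = 0 := by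
  let p := ((modRep q M).K : Module.End 𝕜 M).charpoly
  have hp : p ≠ 0 := (LinearMap.charpoly_monic _).ne_zero
  refine ⟨Polynomial.toLaurent p, (map_ne_zero_iff _ Polynomial.toLaurent_injective).2 hp,
    fun v => ?_⟩
  have h1 : ((laurentHom (k := 𝕜) (modRep q M).K).comp Polynomial.toLaurentAlg) =
      Polynomial.aeval ((modRep q M).K : Module.End 𝕜 M) := by
    apply Polynomial.algHom_ext
    rw [AlgHom.comp_apply, Polynomial.aeval_X]
    change laurentHom (k := 𝕜) _ (Polynomial.toLaurent Polynomial.X) = _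
    rw [Polynomial.toLaurent_X, laurentHom_T, zpow_one]
  have h2 := DFunLike.congr_fun h1 p
  rw [LinearMap.aeval_self_charpoly] at h2
  rw [← modRep_laurentHom]
  exact LinearMap.congr_fun h2 v

variable [IsSimpleModule (Alg q) M]

/-- `𝒜` acts through `D`, so `M = D v` is a quotient of the finite extension `D/𝔭`. -/
theorem finite_of_annIdeal_eq {𝔭 : Ideal 𝕜[T;T⁻¹]} [𝔭.IsMaximal]
    (h : annIdeal q M = idealP q 𝔭) : Module.Finite 𝕜 M := by
  have := IsSimpleModule.nontrivial (Alg q) M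
  obtain ⟨v, hv0⟩ := exists_ne (0 : M)
  have hzero : ∀ a ∈ idealP q 𝔭, a • v = 0 := fun a ha => by
    have h1 := LinearMap.congr_fun (mem_annIdeal.1 (h ▸ ha)) v
    rwa [modRep_lift] at h1
  have hv : Killed (inclD q).toRingHom 𝔭 v := fun d hd => hzero _ (inclD_mem_idealP hd)
  obtain ⟨n, t, ht⟩ := exists_finite_generators hv
  refine ⟨Submodule.fg_def.2 ⟨Set.range fun i => inclD q (t i) • v, Set.finite_range _, ?_⟩⟩
  rw [eq_top_iff]
  intro w _
  obtain ⟨a, rfl⟩ := IsSimpleModule.toSpanSingleton_surjective (Alg q) hv0 w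
  have h2 := hzero _ (sub_inclD_counit_mem q (Y_mem_idealP 𝔭) (E_mem_idealP 𝔭) a)
  rw [sub_smul, sub_eq_zero] at h2
  obtain ⟨c, hc⟩ := ht ((counitRep q).lift a)
  rw [LinearMap.toSpanSingleton_apply, h2, hc]
  exact Submodule.sum_mem _ fun i _ => Submodule.smul_mem _ _ (Submodule.subset_span ⟨i, rfl⟩)

theorem not_isUnit_of_finite (hq : ∀ n : ℕ, 0 < n → q ^ n ≠ 1) [Module.Finite 𝕜 M]
    {x : Module.End 𝕜 M} {n : ℤ} (hn : n ≠ 0) (hx : QComm q n x (modRep q M).K) : ¬ IsUnit x := by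
  intro hu
  have := IsSimpleModule.nontrivial (Alg q) M
  have h := pow_finrank_eq_one hu (modRep q M).K.isUnit hx.eq
  have h1 : q ^ (n * Module.finrank 𝕜 M) = q ^ (0 : ℤ) := by
    refine Units.ext ?_
    rw [zpow_mul, zpow_natCast, Units.val_pow_eq_pow_val, h]; simp
  have h2 := zpow_injective hq h1
  have h3 : Module.finrank 𝕜 M ≠ 0 := Module.finrank_pos.ne'
  exact mul_ne_zero hn (by exact_mod_cast h3) h2

/-- On a finite-dimensional module no operator of nonzero weight is invertible. So the normal
element `X` vanishes, which makes `E` and `Y` normal, and they vanish for the same reason. -/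
theorem Y_E_mem_annIdeal_of_finite (hq : ∀ n : ℕ, 0 < n → q ^ n ≠ 1) [Module.Finite 𝕜 M] :
    elt q .Y ∈ annIdeal q M ∧ elt q .E ∈ annIdeal q M := by
  set r := modRep q M with hr
  have hX : r.X = 0 := (eq_zero_or_isUnit_of_isSimpleModule Rep.normal_X).resolve_right
    (not_isUnit_of_finite hq (by norm_num) r.XK)
  have hE : r.E = 0 := (eq_zero_or_isUnit_of_isSimpleModule (Rep.normal_E_of_X hX)).resolve_right
    (not_isUnit_of_finite hq (by norm_num) r.EK)
  have hY : r.Y = 0 := (eq_zero_or_isUnit_of_isSimpleModule (Rep.normal_Y_of_X hX)).resolve_right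
    (not_isUnit_of_finite hq (by norm_num) r.YK)
  exact ⟨mem_annIdeal.2 (by rw [Rep.lift_Y, hY]), mem_annIdeal.2 (by rw [Rep.lift_E, hE])⟩

end FiniteDim

theorem torsionIn_famP (hq : ∀ n : ℕ, 0 < n → q ^ n ≠ 1) : torsionIn q (famP q) = finDim q := by
  refine Set.Subset.antisymm ?_ ?_
  · rintro _ ⟨M, hM, ht, ⟨𝔭, h𝔭, hann⟩, rfl⟩
    let := groundModule q M
    have := groundModule_isScalarTower q M
    have h : Module.Finite 𝕜 M := finite_of_annIdeal_eq (𝔭 := 𝔭) hann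
    exact ⟨M, hM, h, rfl⟩
  · rintro _ ⟨M, hM, hfin, rfl⟩
    let := groundModule q M
    have := groundModule_isScalarTower q M
    have hfin : Module.Finite 𝕜 M := hfin
    obtain ⟨d, hd, hdM⟩ := exists_smul_eq_zero_of_finite (q := q) (M := M)
    have ht : IsTorsionOver (inclD q).toRingHom M := fun v => ⟨d, hd, hdM v⟩
    obtain ⟨hY, hE⟩ := Y_E_mem_annIdeal_of_finite (M := M) hq
    refine ⟨M, hM, ht, ?_, rfl⟩
    refine mem_famP_of_isCoatom ((ann_eq_bot_or_mem hq M ht).resolve_left fun h => ?_) hY hE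
    have hY : elt q .Y ∈ ann M := hY
    rw [h, TwoSidedIdeal.mem_bot] at hY
    exact elt_Y_ne_zero hq hY

end

end

end Ageing

open Ageing in
theorem theorem4 {𝕜 : Type u} [Field 𝕜] (q : 𝕜ˣ) (hq : ∀ n : ℕ, 0 < n → q ^ n ≠ 1) :
    -- the annihilators of the simple `D`-torsion modules
    (primTorsion q = maxSpec (Alg q) ∪ {⊥} ∧ ⊥ ∉ maxSpec (Alg q)) ∧
    (torsionAt q (TwoSidedIdeal.span {elt q .Y}) = ∅ ∧
      torsionAt q (TwoSidedIdeal.span {elt q .E}) = ∅) ∧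
    -- the maximal ideals
    (maxSpec (Alg q) = famP q ∪ famQ q ∪ famR q ∧
      Disjoint (famP q) (famQ q) ∧ Disjoint (famP q) (famR q) ∧ Disjoint (famQ q) (famR q)) ∧
    -- the family `𝒫`
    torsionIn q (famP q) = finDim q ∧
    -- the family `𝒬`
    (torsionIn q (famQ q) = ⋃ I ∈ famQ q, torsionAt q I) ∧
    (famQ q).PairwiseDisjoint (torsionAt q) ∧
    (∀ 𝔮 : Ideal 𝕜[X], 𝔮.IsMaximal → 𝔮 ≠ Ideal.span {Polynomial.X} →
      ∃ Φ : SkewLaurent (rho q 𝔮) ≃+* Factor (idealQ q 𝔮),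
        (∀ f : 𝕜[X], Φ (SkewLaurent.const _ (LaurentPolynomial.C (Ideal.Quotient.mk 𝔮 f))) =
          proj (idealQ q 𝔮) (Polynomial.aeval (elemZ q) f)) ∧
        Φ (SkewLaurent.const _ (LaurentPolynomial.T 1)) = proj (idealQ q 𝔮) (elt q .K) ∧
        Φ (SkewLaurent.var _) = proj (idealQ q 𝔮) (elt q .Y) ∧
        Set.BijOn (inflate (proj (idealQ q 𝔮))) (simpleTorsion (inclOf Φ))
          (torsionAt q (idealQ q 𝔮)) ∧
        OrbitClassification (rho q 𝔮) (inclOf Φ)) ∧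
    -- the family `ℛ`
    (torsionIn q (famR q) = ⋃ I ∈ famR q, torsionAt q I) ∧
    (famR q).PairwiseDisjoint (torsionAt q) ∧
    (∀ 𝔯 : Ideal 𝕜[X], 𝔯.IsMaximal → 𝔯 ≠ Ideal.span {Polynomial.X} →
      ∃ Φ : SkewLaurent (rho q 𝔯) ≃+* Factor (idealR q 𝔯),
        (∀ f : 𝕜[X], Φ (SkewLaurent.const _ (LaurentPolynomial.C (Ideal.Quotient.mk 𝔯 f))) =
          proj (idealR q 𝔯) (Polynomial.aeval (elemC q) f)) ∧
        Φ (SkewLaurent.const _ (LaurentPolynomial.T 1)) = proj (idealR q 𝔯) (elt q .K) ∧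
        Φ (SkewLaurent.var _) = proj (idealR q 𝔯) (elt q .Y) ∧
        Set.BijOn (inflate (proj (idealR q 𝔯))) (simpleTorsion (inclOf Φ))
          (torsionAt q (idealR q 𝔯)) ∧
        OrbitClassification (rho q 𝔯) (inclOf Φ)) ∧
    -- annihilator zero
    (torsionAt q ⊥).Nonempty := by
  refine ⟨⟨primTorsion_eq hq, not_isCoatom_bot⟩, ⟨torsionAt_Y hq, torsionAt_E hq⟩,
    ⟨maxSpec_eq hq, disjoint_famP_famQ hq, disjoint_famP_famR hq, disjoint_famQ_famR hq⟩,
    torsionIn_famP hq, torsionIn_eq_iUnion _, pairwiseDisjoint_torsionAt _, fun 𝔮 h h' => ?_,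
    torsionIn_eq_iUnion _, pairwiseDisjoint_torsionAt _, fun 𝔯 h h' => ?_,
    torsionAt_bot_nonempty hq⟩
  · obtain ⟨y, hy⟩ := torusIdeal_idealQ (q := q) hq h h'
    exact ⟨hy.equiv hq, hy.equiv_C hq, hy.equiv_T hq, hy.equiv_var hq, hy.bijOn_inflate hq,
      hy.orbitClassification hq⟩
  · obtain ⟨y, hy⟩ := torusIdeal_idealR (q := q) hq h h'
    exact ⟨hy.equiv hq, hy.equiv_C hq, hy.equiv_T hq, hy.equiv_var hq, hy.bijOn_inflate hq,
      hy.orbitClassification hq⟩
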